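/- **Setting.** Let $p$ be a prime, $F$ a finite extension of $\mathbf Q_p$ with ring of integers $O_F$, residue field $k_F$ of cardinality $q$ and uniformizer $\pi$. Let $k$ be a perfect field containing $k_F$ (not necessarily algebraically closed). Put $L=F\otimes_{W(k_F)}W(k)$, a finite totally ramified extension of the fraction field of $W(k)$, with ring of integers $O_L$, and let $\sigma=\mathrm{id}\otimes\sigma_0$, where $\sigma_0$ is the automorphism of $W(k)$ induced by $x\mapsto x^q$ on $k$. An *isocrystal* is a finite-dimensional $L$-vector space $D$ with a bijective $\sigma$-linear map $\varphi:D\to D$; a *sub-isocrystal* is an $L$-subspace $D'$ with $\varphi(D')=D'$. An isocrystal is *isoclinic of slope* $\alpha\in\mathbf Q$ if $\alpha=r/s$ for some $r,s\in\mathbf Z$, $s\ge 1$, such that $\varphi^s(M)=\pi^rM$ for some $O_L$-lattice $M$ of it. Let $D_\alpha$ be the largest sub-isocrystal of $D$ that is isoclinic of slope $\alpha$, and put $|\nu(D,\varphi)|=\sum_{\alpha}\alpha\dim_L D_\alpha$ (the sum of the slopes of $D$, counted with multiplicity). Let $(D,\varphi)$ be an isocrystal of dimension $d$. A *filtration* $\mathcal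 F^\bullet$ of $D$ is a decreasing, exhaustive and separated filtration by $L$-subspaces indexed by $\mathbf Z$; put $|\mu(\mathcal F^\bullet)|=\sum_i i\,\dim_L \mathrm{gr}^i_{\mathcal F}$. For $\mu=(\mu_1\ge\dots\ge\mu_d)\in(\mathbf Z^d)_+$, the filtration is *of type* $\mu$ if $\dim_L \mathrm{gr}^i_{\mathcal F}=\#\{j:\mu_j=i\}$ for all $i$. It is *admissible* if $|\mu(\mathcal F^\bullet)|=|\nu(D,\varphi)|$ and, for every sub-isocrystal $D'$ of $D$, the filtration $\mathcal F^\bullet\cap D'$ induced on $D'$ satisfies $|\mu(\mathcal F^\bullet\cap D')|\le|\nu(D',\varphi|_{D'})|$. An $O_L$-lattice $M$ of $D$ (a finitely generated $O_L$-submodule spanning $D$ over $L$) is *of type* $\mu$ if it has an $O_L$-basis $e_1,\dots,e_d$ such that $\pi^{\mu_1}e_1,\dots,\pi^{\mu_d}e_d$ is an $O_L$-basis of $\varphi(M)$. **Proposition.** For every isocrystal $(D,\varphi)$ of dimension $d$ and every $\mu\in(\mathbf Z^d)_+$, the following are equivalent: (i) there is an admissible filtration of type $\mu$ on $D$; (ii)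 there is an $O_L$-lattice of type $\mu$ in $D$. -/

import Mathlib

open scoped TensorProduct

noncomputable section

namespace FilteredIsocrystal

/-! ### The base field `F` -/

section BaseField

variable (p : ℕ) [Fact p.Prime] (F : Type*) [Field F] [Algebra ℚ_[p] F]
  [Algebra ℤ_[p] F] [IsScalarTower ℤ_[p] ℚ_[p] F]

/-- The ring of integers `O_F` of a finite extension `F` of `ℚ_p`. -/
abbrev OF : Subalgebra ℤ_[p] F := integralClosure ℤ_[p] F

variable [FiniteDimensional ℚ_[p] F]

theorem finite_OF : Module.Finite ℤ_[p] (OF p F) :=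
  IsIntegralClosure.finite ℤ_[p] ℚ_[p] F (OF p F)

theorem mem_OF_iff (x : F) : x ∈ OF p F ↔ spectralNorm ℚ_[p] F x ≤ 1 := by
  have hx : IsIntegral ℚ_[p] x := Algebra.IsIntegral.isIntegral x
  rw [spectralNorm, spectralValue_le_one_iff (minpoly.monic hx), mem_integralClosure_iff]
  constructor
  · intro h n
    rw [minpoly.isIntegrallyClosed_eq_field_fractions' ℚ_[p] h, Polynomial.coeff_map,
      PadicInt.algebraMap_apply]
    exact PadicInt.norm_le_one _
  · intro h
    have hl : minpoly ℚ_[p] x ∈ Polynomial.lifts (algebraMap ℤ_[p] ℚ_[p]) := by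
      rw [Polynomial.lifts_iff_coeff_lifts]
      intro n
      exact ⟨⟨_, h n⟩, rfl⟩
    obtain ⟨q, hq, -, hm⟩ := Polynomial.lifts_and_natDegree_eq_and_monic hl (minpoly.monic hx)
    refine ⟨q, hm, ?_⟩
    have := minpoly.aeval ℚ_[p] x
    rw [← hq, Polynomial.aeval_map_algebraMap] at this
    exact this

theorem isUnit_OF_iff (x : OF p F) : IsUnit x ↔ ¬ spectralNorm ℚ_[p] F (x : F) < 1 := by
  have hmul : ∀ a b : F, spectralNorm ℚ_[p] F (a * b) =
      spectralNorm ℚ_[p] F a * spectralNorm ℚ_[p] F b := fun a b =>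
    spectralAlgNorm_mul (K := ℚ_[p]) a b
  have hone : spectralNorm ℚ_[p] F (1 : F) = 1 := spectralNorm_one
  constructor
  · rintro hu hlt
    obtain ⟨y, hy⟩ := hu.exists_right_inv
    have h1 : spectralNorm ℚ_[p] F ((x : F) * (y : F)) = 1 := by
      rw [← hone]; congr 1; exact_mod_cast congrArg Subtype.val hy
    rw [hmul] at h1
    have h2 := (mem_OF_iff p F y).1 y.2
    have h3 := spectralNorm_nonneg (K := ℚ_[p]) (x : F)
    have h4 := spectralNorm_nonneg (K := ℚ_[p]) (y : F)
    nlinarith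
  · intro h
    have hx0 : (x : F) ≠ 0 := by
      intro h0; apply h; rw [h0, spectralNorm_zero]; norm_num
    have hxy : (x : F) * (x : F)⁻¹ = 1 := mul_inv_cancel₀ hx0
    have h1 : spectralNorm ℚ_[p] F (x : F) * spectralNorm ℚ_[p] F ((x : F)⁻¹) = 1 := by
      rw [← hmul, hxy, hone]
    have h4 := spectralNorm_nonneg (K := ℚ_[p]) ((x : F)⁻¹)
    have hinv : (x : F)⁻¹ ∈ OF p F := by
      rw [mem_OF_iff]
      push Not at h
      nlinarith
    exact IsUnit.of_mul_eq_one ⟨(x : F)⁻¹, hinv⟩ (Subtype.ext hxy)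

instance isLocalRing_OF : IsLocalRing (OF p F) := by
  refine IsLocalRing.of_nonunits_add ?_
  intro a b ha hb
  rw [mem_nonunits_iff, isUnit_OF_iff, not_not] at ha hb ⊢
  have := isNonarchimedean_spectralNorm (K := ℚ_[p]) (L := F) (a : F) (b : F)
  exact lt_of_le_of_lt this (max_lt ha hb)

theorem mem_maximalIdeal_iff (x : OF p F) :
    x ∈ IsLocalRing.maximalIdeal (OF p F) ↔ spectralNorm ℚ_[p] F (x : F) < 1 := by
  rw [IsLocalRing.mem_maximalIdeal, mem_nonunits_iff, isUnit_OF_iff, not_not]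

/-- The residue field `k_F`. -/
abbrev KF : Type _ := IsLocalRing.ResidueField (OF p F)

theorem not_isUnit_p : ¬ IsUnit ((p : ℕ) : OF p F) := by
  intro h
  obtain ⟨y, hy⟩ := h.exists_right_inv
  have hi : IsIntegral ℤ_[p] (algebraMap ℚ_[p] F ((p : ℚ_[p])⁻¹)) := by
    have hp0 : (p : F) ≠ 0 := by
      have : CharZero F := charZero_of_injective_algebraMap (algebraMap ℚ_[p] F).injective
      exact_mod_cast (Fact.out : p.Prime).ne_zero
    have h1 : (p : F) * (y : F) = 1 := by exact_mod_cast congrArg Subtype.val hy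
    have : algebraMap ℚ_[p] F ((p : ℚ_[p])⁻¹) = (y : F) := by
      rw [map_inv₀, map_natCast]
      exact inv_eq_of_mul_eq_one_right h1
    rw [this]; exact y.2
  have hi2 : IsIntegral ℤ_[p] ((p : ℚ_[p])⁻¹) :=
    (isIntegral_algebraMap_iff (algebraMap ℚ_[p] F).injective).1 hi
  obtain ⟨z, hz⟩ := IsIntegrallyClosed.isIntegral_iff.1 hi2
  have hz1 := PadicInt.norm_le_one z
  rw [PadicInt.algebraMap_apply] at hz
  rw [PadicInt.norm_def, hz, norm_inv, Padic.norm_p, inv_inv] at hz1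
  have : (1 : ℝ) < p := by exact_mod_cast (Fact.out : p.Prime).one_lt
  linarith

instance fact_not_isUnit_p : Fact (¬ IsUnit ((p : ℕ) : OF p F)) := ⟨not_isUnit_p p F⟩

instance charP_KF : CharP (KF p F) p := by
  apply (CharP.charP_iff_prime_eq_zero (Fact.out : p.Prime)).2
  rw [← map_natCast (IsLocalRing.residue (OF p F)), IsLocalRing.residue_eq_zero_iff]
  exact not_isUnit_p p F

instance finite_KF : Finite (KF p F) := by
  have := finite_OF p F
  have hinj : Function.Injective (algebraMap ℤ_[p] F) := by
    rw [IsScalarTower.algebraMap_eq ℤ_[p] ℚ_[p] F]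
    exact (algebraMap ℚ_[p] F).injective.comp Subtype.val_injective
  have : FaithfulSMul ℤ_[p] (OF p F) := by
    rw [faithfulSMul_iff_algebraMap_injective]
    intro a b hab
    exact hinj (congrArg Subtype.val hab)
  have : Finite (IsLocalRing.ResidueField ℤ_[p]) :=
    Finite.of_equiv _ (PadicInt.residueField (p := p)).symm.toEquiv
  exact IsLocalRing.ResidueField.finite_of_finite (R := ℤ_[p]) this

instance isAdicComplete_OF : IsAdicComplete (Ideal.span {((p : ℕ) : OF p F)}) (OF p F) := by
  have := finite_OF p F
  have hpre : IsPrecomplete (IsLocalRing.maximalIdeal ℤ_[p]) (OF p F) := by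
    rw [← AdicCompletion.of_surjective_iff]
    intro x
    obtain ⟨t, rfl⟩ := AdicCompletion.ofTensorProduct_surjective_of_finite
      (IsLocalRing.maximalIdeal ℤ_[p]) (OF p F) x
    induction t with
    | zero => exact ⟨0, by simp⟩
    | add a b ha hb =>
      obtain ⟨a', ha⟩ := ha
      obtain ⟨b', hb⟩ := hb
      exact ⟨a' + b', by rw [map_add, map_add, ha, hb]⟩
    | tmul r m =>
      obtain ⟨r', rfl⟩ := AdicCompletion.of_surjective (IsLocalRing.maximalIdeal ℤ_[p]) ℤ_[p] r
      refine ⟨r' • m, ?_⟩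
      rw [AdicCompletion.ofTensorProduct_tmul]
      ext n
      rfl
  have hc : IsAdicComplete (IsLocalRing.maximalIdeal ℤ_[p]) (OF p F) :=
    { toIsHausdorff := inferInstance, toIsPrecomplete := hpre }
  have := (IsAdicComplete.map_algebraMap_iff (I := IsLocalRing.maximalIdeal ℤ_[p])
    (S := OF p F) (M := OF p F)).2 hc
  rwa [PadicInt.maximalIdeal_eq_span_p, Ideal.map_span, Set.image_singleton, map_natCast] at this


/-- The residue map factored through `O_F / p`. -/
def modPToKF : ModP (OF p F) p →+* KF p F :=
  Ideal.Quotient.lift _ (IsLocalRing.residue (OF p F)) (by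
    intro a ha
    rw [IsLocalRing.residue_eq_zero_iff]
    refine (Ideal.span_singleton_le_iff_mem _).2 ?_ ha
    exact not_isUnit_p p F)

theorem isNilpotent_ker_modPToKF : IsNilpotent (RingHom.ker (modPToKF p F)) := by
  have := finite_OF p F
  have : IsNoetherianRing (OF p F) := IsNoetherianRing.of_finite ℤ_[p] _
  rw [Ideal.FG.isNilpotent_iff_le_nilradical (IsNoetherian.noetherian _)]
  intro y hy
  obtain ⟨x, rfl⟩ := Ideal.Quotient.mk_surjective y
  have hx : x ∈ IsLocalRing.maximalIdeal (OF p F) := by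
    rw [← IsLocalRing.residue_eq_zero_iff]; exact hy
  have hlt := (mem_maximalIdeal_iff p F x).1 hx
  have hp : (0 : ℝ) < (p : ℝ)⁻¹ := by
    have := (Fact.out : p.Prime).pos
    positivity
  obtain ⟨n, hn⟩ := exists_pow_lt_of_lt_one hp hlt
  refine ⟨n, Ideal.mem_bot.1 ?_⟩
  rw [← map_pow, Ideal.mem_bot, Ideal.Quotient.eq_zero_iff_mem, Ideal.mem_span_singleton]
  have hmem : algebraMap ℚ_[p] F ((p : ℚ_[p])⁻¹) * (x : F) ^ n ∈ OF p F := by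
    rw [mem_OF_iff]
    have h1 : spectralNorm ℚ_[p] F (algebraMap ℚ_[p] F ((p : ℚ_[p])⁻¹) * (x : F) ^ n) =
        p * spectralNorm ℚ_[p] F (x : F) ^ n := by
      have h2 := map_mul (spectralMulAlgNorm ℚ_[p] F)
        (algebraMap ℚ_[p] F ((p : ℚ_[p])⁻¹)) ((x : F) ^ n)
      have h3 := map_pow (spectralMulAlgNorm ℚ_[p] F) (x : F) n
      rw [h3] at h2
      simp only [spectralMulAlgNorm_def] at h2
      rw [h2, spectralNorm_extends, norm_inv, Padic.norm_p, inv_inv]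
    rw [h1]
    have h4 : (p : ℝ) * (p : ℝ)⁻¹ = 1 := mul_inv_cancel₀ (inv_pos.1 hp).ne'
    have := mul_lt_mul_of_pos_left hn (inv_pos.1 hp)
    linarith
  refine ⟨⟨_, hmem⟩, Subtype.ext ?_⟩
  have hp0 : (p : ℚ_[p]) ≠ 0 := by exact_mod_cast (Fact.out : p.Prime).ne_zero
  have h5 : (p : F) * algebraMap ℚ_[p] F ((p : ℚ_[p])⁻¹) = 1 := by
    rw [← map_natCast (algebraMap ℚ_[p] F) p, ← map_mul, mul_inv_cancel₀ hp0, map_one]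
  change (x : F) ^ n = (p : F) * (algebraMap ℚ_[p] F ((p : ℚ_[p])⁻¹) * (x : F) ^ n)
  rw [← mul_assoc, h5, one_mul]

/-- The residue map `O_F / p → k_F` has a (multiplicative and additive) section: the Teichmüller
lift modulo `p`. -/
theorem exists_section_modPToKF : ∃ h : KF p F →+* ModP (OF p F) p,
    (modPToKF p F).comp h = RingHom.id _ := by
  obtain ⟨N, hN⟩ := isNilpotent_ker_modPToKF p F
  have hsurj : Function.Surjective (modPToKF p F) := by
    intro y
    obtain ⟨x, rfl⟩ := IsLocalRing.residue_surjective y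
    exact ⟨Ideal.Quotient.mk _ x, rfl⟩
  have hker : RingHom.ker (modPToKF p F) ≤ RingHom.ker (iterateFrobenius (ModP (OF p F) p) p N) := by
    intro y hy
    rw [RingHom.mem_ker, iterateFrobenius_def]
    have h1 : y ^ N = 0 := by
      have := Ideal.pow_mem_pow hy N
      rwa [hN] at this
    exact pow_eq_zero_of_le (Nat.lt_pow_self (Fact.out : p.Prime).one_lt).le h1
  let g : KF p F →+* ModP (OF p F) p := (modPToKF p F).liftOfSurjective hsurj ⟨_, hker⟩
  have hg : ∀ y, g (modPToKF p F y) = y ^ p ^ N := fun y =>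
    RingHom.liftOfSurjective_comp_apply _ hsurj ⟨_, hker⟩ y
  refine ⟨g.comp (iterateFrobeniusEquiv (KF p F) p N).symm.toRingHom, ?_⟩
  ext z
  obtain ⟨y, hy⟩ := hsurj ((iterateFrobeniusEquiv (KF p F) p N).symm z)
  simp only [RingHom.comp_apply, RingEquiv.toRingHom_eq_coe, RingHom.coe_coe, RingHom.id_apply]
  rw [← hy, hg, map_pow, hy, ← iterateFrobeniusEquiv_def, RingEquiv.apply_symm_apply]

/-- The Teichmüller section `k_F → O_F / p` of the residue map. -/
def sectionModP : KF p F →+* ModP (OF p F) p := (exists_section_modPToKF p F).choose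

/-- The canonical embedding `W(k_F) → O_F`: the unique ring homomorphism which induces the identity
on residue fields. -/
def wittToOF : WittVector p (KF p F) →+* OF p F :=
  (WittVector.fontaineTheta (OF p F) p).comp
    (WittVector.map (show KF p F →+* PreTilt (OF p F) p from
      Perfection.lift p (KF p F) (ModP (OF p F) p) (sectionModP p F)))

theorem residue_wittToOF (x : WittVector p (KF p F)) :
    IsLocalRing.residue (OF p F) (wittToOF p F x) = x.coeff 0 := by
  have h1 := WittVector.mk_fontaineTheta (R := OF p F) (p := p)
    (WittVector.map (show KF p F →+* PreTilt (OF p F) p from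
      Perfection.lift p (KF p F) (ModP (OF p F) p) (sectionModP p F)) x)
  rw [WittVector.map_coeff] at h1
  have h2 := congrArg (modPToKF p F) h1
  have h3 : modPToKF p F (sectionModP p F (x.coeff 0)) = x.coeff 0 :=
    congrFun (congrArg DFunLike.coe (exists_section_modPToKF p F).choose_spec) (x.coeff 0)
  exact h2.trans h3

end BaseField

/-! ### The field `L = F ⊗_{W(k_F)} W(k)` and its Frobenius `σ` -/

section FieldL

variable (p : ℕ) [Fact p.Prime] (F : Type*) [Field F] [Algebra ℚ_[p] F]
  [Algebra ℤ_[p] F] [IsScalarTower ℤ_[p] ℚ_[p] F] [FiniteDimensional ℚ_[p] F]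
  (k : Type*) [Field k] [Algebra (KF p F) k]

/-- `F` is a `W(k_F)`-algebra through the canonical embedding `W(k_F) → O_F`. -/
instance algebraWittF : Algebra (WittVector p (KF p F)) F :=
  ((algebraMap (OF p F) F).comp (wittToOF p F)).toAlgebra

/-- `W(k)` is a `W(k_F)`-algebra by functoriality. -/
instance algebraWittWitt : Algebra (WittVector p (KF p F)) (WittVector p k) :=
  (WittVector.map (algebraMap (KF p F) k)).toAlgebra

/-- The ring `L = F ⊗_{W(k_F)} W(k)`. When `F / ℚ_p` is finite and `k` is perfect it is a field,
a totally ramified finite extension of the fraction field of `W(k)`. -/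
abbrev L : Type _ := F ⊗[WittVector p (KF p F)] WittVector p k

/-- The endomorphism `x ↦ x ^ q` of `k`, where `q = #k_F`. -/
def frobQ : k →+* k :=
  letI := Fintype.ofFinite (KF p F)
  (FiniteField.frobeniusAlgHom (KF p F) k : k →+* k)

theorem frobQ_apply (x : k) : frobQ p F k x = x ^ Nat.card (KF p F) := by
  let := Fintype.ofFinite (KF p F)
  rw [Nat.card_eq_fintype_card]
  rfl

/-- `σ₀ = W(x ↦ x ^ q)`, an endomorphism of the `W(k_F)`-algebra `W(k)`. -/
def sigma0 : WittVector p k →ₐ[WittVector p (KF p F)] WittVector p k :=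
  { WittVector.map (frobQ p F k) with
    commutes' := fun x => by
      let := Fintype.ofFinite (KF p F)
      ext n
      exact (FiniteField.frobeniusAlgHom (KF p F) k).commutes (x.coeff n) }

/-- The Frobenius `σ = id ⊗ σ₀` of `L`. -/
def sigma : L p F k →+* L p F k :=
  (Algebra.TensorProduct.map (AlgHom.id (WittVector p (KF p F)) F) (sigma0 p F k)).toRingHom

/-- The ring of integers `O_L` of `L`: the integral closure of (the image of) `W(k)` in `L`. -/
def OL : Subring (L p F k) :=
  (integralClosure
    (Algebra.TensorProduct.includeRight : WittVector p k →ₐ[WittVector p (KF p F)] L p F k).range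
    (L p F k)).toSubring

variable {p F}

/-- The power `π ^ n`, `n ∈ ℤ`, of a nonzero `π ∈ O_F`, viewed in `L`. -/
def piPow (π : OF p F) (n : ℤ) : L p F k :=
  algebraMap F (L p F k) ((π : F) ^ n)

end FieldL

/-! ### Isocrystals, slopes, filtrations and lattices

An isocrystal is a finite-dimensional `L`-vector space `D` with a bijective `σ`-linear map
`φ : D → D`. -/

section Isocrystal

variable {p : ℕ} [Fact p.Prime] {F : Type*} [Field F] [Algebra ℚ_[p] F]
  [Algebra ℤ_[p] F] [IsScalarTower ℤ_[p] ℚ_[p] F] [FiniteDimensional ℚ_[p] F]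
  {k : Type*} [Field k] [Algebra (KF p F) k]
  {D : Type*} [AddCommGroup D] [Module (L p F k) D]

/-- `D'` is (the underlying space of) a sub-isocrystal: `φ` restricts to a bijection of `D'`. -/
def IsSubisocrystal (φ : D →ₛₗ[sigma p F k] D) (D' : Submodule (L p F k) D) : Prop :=
  φ '' (D' : Set D) = D'

/-- `M` is an `O_L`-lattice of the subspace `E` of `D`. -/
def IsLatticeOf (M : Submodule (OL p F k) D) (E : Submodule (L p F k) D) : Prop :=
  M.FG ∧ Submodule.span (L p F k) (M : Set D) = E

/-- The sub-isocrystal `E` is isoclinic of slope `α`: one can write `α = r / s` with `s ≥ 1` so that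
`φ ^ s (M) = π ^ r M` for some lattice `M` of `E`. -/
def IsIsoclinic (φ : D →ₛₗ[sigma p F k] D) (π : OF p F) (E : Submodule (L p F k) D) (α : ℚ) :
    Prop :=
  IsSubisocrystal φ E ∧ ∃ (s : ℕ) (r : ℤ), 0 < s ∧ α = (r : ℚ) / (s : ℚ) ∧
    ∃ M : Submodule (OL p F k) D, IsLatticeOf M E ∧
      φ^[s] '' (M : Set D) = (fun x => piPow k π r • x) '' (M : Set D)

/-- The part of slope `α` of the sub-isocrystal `D'`, i.e. the component `D'_α` of its slope
decomposition: the largest sub-isocrystal of `D'` which is isoclinic of slope `α`. -/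
def slopePart (φ : D →ₛₗ[sigma p F k] D) (π : OF p F) (D' : Submodule (L p F k) D) (α : ℚ) :
    Submodule (L p F k) D :=
  sSup {E | E ≤ D' ∧ IsIsoclinic φ π E α}

/-- `|ν(D', φ)|`, the sum of the coordinates of the Newton vector of the sub-isocrystal `D'`: the
sum of its slopes `α`, each counted with its multiplicity `dim D'_α` (almost all of which are
zero). -/
def newtonDegree (φ : D →ₛₗ[sigma p F k] D) (π : OF p F) (D' : Submodule (L p F k) D) : ℚ :=
  ∑ᶠ α : ℚ, (Module.finrank (L p F k) (slopePart φ π D' α) : ℚ) * α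

/-- `dim gr_i` of a decreasing family of subspaces. -/
def grDim (G : ℤ → Submodule (L p F k) D) (i : ℤ) : ℕ :=
  Module.finrank (L p F k) (G i ⧸ (G (i + 1)).submoduleOf (G i))

/-- `|μ(G)|`, the sum of the jumps `i` of the filtration `G`, counted with multiplicity
`dim gr_i`. -/
def hodgeDegree (G : ℤ → Submodule (L p F k) D) : ℤ :=
  ∑ᶠ i : ℤ, (grDim G i : ℤ) * i

/-- A decreasing, exhaustive and separated `ℤ`-filtration of `D` by `L`-subspaces. -/
structure IsFiltration (Fil : ℤ → Submodule (L p F k) D) : Prop where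
  antitone : Antitone Fil
  exhaustive : ⨆ i, Fil i = ⊤
  separated : ⨅ i, Fil i = ⊥

/-- The filtration `Fil` is of type `μ`: `dim gr_i = #{j ; μ_j = i}` for all `i`. -/
def HasType {d : ℕ} (Fil : ℤ → Submodule (L p F k) D) (μ : Fin d → ℤ) : Prop :=
  ∀ i : ℤ, grDim Fil i = (Finset.univ.filter fun j => μ j = i).card

/-- Admissibility of a filtration of the isocrystal `(D, φ)`; `fun i => Fil i ⊓ D'` is the
filtration induced on `D'`. -/
structure IsAdmissible (φ : D →ₛₗ[sigma p F k] D) (π : OF p F)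
    (Fil : ℤ → Submodule (L p F k) D) : Prop where
  eq_degree : (hodgeDegree Fil : ℚ) = newtonDegree φ π ⊤
  le_degree : ∀ D' : Submodule (L p F k) D, IsSubisocrystal φ D' →
    (hodgeDegree (fun i => Fil i ⊓ D') : ℚ) ≤ newtonDegree φ π D'

/-- The family `e` is an `O_L`-basis of `N ⊆ D`. -/
def IsOLBasis {d : ℕ} (e : Fin d → D) (N : Set D) : Prop :=
  LinearIndependent (OL p F k) e ∧ (Submodule.span (OL p F k) (Set.range e) : Set D) = N

/-- The lattice `M` is of type `μ`: there is a basis `e_1, …, e_d` of `M` such that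
`π ^ μ_1 e_1, …, π ^ μ_d e_d` is a basis of `φ(M)`. -/
def LatticeHasType {d : ℕ} (φ : D →ₛₗ[sigma p F k] D) (π : OF p F)
    (M : Submodule (OL p F k) D) (μ : Fin d → ℤ) : Prop :=
  ∃ e : Fin d → D, IsOLBasis (p := p) (F := F) (k := k) e (M : Set D) ∧
    IsOLBasis (p := p) (F := F) (k := k) (fun j => piPow k π (μ j) • e j) (φ '' (M : Set D))

end Isocrystal

end FilteredIsocrystal

end

/-! Both conditions are compared through the operator Φ(M) = ∑ π^(-i) φ(M ∩ Fil^i) on O_L-submodules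
(`Phi`). A lattice and a filtration have a common adapted basis b_j with weights w_j
(`exists_adapted_basis`), so Φ(M) is spanned by the π^(-w_j) φ(b_j), and the volumes of M and Φ(M)
differ by ord det φ - ∑ w_j. On the other side, the sum of the slopes of a sub-isocrystal is the
valuation of the determinant of φ on it (`finsum_slopes_eq`). Admissibility thus compares weights
with determinants on stable subspaces.

From a lattice to a filtration (`exists_admissible`): if the π^(μ_j) e_j form a basis of φ(M), then
the vectors φ⁻¹(π^(μ_j) e_j) form a second basis of M; give them the weights μ_j. Then Φ(M) ⊆ M, and
on M ∩ D' the induced operator has an integral determinant, which is the inequality for D'. On D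
itself the determinant is a unit.

From a filtration to a lattice: it suffices to find M with Φ(M) ⊆ M (`exists_strongly_divisible`).
Equality of degrees then forces Φ(M) = M, and the π^(-v_j) φ(e_j) attached to an adapted basis e of
M are the wanted basis. Let U be the union of the chain M₀ ⊆ M₀ + Φ(M₀) ⊆ … . It is Φ-stable, and it
is the sum of a subspace H, its divisible part, and a lattice of a complement. If H = 0, take M = U.
The case H = D is impossible, because Φ preserves volumes (`fg_top_of_iSup_chain_eq_top`). Otherwise
H is a proper sub-isocrystal on which the degrees again agree: admissibility gives one inequality on
H, integrality gives one on D/H, and the total is an equality. Induction gives a lattice of H, and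
`exists_glue` extends it to D.

The residue field need not be algebraically closed, so the slope decomposition is obtained without a
classification of isocrystals. The same chain is run for ψ = π^(-r) φ^n with n = dim D and r = ord
det φ. If its union is a lattice, D is isoclinic; otherwise the divisible part has a stable
complement, made of the vectors with bounded forward orbit under a power of ψ
(`exists_compl_divisible_part`). Different slopes are independent because their growth rates differ
(`iSupIndep_of_isIsoclinicOf`).

All this takes place over an abstract complete discretely valued field; `isCompleteDV_wittOF` shows
that L is one. -/

/-- A field with a complete discrete valuation `ord` (normalised by `ord 0 = 0`), its valuation ring
`O` and a uniformizer `ϖ`. -/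
structure DVField (K : Type*) [Field K] where
  O : Subring K
  ϖ : K
  ord : K → ℤ
  ord_zero : ord 0 = 0
  ord_mul : ∀ {a b : K}, a ≠ 0 → b ≠ 0 → ord (a * b) = ord a + ord b
  mem_O : ∀ {a : K}, a ∈ O ↔ 0 ≤ ord a
  ϖ_ne : ϖ ≠ 0
  ord_ϖ : ord ϖ = 1
  complete : ∀ a : ℕ → K, (∀ n, a n ∈ O) →
    ∃ s : K, ∀ n, (s - ∑ j ∈ Finset.range n, ϖ ^ j * a j) * (ϖ ^ n)⁻¹ ∈ O

/-! ### The valuation, integral matrices and spans of bases. -/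

namespace DVField

variable {K : Type*} [Field K] (S : DVField K)

theorem ord_one : S.ord 1 = 0 := by
  have := S.ord_mul (one_ne_zero (α := K)) (one_ne_zero (α := K))
  rw [mul_one] at this
  omega

theorem ord_inv (a : K) : S.ord a⁻¹ = - S.ord a := by
  by_cases h : a = 0
  · simp [h, S.ord_zero]
  · have := S.ord_mul h (inv_ne_zero h)
    rw [mul_inv_cancel₀ h, S.ord_one] at this
    omega

theorem ord_pow (a : K) (n : ℕ) : S.ord (a ^ n) = n * S.ord a := by
  by_cases h : a = 0
  · cases n <;> simp [h, S.ord_zero, S.ord_one]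
  · induction n with
    | zero => simp [S.ord_one]
    | succ n ih => rw [pow_succ, S.ord_mul (pow_ne_zero n h) h, ih]; push_cast; ring

theorem ord_zpow (a : K) (n : ℤ) : S.ord (a ^ n) = n * S.ord a := by
  obtain ⟨m, rfl | rfl⟩ := n.eq_nat_or_neg
  · simp [S.ord_pow]
  · simp [S.ord_pow, S.ord_inv]

theorem ord_ϖ_zpow (n : ℤ) : S.ord (S.ϖ ^ n) = n := by rw [S.ord_zpow, S.ord_ϖ, mul_one]

theorem zpow_ne (n : ℤ) : S.ϖ ^ n ≠ 0 := zpow_ne_zero n S.ϖ_ne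

theorem ord_prod {ι : Type*} (s : Finset ι) (a : ι → K) (h : ∀ i ∈ s, a i ≠ 0) :
    S.ord (∏ i ∈ s, a i) = ∑ i ∈ s, S.ord (a i) := by
  classical
  induction s using Finset.induction_on with
  | empty => simp [S.ord_one]
  | insert i s hi ih =>
    rw [Finset.prod_insert hi, Finset.sum_insert hi, S.ord_mul, ih]
    · exact fun j hj => h j (Finset.mem_insert_of_mem hj)
    · exact h i (Finset.mem_insert_self _ _)
    · exact Finset.prod_ne_zero_iff.2 fun j hj => h j (Finset.mem_insert_of_mem hj)

theorem zpow_mul_mem {n : ℤ} {a : K} (ha : a ≠ 0) : S.ϖ ^ n * a ∈ S.O ↔ 0 ≤ n + S.ord a := by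
  rw [S.mem_O, S.ord_mul (S.zpow_ne n) ha, S.ord_ϖ_zpow]

theorem zpow_mem {n : ℤ} (h : 0 ≤ n) : S.ϖ ^ n ∈ S.O := by
  rw [S.mem_O, S.ord_ϖ_zpow]; exact h

theorem ϖ_mem : S.ϖ ∈ S.O := by rw [S.mem_O, S.ord_ϖ]; omega

/-- Any finite family of scalars becomes integral after multiplication with a power of `ϖ`. -/
theorem exists_zpow_mul_mem {ι : Type*} [Finite ι] (a : ι → K) :
    ∃ n : ℕ, ∀ m : ℤ, n ≤ m → ∀ i, S.ϖ ^ m * a i ∈ S.O := by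
  cases nonempty_fintype ι
  refine ⟨∑ i, (- S.ord (a i)).toNat, fun m hm i => ?_⟩
  by_cases h : a i = 0
  · rw [h, mul_zero]; exact S.O.zero_mem
  rw [S.zpow_mul_mem h]
  have : (- S.ord (a i)).toNat ≤ ∑ i, (- S.ord (a i)).toNat :=
    Finset.single_le_sum (f := fun i => (- S.ord (a i)).toNat) (fun _ _ => Nat.zero_le _)
      (Finset.mem_univ i)
  omega

theorem eq_zero_of_forall_mem {a : K} (h : ∀ n : ℕ, S.ϖ ^ (-(n : ℤ)) * a ∈ S.O) : a = 0 := by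
  by_contra h0
  have := h ((S.ord a).toNat + 1)
  rw [S.zpow_mul_mem h0] at this
  push_cast at this
  omega

/-- A nonzero element of least valuation generates. The consequence used below is that O is
Noetherian: submodules of finitely generated O-modules are finitely generated. -/
instance : IsPrincipalIdealRing S.O := by
  refine ⟨fun I => ⟨?_⟩⟩
  by_cases hI : I = ⊥
  · exact ⟨0, by simp [hI]⟩
  obtain ⟨x, hx, hx0⟩ := Submodule.exists_mem_ne_zero_of_ne_bot hI
  let P : ℕ → Prop := fun n => ∃ y ∈ I, y ≠ 0 ∧ (S.ord (y : K)).toNat = n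
  have hP : ∃ n, P n := ⟨_, x, hx, hx0, rfl⟩
  classical
  obtain ⟨y, hy, hy0, hyn⟩ := Nat.find_spec hP
  refine ⟨y, le_antisymm (fun z hz => ?_) ((Ideal.span_singleton_le_iff_mem _).2 hy)⟩
  by_cases hz0 : z = 0
  · rw [hz0]; exact Submodule.zero_mem _
  have h1 : Nat.find hP ≤ (S.ord (z : K)).toNat := Nat.find_min' hP ⟨z, hz, hz0, rfl⟩
  have hz1 := S.mem_O.1 z.2
  have hy1 := S.mem_O.1 y.2
  have hyK : (y : K) ≠ 0 := fun h => hy0 (Subtype.ext h)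
  have hzK : (z : K) ≠ 0 := fun h => hz0 (Subtype.ext h)
  have h2 : (z : K) * (y : K)⁻¹ ∈ S.O := by
    rw [S.mem_O, S.ord_mul hzK (inv_ne_zero hyK), S.ord_inv]
    omega
  refine Ideal.mem_span_singleton'.2 ⟨⟨_, h2⟩, Subtype.ext ?_⟩
  simp [hyK]

theorem smul_mem {V : Type*} [AddCommGroup V] [Module K V] (M : Submodule S.O V) {a : K}
    (ha : a ∈ S.O) {x : V} (hx : x ∈ M) : a • x ∈ M := M.smul_mem ⟨a, ha⟩ hx

section Matrix

variable {ι : Type*} [Fintype ι] [DecidableEq ι]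

theorem exists_lift {Q : Matrix ι ι K} (h : ∀ i j, Q i j ∈ S.O) :
    ∃ R : Matrix ι ι S.O, Q = S.O.subtype.mapMatrix R :=
  ⟨Matrix.of fun i j => ⟨Q i j, h i j⟩, rfl⟩

theorem det_mem {Q : Matrix ι ι K} (h : ∀ i j, Q i j ∈ S.O) : Q.det ∈ S.O := by
  obtain ⟨R, rfl⟩ := S.exists_lift h
  rw [← RingHom.map_det]
  exact R.det.2

theorem inv_apply_mem {Q : Matrix ι ι K} (h : ∀ i j, Q i j ∈ S.O) (hd : S.ord Q.det ≤ 0)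
    (i j : ι) : Q⁻¹ i j ∈ S.O := by
  rw [Matrix.inv_def, Matrix.smul_apply, smul_eq_mul]
  refine S.O.mul_mem ?_ ?_
  · rw [Ring.inverse_eq_inv', S.mem_O, S.ord_inv]; omega
  · obtain ⟨R, rfl⟩ := S.exists_lift h
    rw [← RingHom.map_adjugate]
    exact (R.adjugate i j).2

end Matrix

section Lattice

variable {V : Type*} [AddCommGroup V] [Module K V]

theorem mem_span_basis {ι : Type*} [Finite ι] (b : Module.Basis ι K V) {x : V} :
    x ∈ Submodule.span S.O (Set.range b) ↔ ∀ i, b.repr x i ∈ S.O := by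
  rw [Module.Basis.mem_span_iff_repr_mem]
  simp only [Set.mem_range]
  exact forall_congr' fun i => ⟨fun ⟨y, hy⟩ => hy ▸ y.2, fun h => ⟨⟨_, h⟩, rfl⟩⟩

/-- If a monotone union of submodules contains a finitely generated one, so does a single term. -/
theorem exists_le_of_fg {R W : Type*} [Ring R] [AddCommGroup W] [Module R W] {M : Submodule R W}
    (hM : M.FG) {f : ℕ → Submodule R W} (hf : Monotone f) (h : M ≤ ⨆ n, f n) : ∃ n, M ≤ f n := by
  obtain ⟨s, rfl⟩ := hM
  have h1 : ∀ x ∈ s, ∃ n, x ∈ f n := fun x hx =>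
    (Submodule.mem_iSup_of_directed f hf.directed_le).1 (h (Submodule.subset_span hx))
  choose! N hN using h1
  refine ⟨s.sup N, Submodule.span_le.2 fun x hx => hf (Finset.le_sup hx) (hN x hx)⟩

/-- A family which is expressed in an integral way and with unit determinant by a basis spans the
same lattice. -/
theorem span_le_span_of_det {ι : Type*} [Fintype ι] [DecidableEq ι] {b c : ι → V}
    {Q : Matrix ι ι K} (hQ : ∀ j, c j = ∑ i, Q i j • b i) (h : ∀ i j, Q i j ∈ S.O)
    (h0 : Q.det ≠ 0) (hd : S.ord Q.det ≤ 0) :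
    Submodule.span S.O (Set.range b) ≤ Submodule.span S.O (Set.range c) := by
  rw [Submodule.span_le]
  rintro _ ⟨i, rfl⟩
  have h1 : b i = ∑ j, Q⁻¹ j i • c j := by
    simp only [hQ, Finset.smul_sum, smul_smul]
    rw [Finset.sum_comm]
    have h2 : ∀ l, ∑ j, (Q⁻¹ j i * Q l j) • b l = (1 : Matrix ι ι K) l i • b l := by
      intro l
      rw [← Finset.sum_smul, ← Matrix.mul_nonsing_inv Q (isUnit_iff_ne_zero.2 h0),
        Matrix.mul_apply]
      simp only [mul_comm]
    simp only [h2, Matrix.one_apply, ite_smul, one_smul, zero_smul, Finset.sum_ite_eq',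
      Finset.mem_univ, if_true]
  rw [h1]
  exact Submodule.sum_mem _ fun j _ =>
    S.smul_mem _ (S.inv_apply_mem h hd j i) (Submodule.subset_span ⟨j, rfl⟩)

end Lattice

end DVField

/-! ### Bases adapted both to a filtration and to an O-submodule. -/

namespace DVField

universe u

variable {K : Type*} [Field K] (S : DVField K)

/-- The trace of an `O`-submodule on a subspace. -/
def traceO {V : Type*} [AddCommGroup V] [Module K V] (U : Submodule S.O V) (H : Submodule K V) :
    Submodule S.O H where
  carrier := {x | (x : V) ∈ U}
  add_mem' := fun ha hb => U.add_mem ha hb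
  zero_mem' := U.zero_mem
  smul_mem' := fun a _ hx => U.smul_mem a hx

theorem mem_traceO {V : Type*} [AddCommGroup V] [Module K V] {U : Submodule S.O V}
    {H : Submodule K V} {x : H} : x ∈ S.traceO U H ↔ (x : V) ∈ U := Iff.rfl

/-- A basis of `V` which is built from a vector outside a hyperplane and a basis of the
hyperplane. -/
theorem exists_basis_cons {V : Type*} [AddCommGroup V] [Module K V] (l : V →ₗ[K] K) {n : ℕ}
    (b : Module.Basis (Fin n) K (LinearMap.ker l)) {v : V} (hv : l v ≠ 0) :
    ∃ e : Module.Basis (Fin (n + 1)) K V, ∀ x : V, ∃ y : LinearMap.ker l,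
      x = (l x * (l v)⁻¹) • v + y ∧ e.repr x 0 = l x * (l v)⁻¹ ∧
        ∀ j, e.repr x j.succ = b.repr y j := by
  -- The projection onto `ker l` along `v`.
  let pr : V →ₗ[K] LinearMap.ker l := LinearMap.codRestrict _
    (LinearMap.id - ((l v)⁻¹ • l).smulRight v) (by
      intro x
      simp only [LinearMap.mem_ker, LinearMap.sub_apply, LinearMap.id_apply, map_sub,
        LinearMap.smulRight_apply, LinearMap.smul_apply, map_smul, smul_eq_mul]
      field_simp
      ring)
  have hpr : ∀ x, ((pr x : LinearMap.ker l) : V) = x - (l x * (l v)⁻¹) • v := by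
    intro x
    simp [pr, mul_comm]
  let g : V →ₗ[K] (Fin (n + 1) → K) :=
    { toFun := fun x => Fin.cons (l x * (l v)⁻¹) (b.repr (pr x))
      map_add' := by
        intro x y
        ext j
        refine Fin.cases ?_ (fun j => ?_) j <;> simp [add_mul]
      map_smul' := by
        intro a x
        ext j
        refine Fin.cases ?_ (fun j => ?_) j <;> simp [mul_assoc] }
  have hinj : Function.Injective g := by
    rw [injective_iff_map_eq_zero]
    intro x hx
    have h0 : l x * (l v)⁻¹ = 0 := congrFun hx 0
    have h1 : pr x = 0 := by
      apply b.repr.injective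
      ext j
      have : b.repr (pr x) j = 0 := congrFun hx j.succ
      simp [this]
    have h2 := hpr x
    rw [h1, h0, zero_smul, sub_zero] at h2
    exact h2.symm
  have hsurj : Function.Surjective g := by
    intro y
    refine ⟨y 0 • v + ((b.repr.symm (Finsupp.equivFunOnFinite.symm (Fin.tail y)) :
      LinearMap.ker l) : V), ?_⟩
    set z := b.repr.symm (Finsupp.equivFunOnFinite.symm (Fin.tail y)) with hz
    have hlz : l (z : V) = 0 := z.2
    have hl : l (y 0 • v + (z : V)) * (l v)⁻¹ = y 0 := by
      rw [map_add, map_smul, hlz, add_zero, smul_eq_mul, mul_assoc, mul_inv_cancel₀ hv, mul_one]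
    have hp : pr (y 0 • v + (z : V)) = z := by
      apply Subtype.ext
      rw [hpr, hl]
      abel
    ext j
    refine Fin.cases ?_ (fun j => ?_) j
    · exact hl
    · change b.repr (pr (y 0 • v + (z : V))) j = _
      rw [hp, hz]
      simp [Fin.tail]
  refine ⟨Module.Basis.ofEquivFun (LinearEquiv.ofBijective g ⟨hinj, hsurj⟩), fun x =>
    ⟨pr x, ?_, ?_, fun j => ?_⟩⟩
  · rw [hpr]; abel
  · rw [Module.Basis.ofEquivFun_repr_apply]; rfl
  · rw [Module.Basis.ofEquivFun_repr_apply]; rfl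

/-- Every `O`-submodule which spans `V` surjects onto `K` through a nonzero functional in such a
way that there is a good vector outside the kernel. -/
theorem exists_good_vector {V : Type*} [AddCommGroup V] [Module K V] (U : Submodule S.O V)
    (hU : ∀ x, ∃ n : ℕ, S.ϖ ^ n • x ∈ U) (l : V →ₗ[K] K) (hl : l ≠ 0) {n : ℕ}
    (b : Module.Basis (Fin n) K (LinearMap.ker l)) (T : Fin n → Prop)
    (hT : ∀ x : LinearMap.ker l, (x : V) ∈ U ↔ ∀ j, T j → b.repr x j ∈ S.O) :
    ∃ v, l v ≠ 0 ∧ ((∀ a : K, a • v ∈ U) ∨ (v ∈ U ∧ ∀ u ∈ U, l u * (l v)⁻¹ ∈ S.O)) := by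
  classical
  -- Either `l` has bounded denominators on `U`, and a vector where `ord (l v)` is minimal splits
  -- off a copy of O, or `l` maps `U` onto K, and completeness produces a whole K-line inside `U`.
  by_cases hB : ∃ m : ℤ, ∀ u ∈ U, l u ≠ 0 → m ≤ S.ord (l u)
  · obtain ⟨m, hm⟩ := hB
    obtain ⟨x, hx⟩ : ∃ x, l x ≠ 0 := by
      by_contra! h
      exact hl (LinearMap.ext h)
    obtain ⟨N, hN⟩ := hU x
    obtain ⟨t, ⟨v, hvU, hv0, hvt⟩, hmin⟩ := Int.exists_least_of_bdd
      (P := fun t => ∃ u ∈ U, l u ≠ 0 ∧ S.ord (l u) = t)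
      ⟨m, fun z ⟨u, hu, h0, hz⟩ => hz ▸ hm u hu h0⟩
      ⟨_, _, hN, by rw [map_smul, smul_eq_mul]; exact mul_ne_zero (pow_ne_zero N S.ϖ_ne) hx, rfl⟩
    refine ⟨v, hv0, Or.inr ⟨hvU, fun u hu => ?_⟩⟩
    by_cases hu0 : l u = 0
    · rw [hu0, zero_mul]; exact S.O.zero_mem
    · have := hmin _ ⟨u, hu, hu0, rfl⟩
      rw [S.mem_O, S.ord_mul hu0 (inv_ne_zero hv0), S.ord_inv]
      omega
  · push Not at hB
    have h1 : ∀ n : ℕ, ∃ u ∈ U, l u = (S.ϖ ^ n)⁻¹ := by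
      intro n
      obtain ⟨u, hu, hu0, hlt⟩ := hB (-n)
      refine ⟨((S.ϖ ^ n)⁻¹ * (l u)⁻¹) • u, S.smul_mem U ?_ hu, ?_⟩
      · rw [S.mem_O, S.ord_mul (inv_ne_zero (pow_ne_zero n S.ϖ_ne)) (inv_ne_zero hu0), S.ord_inv,
          S.ord_inv, S.ord_pow, S.ord_ϖ]
        omega
      · rw [map_smul, smul_eq_mul, mul_assoc, inv_mul_cancel₀ hu0, mul_one]
    choose v hvU hv using h1
    -- The vectors `v n` lift ϖ^(-n). Correcting `v 0` by the series of the ϖ^i d_i turns them into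
    -- the multiples ϖ^(-n) of a single vector, up to an error in `U ∩ ker l`.
    have hd : ∀ n, S.ϖ • v (n + 1) - v n ∈ LinearMap.ker l := by
      intro n
      have := S.ϖ_ne
      rw [LinearMap.mem_ker, map_sub, map_smul, hv, hv, smul_eq_mul]
      field_simp
      ring
    let d : ℕ → LinearMap.ker l := fun n => ⟨_, hd n⟩
    have hdU : ∀ n, ((d n : LinearMap.ker l) : V) ∈ U := fun n =>
      U.sub_mem (S.smul_mem U S.ϖ_mem (hvU _)) (hvU n)
    have htel : ∀ n, v 0 = S.ϖ ^ n • v n - ∑ i ∈ Finset.range n, S.ϖ ^ i • (d i : V) := by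
      intro n
      induction n with
      | zero => simp
      | succ n ih =>
        rw [Finset.sum_range_succ, ih]
        simp only [d, smul_sub, smul_smul, pow_succ]
        abel
    -- The series is summed coordinate by coordinate. Coordinates outside `T` are not constrained by
    -- `U`, nor need they be integral, so the limit is simply given the coordinate 0 there.
    have hs : ∀ j, ∃ s : K, ∀ n, (s - ∑ i ∈ Finset.range n,
        S.ϖ ^ i * (if T j then b.repr (d i) j else 0)) * (S.ϖ ^ n)⁻¹ ∈ S.O := by
      intro j
      apply S.complete
      intro n
      split_ifs with h
      · exact (hT _).1 (hdU n) j h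
      · exact S.O.zero_mem
    choose s hs using hs
    let z : LinearMap.ker l := b.equivFun.symm s
    have hzr : ∀ j, b.repr z j = s j := by
      intro j
      have := congrFun (b.equivFun.apply_symm_apply s) j
      rwa [Module.Basis.equivFun_apply] at this
    have hx1 : l (v 0 + z) = 1 := by
      have : l (z : V) = 0 := z.2
      rw [map_add, this, hv]
      simp
    refine ⟨v 0 + z, by rw [hx1]; exact one_ne_zero, Or.inl fun a => ?_⟩
    obtain ⟨N, hN⟩ := S.exists_zpow_mul_mem (fun _ : Unit => a)
    have hN := hN N le_rfl ()
    have key : (S.ϖ ^ N)⁻¹ • (v 0 + (z : V)) ∈ U := by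
      have h2 : (S.ϖ ^ N)⁻¹ • (v 0 + (z : V)) = v N +
          (((S.ϖ ^ N)⁻¹ • (z - ∑ i ∈ Finset.range N, S.ϖ ^ i • d i) : LinearMap.ker l) : V) := by
        rw [htel N]
        simp only [Submodule.coe_smul, Submodule.coe_sub, Submodule.coe_sum, smul_add, smul_sub,
          smul_smul, inv_mul_cancel₀ (pow_ne_zero N S.ϖ_ne), one_smul]
        abel
      rw [h2]
      refine U.add_mem (hvU N) ((hT _).2 fun j hj => ?_)
      have := hs j N
      simp only [hj, if_true] at this
      simpa [hzr, mul_comm] using this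
    have h3 : a • (v 0 + (z : V)) = (S.ϖ ^ (N : ℤ) * a) • (S.ϖ ^ N)⁻¹ • (v 0 + (z : V)) := by
      rw [smul_smul, zpow_natCast]
      congr 1
      have := pow_ne_zero N S.ϖ_ne
      field_simp
    rw [h3]
    exact S.smul_mem U hN key

/-- A spanning `O`-submodule `U` and a filtration of `V` have a common adapted basis. -/
theorem exists_adapted_basis (n : ℕ) : ∀ (V : Type u) [AddCommGroup V] [Module K V]
    [FiniteDimensional K V] (_ : Module.finrank K V = n) (U : Submodule S.O V)
    (_ : ∀ x : V, ∃ n : ℕ, S.ϖ ^ n • x ∈ U) (Fil : ℤ → Submodule K V) (_ : Antitone Fil)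
    (_ : ∃ i, Fil i = ⊤) (_ : ∃ i, Fil i = ⊥),
    ∃ (b : Module.Basis (Fin n) K V) (w : Fin n → ℤ) (T : Fin n → Prop),
      (∀ i x, x ∈ Fil i ↔ ∀ j, w j < i → b.repr x j = 0) ∧
      (∀ x, x ∈ U ↔ ∀ j, T j → b.repr x j ∈ S.O) := by
  induction n with
  | zero =>
    intro V _ _ _ hn U _ Fil _ _ _
    have : Subsingleton V := Module.finrank_zero_iff.1 hn
    refine ⟨Module.finBasisOfFinrankEq K V hn, fun _ => 0, fun _ => True, fun i x => ?_,
      fun x => ?_⟩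
    · simp [Subsingleton.elim x 0]
    · simp [Subsingleton.elim x 0]
  | succ n ih =>
    intro V _ _ _ hn U hU Fil hanti htop hbot
    have hnt : Nontrivial V := Module.nontrivial_of_finrank_pos (R := K) (by omega)
    obtain ⟨i₁, hi₁⟩ := hbot
    -- The smallest jump of the filtration. Any vector outside a hyperplane containing `Fil (i₀ +
    -- 1)` may serve as a basis vector of weight `i₀`, so it can be chosen to suit `U` alone.
    obtain ⟨i₀, hi₀, hmax⟩ := Int.exists_greatest_of_bdd (P := fun i => Fil i = ⊤)
      ⟨i₁, fun z hz => by
        by_contra! h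
        have := hanti h.le
        rw [hz, hi₁] at this
        exact bot_ne_top (eq_top_iff.2 this)⟩ htop
    have hlt : Fil (i₀ + 1) < ⊤ := lt_top_iff_ne_top.2 fun h => by
      have := hmax _ h
      omega
    obtain ⟨l, hl, hle⟩ := Submodule.exists_le_ker_of_lt_top _ hlt
    have hker : Module.finrank K (LinearMap.ker l) = n := by
      have := Module.Dual.finrank_ker_add_one_of_ne_zero hl
      omega
    obtain ⟨b, w, T, hw, hT⟩ := ih (LinearMap.ker l) hker (S.traceO U _)
      (fun x => by
        obtain ⟨m, hm⟩ := hU x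
        exact ⟨m, hm⟩)
      (fun i => (Fil i).comap (LinearMap.ker l).subtype)
      (fun i j hij => Submodule.comap_mono (hanti hij))
      ⟨i₀, by simp [hi₀]⟩ ⟨i₁, by simp [hi₁]⟩
    obtain ⟨v, hv, hcase⟩ := S.exists_good_vector U hU l hl b T hT
    obtain ⟨e, he⟩ := exists_basis_cons l b hv
    -- The new index is outside `T` exactly when the whole line through `v` lies in `U`.
    refine ⟨e, Fin.cons i₀ w, Fin.cons (¬ ∀ a : K, a • v ∈ U) T, fun i x => ?_, fun x => ?_⟩
    · obtain ⟨y, hxy, h0, hs⟩ := he x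
      rw [Fin.forall_fin_succ]
      simp only [Fin.cons_zero, Fin.cons_succ, h0, hs]
      have hwy := hw i y
      simp only [Submodule.mem_comap, Submodule.subtype_apply] at hwy
      rw [← hwy]
      by_cases hi : i₀ < i
      · simp only [hi, true_imp_iff]
        constructor
        · intro hx
          have hlx : l x = 0 := hle (hanti (by omega : i₀ + 1 ≤ i) hx)
          rw [hlx, zero_mul, zero_smul, zero_add] at hxy
          exact ⟨by rw [hlx, zero_mul], hxy ▸ hx⟩
        · rintro ⟨h1, h2⟩
          rw [h1, zero_smul, zero_add] at hxy
          rwa [hxy]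
      · have hFi : Fil i = ⊤ := top_le_iff.1 (hi₀ ▸ hanti (not_lt.1 hi))
        simp [hFi, hi]
    · obtain ⟨y, hxy, h0, hs⟩ := he x
      rw [Fin.forall_fin_succ]
      simp only [Fin.cons_zero, Fin.cons_succ, h0, hs]
      rw [← hT y]
      by_cases hA : ∀ a : K, a • v ∈ U
      · have hiff := U.add_mem_iff_right (y := (y : V)) (hA (l x * (l v)⁻¹))
        rw [← hxy] at hiff
        simp only [hA, implies_true, not_true, false_imp_iff, true_and]
        exact hiff
      · simp only [hA, not_false_iff, true_imp_iff]
        obtain ⟨hvU, hO⟩ := hcase.resolve_left hA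
        constructor
        · intro hx
          refine ⟨hO x hx, ?_⟩
          have hiff := U.add_mem_iff_right (y := (y : V)) (S.smul_mem U (hO x hx) hvU)
          rw [← hxy] at hiff
          exact hiff.1 hx
        · rintro ⟨h1, h2⟩
          rw [hxy]
          exact U.add_mem (S.smul_mem U h1 hvU) h2

end DVField

/-! ### Semilinear automorphisms, lattices and increasing chains of lattices. -/

namespace DVField

universe u

variable {K : Type*} [Field K] (S : DVField K)

section Semilinear

variable {V : Type*} [AddCommGroup V] [Module K V]

/-- The automorphism `f` of `V` is semilinear with respect to the automorphism `τ` of `K`, which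
preserves the valuation and fixes the uniformizer. -/
structure IsSemi (f : Equiv.Perm V) (τ : RingAut K) : Prop where
  ord : ∀ a, S.ord (τ a) = S.ord a
  ϖ : τ S.ϖ = S.ϖ
  add : ∀ x y : V, f (x + y) = f x + f y
  smul : ∀ (a : K) (x : V), f (a • x) = τ a • f x

variable {S}

theorem apply_inv_apply (τ : RingAut K) (a : K) : τ (τ⁻¹ a) = a := τ.apply_symm_apply a

theorem perm_apply_inv_apply {α : Type*} (f : Equiv.Perm α) (x : α) : f (f⁻¹ x) = x :=
  f.apply_symm_apply x

namespace IsSemi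

variable {f g : Equiv.Perm V} {τ ρ : RingAut K}

theorem one : S.IsSemi (1 : Equiv.Perm V) 1 :=
  ⟨fun _ => rfl, rfl, fun _ _ => rfl, fun _ _ => rfl⟩

theorem mul (hf : S.IsSemi f τ) (hg : S.IsSemi g ρ) : S.IsSemi (f * g) (τ * ρ) :=
  ⟨fun a => by rw [RingAut.mul_apply, hf.ord, hg.ord],
    by rw [RingAut.mul_apply, hg.ϖ, hf.ϖ],
    fun x y => by rw [Equiv.Perm.mul_apply, hg.add, hf.add]; rfl,
    fun a x => by rw [Equiv.Perm.mul_apply, hg.smul, hf.smul]; rfl⟩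

theorem inv (hf : S.IsSemi f τ) : S.IsSemi f⁻¹ τ⁻¹ := by
  refine ⟨fun a => ?_, ?_, fun x y => ?_, fun a x => ?_⟩
  · rw [← hf.ord, apply_inv_apply]
  · apply τ.injective
    rw [apply_inv_apply, hf.ϖ]
  · apply f.injective
    simp only [hf.add, perm_apply_inv_apply]
  · apply f.injective
    simp only [hf.smul, apply_inv_apply, perm_apply_inv_apply]

theorem pow (hf : S.IsSemi f τ) (n : ℕ) : S.IsSemi (f ^ n) (τ ^ n) := by
  induction n with
  | zero => exact one
  | succ n ih => rw [pow_succ, pow_succ]; exact ih.mul hf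

theorem map_zero (hf : S.IsSemi f τ) : f 0 = 0 := by
  have := hf.add 0 0
  rwa [add_zero, left_eq_add] at this

theorem map_neg (hf : S.IsSemi f τ) (x : V) : f (-x) = -f x := by
  have := hf.add (-x) x
  rw [neg_add_cancel, hf.map_zero] at this
  exact eq_neg_of_add_eq_zero_left this.symm

theorem map_sub (hf : S.IsSemi f τ) (x y : V) : f (x - y) = f x - f y := by
  have := hf.add (x - y) y
  rw [sub_add_cancel] at this
  rw [this, add_sub_cancel_right]

theorem map_sum (hf : S.IsSemi f τ) {ι : Type*} (s : Finset ι) (x : ι → V) :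
    f (∑ i ∈ s, x i) = ∑ i ∈ s, f (x i) := by
  classical
  induction s using Finset.induction_on with
  | empty => simp [hf.map_zero]
  | insert i s hi ih => rw [Finset.sum_insert hi, Finset.sum_insert hi, hf.add, ih]

theorem map_zpow (hf : S.IsSemi f τ) (r : ℤ) : τ (S.ϖ ^ r) = S.ϖ ^ r := by
  rw [map_zpow₀, hf.ϖ]

theorem mem_O (hf : S.IsSemi f τ) {a : K} : τ a ∈ S.O ↔ a ∈ S.O := by
  rw [S.mem_O, S.mem_O, hf.ord]

theorem apply_zpow_smul (hf : S.IsSemi f τ) (r : ℤ) (x : V) : f (S.ϖ ^ r • x) = S.ϖ ^ r • f x := by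
  rw [hf.smul, hf.map_zpow]

end IsSemi

variable (S) in
/-- Multiplication by `ϖ ^ r`. -/
def scale (V : Type*) [AddCommGroup V] [Module K V] (r : ℤ) : Equiv.Perm V where
  toFun x := S.ϖ ^ r • x
  invFun x := (S.ϖ ^ r)⁻¹ • x
  left_inv x := by
    change (S.ϖ ^ r)⁻¹ • S.ϖ ^ r • x = x
    rw [smul_smul, inv_mul_cancel₀ (S.zpow_ne r), one_smul]
  right_inv x := by
    change S.ϖ ^ r • (S.ϖ ^ r)⁻¹ • x = x
    rw [smul_smul, mul_inv_cancel₀ (S.zpow_ne r), one_smul]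

theorem scale_apply (r : ℤ) (x : V) : S.scale V r x = S.ϖ ^ r • x := rfl

theorem isSemi_scale (r : ℤ) : S.IsSemi (S.scale V r) 1 :=
  ⟨fun _ => rfl, rfl, fun _ _ => smul_add _ _ _,
    fun a x => by rw [scale_apply, scale_apply, smul_comm]; rfl⟩

theorem scale_add (r s : ℤ) : S.scale V (r + s) = S.scale V r * S.scale V s := by
  ext x
  rw [Equiv.Perm.mul_apply, scale_apply, scale_apply, scale_apply, smul_smul, zpow_add₀ S.ϖ_ne]

theorem IsSemi.commute_scale {f : Equiv.Perm V} {τ : RingAut K} (hf : S.IsSemi f τ) (r : ℤ) :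
    Commute f (S.scale V r) := by
  ext x
  rw [Equiv.Perm.mul_apply, Equiv.Perm.mul_apply, scale_apply, scale_apply, hf.apply_zpow_smul]

variable (S) in
/-- The image of an `O`-submodule under a semilinear automorphism. -/
def img (f : Equiv.Perm V) (M : Submodule S.O V) : Submodule S.O V :=
  Submodule.span S.O (f '' (M : Set V))

section img

variable {f g : Equiv.Perm V} {τ ρ : RingAut K}

/-- Because τ⁻¹ preserves O, the image is already an O-submodule, so the span in `img` adds nothing.
-/
theorem mem_img (hf : S.IsSemi f τ) {M : Submodule S.O V} {x : V} :
    x ∈ S.img f M ↔ ∃ y ∈ M, f y = x := by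
  refine ⟨fun hx => ?_, fun ⟨y, hy, h⟩ => Submodule.subset_span ⟨y, hy, h⟩⟩
  induction hx using Submodule.span_induction with
  | mem x hx => exact hx
  | zero => exact ⟨0, M.zero_mem, hf.map_zero⟩
  | add x y _ _ hx hy =>
    obtain ⟨x, hx, rfl⟩ := hx
    obtain ⟨y, hy, rfl⟩ := hy
    exact ⟨x + y, M.add_mem hx hy, hf.add x y⟩
  | smul a x _ hx =>
    obtain ⟨x, hx, rfl⟩ := hx
    refine ⟨τ⁻¹ (a : K) • x, S.smul_mem M (hf.inv.mem_O.2 a.2) hx, ?_⟩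
    rw [hf.smul, apply_inv_apply]
    rfl

theorem apply_mem_img {M : Submodule S.O V} {x : V} (h : x ∈ M) : f x ∈ S.img f M :=
  Submodule.subset_span ⟨x, h, rfl⟩

theorem img_mono {M N : Submodule S.O V} (h : M ≤ N) : S.img f M ≤ S.img f N :=
  Submodule.span_mono (Set.image_mono h)

theorem img_mul (hf : S.IsSemi f τ) (hg : S.IsSemi g ρ) (M : Submodule S.O V) :
    S.img (f * g) M = S.img f (S.img g M) := by
  ext x
  rw [mem_img (hf.mul hg), mem_img hf]
  constructor
  · rintro ⟨y, hy, rfl⟩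
    exact ⟨g y, apply_mem_img hy, rfl⟩
  · rintro ⟨y, hy, rfl⟩
    obtain ⟨z, hz, rfl⟩ := (mem_img hg).1 hy
    exact ⟨z, hz, rfl⟩

theorem img_span (hf : S.IsSemi f τ) (X : Set V) :
    S.img f (Submodule.span S.O X) = Submodule.span S.O (f '' X) := by
  apply le_antisymm
  · rw [img, Submodule.span_le]
    rintro _ ⟨x, hx, rfl⟩
    induction hx using Submodule.span_induction with
    | mem x hx => exact Submodule.subset_span ⟨x, hx, rfl⟩
    | zero => rw [hf.map_zero]; exact Submodule.zero_mem _
    | add x y _ _ hx hy => rw [hf.add]; exact Submodule.add_mem _ hx hy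
    | smul a x _ hx =>
      have : f (a • x) = τ (a : K) • f x := hf.smul _ _
      rw [this]
      exact S.smul_mem _ (hf.mem_O.2 a.2) hx
  · exact Submodule.span_mono (Set.image_mono Submodule.subset_span)

theorem img_fg (hf : S.IsSemi f τ) {M : Submodule S.O V} (h : M.FG) : (S.img f M).FG := by
  classical
  obtain ⟨s, rfl⟩ := h
  rw [img_span hf]
  exact ⟨s.image f, by rw [Finset.coe_image]⟩

theorem img_iSup_le (hf : S.IsSemi f τ) {M : ℕ → Submodule S.O V} (hM : Monotone M) :
    S.img f (⨆ n, M n) ≤ ⨆ n, S.img f (M n) := by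
  intro x hx
  obtain ⟨y, hy, rfl⟩ := (mem_img hf).1 hx
  obtain ⟨n, hn⟩ := (Submodule.mem_iSup_of_directed M hM.directed_le).1 hy
  exact Submodule.mem_iSup_of_mem n (apply_mem_img hn)

theorem img_top (hf : S.IsSemi f τ) : S.img f ⊤ = ⊤ := by
  rw [eq_top_iff]
  exact fun x _ => (mem_img hf).2 ⟨f⁻¹ x, trivial, f.apply_symm_apply x⟩

end img

end Semilinear

section Lattices

variable {V : Type*} [AddCommGroup V] [Module K V]

/-- A finitely generated `O`-submodule which absorbs `V`. -/
def IsLat (M : Submodule S.O V) : Prop := M.FG ∧ ∀ x : V, ∃ n : ℕ, S.ϖ ^ n • x ∈ M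

variable {S}

theorem zpow_smul_mem_of_le {M : Submodule S.O V} {m n : ℤ} (h : m ≤ n) {x : V}
    (hx : S.ϖ ^ m • x ∈ M) : S.ϖ ^ n • x ∈ M := by
  have h1 := S.smul_mem M (S.zpow_mem (by omega : 0 ≤ n - m)) hx
  rwa [smul_smul, ← zpow_add₀ S.ϖ_ne, sub_add_cancel] at h1

theorem absorbs_of_span {M : Submodule S.O V} {E : Submodule K V}
    (h : Submodule.span K (M : Set V) = E) {x : V} (hx : x ∈ E) :
    ∃ n : ℕ, S.ϖ ^ n • x ∈ M := by
  rw [← h] at hx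
  induction hx using Submodule.span_induction with
  | mem x hx => exact ⟨0, by simpa using hx⟩
  | zero => exact ⟨0, by simp⟩
  | add x y _ _ hx hy =>
    obtain ⟨m, hm⟩ := hx
    obtain ⟨n, hn⟩ := hy
    refine ⟨m + n, ?_⟩
    rw [smul_add]
    refine M.add_mem ?_ ?_
    · have := zpow_smul_mem_of_le (m := m) (n := (m + n : ℕ)) (by push_cast; omega)
        (by simpa using hm)
      rwa [zpow_natCast] at this
    · have := zpow_smul_mem_of_le (m := n) (n := (m + n : ℕ)) (by push_cast; omega)
        (by simpa using hn)
      rwa [zpow_natCast] at this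
  | smul a x _ hx =>
    obtain ⟨m, hm⟩ := hx
    obtain ⟨n, hn⟩ := S.exists_zpow_mul_mem (fun _ : Unit => a)
    refine ⟨n + m, ?_⟩
    have h1 := hn n le_rfl ()
    have : S.ϖ ^ (n + m) • a • x = (S.ϖ ^ (n : ℤ) * a) • S.ϖ ^ m • x := by
      simp only [smul_smul, zpow_natCast, pow_add]
      congr 1
      ring
    rw [this]
    exact S.smul_mem M h1 hm

theorem isLat_of_span {M : Submodule S.O V} (hfg : M.FG)
    (h : Submodule.span K (M : Set V) = ⊤) : S.IsLat M :=
  ⟨hfg, fun _ => absorbs_of_span h trivial⟩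

theorem IsLat.span_eq_top {M : Submodule S.O V} (h : S.IsLat M) :
    Submodule.span K (M : Set V) = ⊤ := by
  rw [eq_top_iff]
  intro x _
  obtain ⟨n, hn⟩ := h.2 x
  have : x = (S.ϖ ^ n)⁻¹ • S.ϖ ^ n • x := by
    rw [smul_smul, inv_mul_cancel₀ (pow_ne_zero n S.ϖ_ne), one_smul]
  rw [this]
  exact Submodule.smul_mem _ _ (Submodule.subset_span hn)

theorem isLat_span_basis {ι : Type*} [Finite ι] (b : Module.Basis ι K V) :
    S.IsLat (Submodule.span S.O (Set.range b)) := by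
  refine isLat_of_span (Submodule.fg_span (Set.finite_range b)) (top_le_iff.1 ?_)
  rw [← b.span_eq]
  exact Submodule.span_mono Submodule.subset_span

theorem exists_forall_zpow_mul_mem_of_fg {M : Submodule S.O V} (h : M.FG) (l : V →ₗ[K] K) :
    ∃ n : ℕ, ∀ x ∈ M, S.ϖ ^ n * l x ∈ S.O := by
  obtain ⟨s, rfl⟩ := h
  obtain ⟨n, hn⟩ := S.exists_zpow_mul_mem (fun x : s => l x)
  have hn := hn n le_rfl
  refine ⟨n, fun x hx => ?_⟩
  induction hx using Submodule.span_induction with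
  | mem x hx => simpa using hn ⟨x, hx⟩
  | zero => simp
  | add x y _ _ hx hy => rw [map_add, mul_add]; exact S.O.add_mem hx hy
  | smul a x _ hx =>
    have : l (a • x) = (a : K) * l x := l.map_smul (a : K) x
    rw [this, mul_left_comm]
    exact S.O.mul_mem a.2 hx

/-- A linear functional has bounded denominators on a finitely generated O-module, so such a module
contains no K-line. This is the source of every contradiction with `(⊤ : Submodule S.O V).FG`. -/
theorem not_forall_smul_mem_of_fg {M : Submodule S.O V} (h : M.FG) {x : V} {l : V →ₗ[K] K}
    (hl : l x ≠ 0) : ¬ ∀ a : K, a • x ∈ M := by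
  intro hx
  obtain ⟨n, hn⟩ := exists_forall_zpow_mul_mem_of_fg h l
  have h1 := hn _ (hx ((S.ϖ ^ (n + 1))⁻¹ * (l x)⁻¹))
  rw [map_smul, smul_eq_mul, mul_assoc, inv_mul_cancel₀ hl, mul_one, S.mem_O,
    S.ord_mul (pow_ne_zero n S.ϖ_ne) (inv_ne_zero (pow_ne_zero _ S.ϖ_ne)), S.ord_inv, S.ord_pow,
    S.ord_pow, S.ord_ϖ] at h1
  push_cast at h1
  omega

/-- A lattice contains no K-line, so in `exists_adapted_basis` every index satisfies `T`. -/
theorem exists_adapted_basis_of_isLat {V : Type u} [AddCommGroup V] [Module K V]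
    [FiniteDimensional K V] {n : ℕ} (hn : Module.finrank K V = n) {M : Submodule S.O V}
    (hM : S.IsLat M) {Fil : ℤ → Submodule K V} (hanti : Antitone Fil)
    (htop : ∃ i, Fil i = ⊤) (hbot : ∃ i, Fil i = ⊥) :
    ∃ (b : Module.Basis (Fin n) K V) (w : Fin n → ℤ),
      (∀ i x, x ∈ Fil i ↔ ∀ j, w j < i → b.repr x j = 0) ∧
      M = Submodule.span S.O (Set.range b) := by
  obtain ⟨b, w, T, hw, hT⟩ := S.exists_adapted_basis n V hn M hM.2 Fil hanti htop hbot
  refine ⟨b, w, hw, ?_⟩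
  have hall : ∀ j, T j := by
    intro j
    by_contra hj
    refine not_forall_smul_mem_of_fg hM.1 (x := b j) (l := b.coord j) (by simp) fun a => ?_
    rw [hT]
    intro i hi
    have hij : i ≠ j := fun h => hj (h ▸ hi)
    simp [hij.symm, S.O.zero_mem]
  ext x
  rw [hT, S.mem_span_basis]
  exact ⟨fun h j => h j (hall j), fun h j _ => h j⟩

/-- The filtration concentrated in degree zero. -/
def trivFil (V : Type*) [AddCommGroup V] [Module K V] (i : ℤ) : Submodule K V :=
  if i ≤ 0 then ⊤ else ⊥

theorem trivFil_antitone : Antitone (trivFil (K := K) V) := by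
  intro i j hij
  unfold trivFil
  split_ifs
  · exact le_rfl
  · omega
  · exact bot_le
  · exact bot_le

theorem exists_basis_of_isLat {V : Type u} [AddCommGroup V] [Module K V]
    [FiniteDimensional K V] {n : ℕ} (hn : Module.finrank K V = n) {M : Submodule S.O V}
    (hM : S.IsLat M) : ∃ b : Module.Basis (Fin n) K V, M = Submodule.span S.O (Set.range b) := by
  obtain ⟨b, _, _, h⟩ := exists_adapted_basis_of_isLat hn hM trivFil_antitone
    ⟨0, by simp [trivFil]⟩ ⟨1, by simp [trivFil]⟩
  exact ⟨b, h⟩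

theorem IsLat.mono {M N : Submodule S.O V} (hM : S.IsLat M) (h : M ≤ N) (hN : N.FG) : S.IsLat N :=
  ⟨hN, fun x => (hM.2 x).imp fun _ hn => h hn⟩

theorem IsLat.img {f : Equiv.Perm V} {τ : RingAut K} (hf : S.IsSemi f τ) {M : Submodule S.O V}
    (hM : S.IsLat M) : S.IsLat (S.img f M) := by
  refine ⟨img_fg hf hM.1, fun x => ?_⟩
  obtain ⟨n, hn⟩ := hM.2 (f⁻¹ x)
  refine ⟨n, (mem_img hf).2 ⟨_, hn, ?_⟩⟩
  have := hf.apply_zpow_smul n (f⁻¹ x)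
  rwa [perm_apply_inv_apply, zpow_natCast] at this

/-- Any finitely generated submodule is contained in a multiple of a lattice. -/
theorem IsLat.exists_zpow_smul_mem {M N : Submodule S.O V} (hM : S.IsLat M) (hN : N.FG) :
    ∃ n : ℕ, ∀ m : ℤ, n ≤ m → ∀ x ∈ N, S.ϖ ^ m • x ∈ M := by
  obtain ⟨s, rfl⟩ := hN
  choose n hn using hM.2
  refine ⟨s.sup n, fun m hm x hx => ?_⟩
  induction hx using Submodule.span_induction with
  | mem x hx =>
    have := Finset.le_sup (f := n) hx
    exact zpow_smul_mem_of_le (m := n x) (by omega) (by simpa using hn x)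
  | zero => simp
  | add x y _ _ hx hy => rw [smul_add]; exact M.add_mem hx hy
  | smul a x _ hx => rw [smul_comm]; exact M.smul_mem a hx

end Lattices

section Chain

variable {V : Type*} [AddCommGroup V] [Module K V]
variable {S}

/-- The chain `M₀ ⊆ M₀ + Φ(M₀) ⊆ …`. -/
def chain (Φ : Submodule S.O V → Submodule S.O V) (M₀ : Submodule S.O V) : ℕ → Submodule S.O V
  | 0 => M₀
  | n + 1 => M₀ ⊔ Φ (chain Φ M₀ n)

variable {Φ : Submodule S.O V → Submodule S.O V} {M₀ : Submodule S.O V}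

theorem le_chain (n : ℕ) : M₀ ≤ chain Φ M₀ n := by
  cases n
  · exact le_rfl
  · exact le_sup_left

theorem chain_mono (hΦ : Monotone Φ) : Monotone (chain Φ M₀) := by
  refine monotone_nat_of_le_succ fun n => ?_
  induction n with
  | zero => exact le_chain 1
  | succ n ih => exact sup_le_sup_left (hΦ ih) _

theorem isLat_chain (hfg : ∀ M, S.IsLat M → (Φ M).FG) (h₀ : S.IsLat M₀) (n : ℕ) :
    S.IsLat (chain Φ M₀ n) := by
  induction n with
  | zero => exact h₀
  | succ n ih => exact h₀.mono (le_chain (n + 1)) (h₀.1.sup (hfg _ ih))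

theorem map_iSup_chain_le
    (hcont : ∀ M : ℕ → Submodule S.O V, Monotone M → Φ (⨆ n, M n) ≤ ⨆ n, Φ (M n))
    (hΦ : Monotone Φ) : Φ (⨆ n, chain Φ M₀ n) ≤ ⨆ n, chain Φ M₀ n :=
  (hcont _ (chain_mono hΦ)).trans (iSup_le fun n =>
    le_sup_right.trans (le_iSup (chain Φ M₀) (n + 1)))

/-- The chain of an operator which preserves volumes cannot exhaust the space. -/
theorem fg_top_of_iSup_chain_eq_top (hΦ : Monotone Φ) (htop : Φ ⊤ = ⊤)
    (hcont : ∀ M : ℕ → Submodule S.O V, Monotone M → Φ (⨆ n, M n) ≤ ⨆ n, Φ (M n))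
    (hfg : ∀ M, S.IsLat M → (Φ M).FG) (hvol : ∀ M, S.IsLat M → M ≤ Φ M → Φ M ≤ M)
    (h₀ : S.IsLat M₀) (h : ⨆ n, chain Φ M₀ n = ⊤) : (⊤ : Submodule S.O V).FG := by
  -- If the chain exhausts V, so do the images Φ(M_n). Being finitely generated, `M₀` then lies in a
  -- single Φ(M_n).
  have hle : M₀ ≤ ⨆ n, Φ (chain Φ M₀ n) := by
    refine le_top.trans ?_
    rw [← htop, ← h]
    exact hcont _ (chain_mono hΦ)
  obtain ⟨n, hn⟩ := exists_le_of_fg h₀.1 (fun i j hij => hΦ (chain_mono hΦ hij)) hle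
  have hlat := isLat_chain hfg h₀ n
  -- Now Φ(M_n) is the next term, hence contains M_n. By `hvol` the two are equal, and the chain is
  -- constant from there on.
  have h1 : chain Φ M₀ (n + 1) = Φ (chain Φ M₀ n) := sup_eq_right.2 hn
  have h2 := hvol _ hlat (h1 ▸ chain_mono hΦ n.le_succ)
  have h3 : ∀ m, chain Φ M₀ m ≤ chain Φ M₀ n := by
    intro m
    induction m with
    | zero => exact le_chain n
    | succ m ih => exact sup_le (le_chain n) ((hΦ ih).trans h2)
  rw [← top_le_iff.1 (h ▸ iSup_le h3)]
  exact hlat.1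

end Chain

end DVField

/-! ### Volumes, determinants on stable subspaces and degrees of filtrations. -/

namespace DVField

universe u

variable {K : Type*} [Field K] {S : DVField K}

section Volume

variable {V : Type*} [AddCommGroup V] [Module K V] {ι : Type*} [Fintype ι]

theorem sum_matrix_smul {κ μ : Type*} [Fintype κ] {c : κ → V} {d : ι → V} {e : μ → V}
    {P : Matrix κ ι K} {Q : Matrix ι μ K} (hP : ∀ j, d j = ∑ i, P i j • c i)
    (hQ : ∀ j, e j = ∑ i, Q i j • d i) (j : μ) : e j = ∑ i, (P * Q) i j • c i := by
  simp only [hQ, hP, Finset.smul_sum, smul_smul, Matrix.mul_apply, Finset.sum_smul]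
  rw [Finset.sum_comm]
  simp only [mul_comm]

theorem matrix_eq_of_sum_smul {μ : Type*} {c : ι → V} (hc : LinearIndependent K c) {d : μ → V}
    {P Q : Matrix ι μ K} (hP : ∀ j, d j = ∑ i, P i j • c i) (hQ : ∀ j, d j = ∑ i, Q i j • c i) :
    P = Q := by
  ext i j
  exact hc.eq_coords_of_eq ((hP j).symm.trans (hQ j)) i

variable [DecidableEq ι]

/-- The inclusion gives an integral `R` with Q R = 1, and `hd` bounds the valuation of det R above
by 0. So R is invertible over O: a lattice that contains another one without having larger volume is
equal to it. -/
theorem span_le_span_of_le {b d : ι → V} (hb : LinearIndependent K b) {Q : Matrix ι ι K}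
    (hQ : ∀ j, d j = ∑ i, Q i j • b i) (hd : 0 ≤ S.ord Q.det)
    (h : Submodule.span S.O (Set.range b) ≤ Submodule.span S.O (Set.range d)) :
    Submodule.span S.O (Set.range d) ≤ Submodule.span S.O (Set.range b) := by
  have h1 : ∀ j, ∃ r : ι → S.O, ∑ i, r i • d i = b j := fun j =>
    (Submodule.mem_span_range_iff_exists_fun S.O).1 (h (Submodule.subset_span ⟨j, rfl⟩))
  choose r hr using h1
  let R : Matrix ι ι K := Matrix.of fun i j => (r j i : K)
  have hR : ∀ j, b j = ∑ i, R i j • d i := fun j => (hr j).symm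
  have h2 : Q * R = 1 := matrix_eq_of_sum_smul hb (sum_matrix_smul hQ hR)
    (fun j => by simp [Matrix.one_apply])
  have h3 : Q.det * R.det = 1 := by rw [← Matrix.det_mul, h2, Matrix.det_one]
  have hQ0 : Q.det ≠ 0 := left_ne_zero_of_mul_eq_one h3
  have hR0 : R.det ≠ 0 := right_ne_zero_of_mul_eq_one h3
  have h4 := S.ord_mul hQ0 hR0
  rw [h3, S.ord_one] at h4
  exact S.span_le_span_of_det hR (fun i j => (r j i).2) hR0 (by omega)

end Volume

section Frames

variable {V : Type*} [AddCommGroup V] [Module K V]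
variable {ι κ : Type*} [Fintype ι] [Fintype κ]

/-- `c` is a linearly independent family whose span is stable under `f`, and `P` is the matrix of
`f` with respect to `c`. -/
structure IsFrame (f : Equiv.Perm V) (c : ι → V) (P : Matrix ι ι K) : Prop where
  indep : LinearIndependent K c
  map : ∀ j, f (c j) = ∑ i, P i j • c i

variable {f g : Equiv.Perm V} {τ ρ : RingAut K} {c : ι → V} {P Q : Matrix ι ι K}

theorem apply_sum_smul (hf : S.IsSemi f τ) (a : ι → K) (c : ι → V) :
    f (∑ i, a i • c i) = ∑ i, τ (a i) • f (c i) := by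
  rw [hf.map_sum]
  simp only [hf.smul]

theorem IsFrame.mul (hf : S.IsSemi f τ) (hP : IsFrame f c P) (hQ : IsFrame g c Q) :
    IsFrame (f * g) c (P * Q.map τ) := by
  refine ⟨hP.indep, sum_matrix_smul hP.map fun j => ?_⟩
  rw [Equiv.Perm.mul_apply, hQ.map, apply_sum_smul hf]
  rfl

variable [DecidableEq ι] [DecidableEq κ]

theorem IsFrame.one (hc : LinearIndependent K c) : IsFrame (1 : Equiv.Perm V) c (1 : Matrix ι ι K) :=
  ⟨hc, fun j => by simp [Matrix.one_apply]⟩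

theorem det_map (τ : RingAut K) (Q : Matrix ι ι K) : (Q.map τ).det = τ Q.det :=
  ((τ : K →+* K).map_det Q).symm

/-- A vector in the kernel of P, untwisted by τ⁻¹, would give the coordinates of a vector killed by
the injective map `f`. -/
theorem IsFrame.det_ne_zero (hf : S.IsSemi f τ) (hP : IsFrame f c P) : P.det ≠ 0 := by
  intro h
  obtain ⟨a, ha, h0⟩ := Matrix.exists_mulVec_eq_zero_iff.2 h
  apply ha
  have h1 : f (∑ j, τ⁻¹ (a j) • c j) = 0 := by
    rw [apply_sum_smul hf]
    simp only [apply_inv_apply, hP.map, Finset.smul_sum, smul_smul]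
    rw [Finset.sum_comm]
    refine Finset.sum_eq_zero fun i _ => ?_
    rw [← Finset.sum_smul]
    have := congrFun h0 i
    simp only [Matrix.mulVec, dotProduct, Pi.zero_apply] at this
    simp only [mul_comm (a _), this, zero_smul]
  have h2 : ∑ j, τ⁻¹ (a j) • c j = 0 := f.injective (h1.trans hf.map_zero.symm)
  have h3 := Fintype.linearIndependent_iff.1 hP.indep _ h2
  ext j
  have := h3 j
  rwa [map_eq_zero_iff _ (τ⁻¹).injective] at this

theorem IsFrame.exists_pow (hf : S.IsSemi f τ) (hP : IsFrame f c P) (s : ℕ) :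
    ∃ Q : Matrix ι ι K, IsFrame (f ^ s) c Q ∧ S.ord Q.det = s * S.ord P.det := by
  induction s with
  | zero => exact ⟨1, IsFrame.one hP.indep, by simp [S.ord_one]⟩
  | succ s ih =>
    obtain ⟨Q, hQ, hs⟩ := ih
    refine ⟨Q * P.map (τ ^ s), by rw [pow_succ]; exact hQ.mul (hf.pow s) hP, ?_⟩
    rw [Matrix.det_mul, det_map, S.ord_mul (hQ.det_ne_zero (hf.pow s)), (hf.pow s).ord, hs]
    · push_cast; ring
    · rw [Ne, map_eq_zero_iff _ (τ ^ s).injective]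
      exact hP.det_ne_zero hf

omit [DecidableEq ι] in
theorem IsFrame.scale_mul (hP : IsFrame f c P) (r : ℤ) :
    IsFrame (S.scale V r * f) c (S.ϖ ^ r • P) :=
  ⟨hP.indep, fun j => by
    rw [Equiv.Perm.mul_apply, scale_apply, hP.map, Finset.smul_sum]
    simp only [Matrix.smul_apply, smul_smul, smul_eq_mul]⟩

theorem ord_det_smul (r : ℤ) (h : P.det ≠ 0) :
    S.ord (S.ϖ ^ r • P).det = r * Fintype.card ι + S.ord P.det := by
  rw [Matrix.det_smul, S.ord_mul (pow_ne_zero _ (S.zpow_ne r)) h, S.ord_pow, S.ord_ϖ_zpow]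
  ring

theorem ord_det_mul_diagonal (w : ι → ℤ) (h : P.det ≠ 0) :
    S.ord (P * Matrix.diagonal fun j => S.ϖ ^ (-w j)).det = S.ord P.det - ∑ j, w j := by
  rw [Matrix.det_mul, Matrix.det_diagonal, S.ord_mul h, S.ord_prod]
  · simp only [S.ord_ϖ_zpow, Finset.sum_neg_distrib]
    ring
  · exact fun j _ => S.zpow_ne _
  · exact Finset.prod_ne_zero_iff.2 fun j _ => S.zpow_ne _

omit [DecidableEq ι] [DecidableEq κ] in
theorem IsFrame.reindex (hP : IsFrame f c P) (e : κ ≃ ι) :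
    IsFrame f (c ∘ e) (P.submatrix e e) := by
  refine ⟨hP.indep.comp _ e.injective, fun j => ?_⟩
  rw [Function.comp_apply, hP.map]
  exact (e.sum_comp fun i => P i (e j) • c i).symm

/-- The valuation of the determinant of a semilinear map on a stable subspace does not depend on
the basis. -/
theorem IsFrame.ord_det_eq (hf : S.IsSemi f τ) (hP : IsFrame f c P) {d : κ → V}
    {Q : Matrix κ κ K} (hQ : IsFrame f d Q)
    (h : Submodule.span K (Set.range c) = Submodule.span K (Set.range d)) :
    S.ord P.det = S.ord Q.det := by
  have hcard : Fintype.card ι = Fintype.card κ := by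
    rw [← finrank_span_eq_card hP.indep, ← finrank_span_eq_card hQ.indep, h]
  -- Both families are indexed by ι from here on, so that the base change matrices are square.
  let e : ι ≃ κ := Fintype.equivOfCardEq hcard
  have hR := hQ.reindex e
  have hdet : (Q.submatrix e e).det = Q.det := Matrix.det_submatrix_equiv_self e Q
  rw [← hdet]
  have hspan : Submodule.span K (Set.range c) = Submodule.span K (Set.range (d ∘ e)) := by
    rw [h, e.surjective.range_comp]
  generalize d ∘ e = d' at hR hspan
  generalize Q.submatrix e e = Q' at hR
  have h1 : ∀ j, ∃ r : ι → K, ∑ i, r i • c i = d' j := fun j =>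
    (Submodule.mem_span_range_iff_exists_fun K).1
      (hspan ▸ Submodule.subset_span ⟨j, rfl⟩)
  have h2 : ∀ j, ∃ r : ι → K, ∑ i, r i • d' i = c j := fun j =>
    (Submodule.mem_span_range_iff_exists_fun K).1
      (hspan ▸ Submodule.subset_span ⟨j, rfl⟩)
  choose r hr using h1
  choose s hs using h2
  let A : Matrix ι ι K := Matrix.of fun i j => r j i
  let B : Matrix ι ι K := Matrix.of fun i j => s j i
  have hA : ∀ j, d' j = ∑ i, A i j • c i := fun j => (hr j).symm
  have hB : ∀ j, c j = ∑ i, B i j • d' i := fun j => (hs j).symm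
  have hAB : A * B = 1 := matrix_eq_of_sum_smul hP.indep (sum_matrix_smul hA hB)
    (fun j => by simp [Matrix.one_apply])
  have hA0 : A.det ≠ 0 := left_ne_zero_of_mul_eq_one
    (b := B.det) (by rw [← Matrix.det_mul, hAB, Matrix.det_one])
  have hfd : ∀ j, f (d' j) = ∑ i, (A.map τ) i j • f (c i) := fun j => by
    rw [hA, apply_sum_smul hf]; rfl
  -- A semilinear change of basis is a twisted conjugation; det A and τ(det A) have the same
  -- valuation and cancel.
  have key : A * Q' = P * A.map τ := matrix_eq_of_sum_smul hP.indep (sum_matrix_smul hA hR.map)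
    (sum_matrix_smul hP.map hfd)
  have hτA : τ A.det ≠ 0 := by rwa [Ne, map_eq_zero_iff _ τ.injective]
  have h3 := congrArg (fun M : Matrix ι ι K => S.ord M.det) key
  simp only [Matrix.det_mul, det_map] at h3
  rw [S.ord_mul hA0 (hR.det_ne_zero hf), S.ord_mul (hP.det_ne_zero hf) hτA, hf.ord] at h3
  omega

omit [Fintype κ] [DecidableEq κ] [DecidableEq ι] in
theorem isFrame_basis (f : Equiv.Perm V) (b : Module.Basis ι K V) :
    IsFrame f b (Matrix.of fun i j => b.repr (f (b j)) i) :=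
  ⟨b.linearIndependent, fun _ => (b.sum_repr _).symm⟩

omit [DecidableEq ι] in
theorem exists_isFrame {c : ι → V} (hc : LinearIndependent K c)
    (h : ∀ x ∈ Submodule.span K (Set.range c), f x ∈ Submodule.span K (Set.range c)) :
    ∃ P : Matrix ι ι K, IsFrame f c P := by
  have h1 : ∀ j, ∃ r : ι → K, ∑ i, r i • c i = f (c j) := fun j =>
    (Submodule.mem_span_range_iff_exists_fun K).1 (h _ (Submodule.subset_span ⟨j, rfl⟩))
  choose r hr using h1
  exact ⟨Matrix.of fun i j => r j i, hc, fun j => (hr j).symm⟩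

omit [DecidableEq ι] in
theorem IsFrame.apply_mem_span (hf : S.IsSemi f τ) (hP : IsFrame f c P) {x : V}
    (hx : x ∈ Submodule.span K (Set.range c)) : f x ∈ Submodule.span K (Set.range c) := by
  obtain ⟨a, rfl⟩ := (Submodule.mem_span_range_iff_exists_fun K).1 hx
  rw [apply_sum_smul hf]
  refine Submodule.sum_mem _ fun i _ => Submodule.smul_mem _ _ ?_
  rw [hP.map]
  exact Submodule.sum_mem _ fun j _ => Submodule.smul_mem _ _ (Submodule.subset_span ⟨j, rfl⟩)

/-- Since P is invertible, a subspace merely mapped into itself is mapped onto itself. Hence a frame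
always spans a sub-isocrystal, to which admissibility applies. -/
theorem IsFrame.image_span (hf : S.IsSemi f τ) (hP : IsFrame f c P) :
    f '' (Submodule.span K (Set.range c) : Set V) = Submodule.span K (Set.range c) := by
  ext x
  constructor
  · rintro ⟨y, hy, rfl⟩
    exact hP.apply_mem_span hf hy
  · intro hx
    obtain ⟨a, rfl⟩ := (Submodule.mem_span_range_iff_exists_fun K).1 hx
    refine ⟨∑ j, τ⁻¹ ((P⁻¹.mulVec a) j) • c j, Submodule.sum_mem _ fun j _ =>
      Submodule.smul_mem _ _ (Submodule.subset_span ⟨j, rfl⟩), ?_⟩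
    rw [apply_sum_smul hf]
    simp only [apply_inv_apply, hP.map, Finset.smul_sum, smul_smul]
    rw [Finset.sum_comm]
    refine Finset.sum_congr rfl fun i _ => ?_
    rw [← Finset.sum_smul]
    congr 1
    have h1 : P.mulVec (P⁻¹.mulVec a) = a := by
      rw [Matrix.mulVec_mulVec, Matrix.mul_nonsing_inv P
        (isUnit_iff_ne_zero.2 (hP.det_ne_zero hf)), Matrix.one_mulVec]
    have := congrFun h1 i
    rw [Matrix.mulVec, dotProduct] at this
    simp only [mul_comm (P i _)] at this
    exact this

end Frames

section Hodge

variable {V : Type*} [AddCommGroup V] [Module K V] {ι κ : Type*} [Fintype ι] [Fintype κ]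

/-- The dimension of the graded pieces of a family of subspaces. -/
noncomputable def gradedDim (G : ℤ → Submodule K V) (i : ℤ) : ℕ :=
  Module.finrank K (G i ⧸ (G (i + 1)).submoduleOf (G i))

/-- The degree of a filtration. -/
noncomputable def filDegree (G : ℤ → Submodule K V) : ℤ :=
  ∑ᶠ i : ℤ, (gradedDim G i : ℤ) * i

/-- The family `c` with weights `w` is adapted to the filtration `Fil`. -/
def IsAdapted (Fil : ℤ → Submodule K V) (c : ι → V) (w : ι → ℤ) : Prop :=
  ∀ (i : ℤ) (a : ι → K), ∑ j, a j • c j ∈ Fil i ↔ ∀ j, w j < i → a j = 0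

variable {Fil : ℤ → Submodule K V} {c : ι → V} {w : ι → ℤ}

theorem IsAdapted.inf_span (h : IsAdapted Fil c w) (i : ℤ) :
    Fil i ⊓ Submodule.span K (Set.range c) =
      Submodule.span K (Set.range fun j : {j // i ≤ w j} => c j) := by
  classical
  apply le_antisymm
  · rintro x ⟨hx, hx'⟩
    obtain ⟨a, rfl⟩ := (Submodule.mem_span_range_iff_exists_fun K).1 hx'
    have h1 := (h i a).1 hx
    refine Submodule.sum_mem _ fun j _ => ?_
    by_cases hj : i ≤ w j
    · exact Submodule.smul_mem _ _ (Submodule.subset_span ⟨⟨j, hj⟩, rfl⟩)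
    · rw [h1 j (not_le.1 hj), zero_smul]
      exact Submodule.zero_mem _
  · rw [Submodule.span_le]
    rintro _ ⟨⟨j, hj⟩, rfl⟩
    refine ⟨?_, Submodule.subset_span ⟨j, rfl⟩⟩
    have h1 := (h i (Pi.single j 1)).2 fun l hl => by
      have : l ≠ j := fun h => by subst h; omega
      simp [this]
    simpa [Pi.single_apply] using h1

theorem IsAdapted.finrank_eq (h : IsAdapted Fil c w) (hc : LinearIndependent K c) (i : ℤ) :
    Module.finrank K (Fil i ⊓ Submodule.span K (Set.range c) : Submodule K V) =
      (Finset.univ.filter fun j => i ≤ w j).card := by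
  rw [h.inf_span, ← Fintype.card_subtype]
  exact finrank_span_eq_card (hc.comp _ Subtype.val_injective)

theorem IsAdapted.gradedDim_eq (h : IsAdapted Fil c w) (hc : LinearIndependent K c) (i : ℤ) :
    gradedDim (fun i => Fil i ⊓ Submodule.span K (Set.range c)) i =
      (Finset.univ.filter fun j => w j = i).card := by
  classical
  have hle : Fil (i + 1) ⊓ Submodule.span K (Set.range c) ≤
      Fil i ⊓ Submodule.span K (Set.range c) := by
    rw [h.inf_span, h.inf_span]
    refine Submodule.span_mono ?_
    rintro _ ⟨⟨j, hj⟩, rfl⟩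
    exact ⟨⟨j, by omega⟩, rfl⟩
  have : FiniteDimensional K (Fil i ⊓ Submodule.span K (Set.range c) : Submodule K V) := by
    rw [h.inf_span]
    exact FiniteDimensional.span_of_finite K (Set.finite_range _)
  have h1 := Submodule.finrank_quotient_add_finrank
    ((Fil (i + 1) ⊓ Submodule.span K (Set.range c)).submoduleOf
      (Fil i ⊓ Submodule.span K (Set.range c)))
  rw [(Submodule.submoduleOfEquivOfLe hle).finrank_eq, h.finrank_eq hc, h.finrank_eq hc] at h1
  have h2 : (Finset.univ.filter fun j => i ≤ w j) =
      (Finset.univ.filter fun j => w j = i) ∪ (Finset.univ.filter fun j => i + 1 ≤ w j) := by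
    ext j
    simp only [Finset.mem_filter, Finset.mem_univ, true_and, Finset.mem_union]
    omega
  rw [h2, Finset.card_union_of_disjoint] at h1
  · exact Nat.add_right_cancel h1
  · rw [Finset.disjoint_filter]
    intro j _ _
    omega

theorem filDegree_eq_sum {G : ℤ → Submodule K V}
    (h : ∀ i, gradedDim G i = (Finset.univ.filter fun j => w j = i).card) :
    filDegree G = ∑ j, w j := by
  classical
  rw [filDegree, finsum_eq_sum_of_support_subset (s := Finset.univ.image w)]
  · rw [Finset.sum_comp (fun i : ℤ => i) w]
    refine Finset.sum_congr rfl fun i _ => ?_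
    rw [h, nsmul_eq_mul]
  · intro i hi
    rw [Function.mem_support, h] at hi
    have : (Finset.univ.filter fun j => w j = i).card ≠ 0 := fun h0 => hi (by rw [h0]; simp)
    obtain ⟨j, hj⟩ := Finset.card_ne_zero.1 this
    simp only [Finset.mem_filter, Finset.mem_univ, true_and] at hj
    simp only [Finset.coe_image, Finset.coe_univ, Set.image_univ, Set.mem_range]
    exact ⟨j, hj⟩

theorem IsAdapted.filDegree_eq (h : IsAdapted Fil c w) (hc : LinearIndependent K c) :
    filDegree (fun i => Fil i ⊓ Submodule.span K (Set.range c)) = ∑ j, w j :=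
  filDegree_eq_sum (h.gradedDim_eq hc)

theorem isAdapted_basis (b : Module.Basis ι K V)
    (h : ∀ i x, x ∈ Fil i ↔ ∀ j, w j < i → b.repr x j = 0) : IsAdapted Fil b w := by
  intro i a
  rw [h]
  have : ∀ j, b.repr (∑ j, a j • b j) j = a j := fun j => by
    rw [Module.Basis.repr_sum_self]
  simp only [this]

end Hodge

end DVField

/-! ### Restriction to stable subspaces and the operator Φ. -/

namespace DVField

universe u

variable {K : Type*} [Field K] {S : DVField K}

section Restrict

variable {V : Type*} [AddCommGroup V] [Module K V] {f : Equiv.Perm V} {τ : RingAut K}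
  {H : Submodule K V}

theorem mem_iff_of_image_eq (h : f '' (H : Set V) = H) (x : V) : f x ∈ H ↔ x ∈ H := by
  rw [← SetLike.mem_coe, ← SetLike.mem_coe]
  nth_rewrite 1 [← h]
  exact f.injective.mem_set_image

/-- The restriction of a semilinear automorphism to a stable subspace. -/
def restr (f : Equiv.Perm V) (H : Submodule K V) (h : f '' (H : Set V) = H) : Equiv.Perm H :=
  f.subtypePerm (mem_iff_of_image_eq h)

theorem coe_restr (h : f '' (H : Set V) = H) (x : H) : (restr f H h x : V) = f x := rfl

theorem IsSemi.restr (hf : S.IsSemi f τ) (h : f '' (H : Set V) = H) :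
    S.IsSemi (restr f H h) τ :=
  ⟨hf.ord, hf.ϖ, fun x y => Subtype.ext (hf.add x y), fun a x => Subtype.ext (hf.smul a x)⟩

theorem IsFrame.of_restr {ι : Type*} [Fintype ι] {h : f '' (H : Set V) = H} {c : ι → H}
    {P : Matrix ι ι K} (hP : IsFrame (DVField.restr f H h) c P) :
    IsFrame f (fun j => (c j : V)) P := by
  refine ⟨hP.indep.map' H.subtype H.ker_subtype, fun j => ?_⟩
  have := congrArg (H.subtype) (hP.map j)
  rw [map_sum] at this
  exact this

theorem IsFrame.restr {ι : Type*} [Fintype ι] (h : f '' (H : Set V) = H) {c : ι → H}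
    {P : Matrix ι ι K} (hP : IsFrame f (fun j => (c j : V)) P) :
    IsFrame (DVField.restr f H h) c P := by
  refine ⟨LinearIndependent.of_comp H.subtype hP.indep, fun j => Subtype.ext ?_⟩
  rw [coe_restr, hP.map, Submodule.coe_sum]
  rfl

theorem isAdapted_comap_iff {ι : Type*} [Fintype ι] {c : ι → H} {w : ι → ℤ}
    {Fil : ℤ → Submodule K V} :
    IsAdapted (fun i => (Fil i).comap H.subtype) c w ↔ IsAdapted Fil (fun j => (c j : V)) w := by
  unfold IsAdapted
  simp only [Submodule.mem_comap, map_sum, map_smul, Submodule.subtype_apply]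

theorem coe_mem_span {ι : Type*} {c : ι → H} {x : H}
    (hx : x ∈ Submodule.span S.O (Set.range c)) :
    (x : V) ∈ Submodule.span S.O (Set.range fun j => (c j : V)) := by
  induction hx using Submodule.span_induction with
  | mem x hx =>
    obtain ⟨j, rfl⟩ := hx
    exact Submodule.subset_span ⟨j, rfl⟩
  | zero => exact Submodule.zero_mem _
  | add x y _ _ hx hy => exact Submodule.add_mem _ hx hy
  | smul a x _ hx => exact Submodule.smul_mem _ a hx

theorem span_coe_eq {ι : Type*} {c : ι → H} (h : Submodule.span K (Set.range c) = ⊤) :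
    Submodule.span K (Set.range fun j => (c j : V)) = H := by
  have := congrArg (Submodule.map H.subtype) h
  rw [Submodule.map_span, Submodule.map_top, Submodule.range_subtype, ← Set.range_comp] at this
  exact this

theorem exists_eq_top_comap {Fil : ℤ → Submodule K V} (h : ∃ i, Fil i = ⊤) :
    ∃ i, (Fil i).comap H.subtype = ⊤ := by
  obtain ⟨i, hi⟩ := h
  exact ⟨i, by rw [hi, Submodule.comap_top]⟩

theorem exists_eq_bot_comap {Fil : ℤ → Submodule K V} (h : ∃ i, Fil i = ⊥) :
    ∃ i, (Fil i).comap H.subtype = ⊥ := by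
  obtain ⟨i, hi⟩ := h
  exact ⟨i, by rw [hi, Submodule.comap_bot, Submodule.ker_subtype]⟩

end Restrict

section Phi

variable {V : Type*} [AddCommGroup V] [Module K V] {f : Equiv.Perm V} {τ : RingAut K}
  {Fil : ℤ → Submodule K V}

variable (S) in
/-- The operator `M ↦ ∑ ϖ ^ (-i) f (M ∩ Fil i)` on `O`-submodules. -/
def Phi (f : Equiv.Perm V) (Fil : ℤ → Submodule K V) (M : Submodule S.O V) : Submodule S.O V :=
  Submodule.span S.O {y | ∃ i x, x ∈ M ∧ x ∈ Fil i ∧ y = S.ϖ ^ (-i) • f x}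

theorem mem_Phi {M : Submodule S.O V} {i : ℤ} {x : V} (hx : x ∈ M) (hi : x ∈ Fil i) :
    S.ϖ ^ (-i) • f x ∈ S.Phi f Fil M := Submodule.subset_span ⟨i, x, hx, hi, rfl⟩

theorem Phi_mono : Monotone (S.Phi f Fil) := by
  intro M N h
  refine Submodule.span_mono ?_
  rintro _ ⟨i, x, hx, hi, rfl⟩
  exact ⟨i, x, h hx, hi, rfl⟩

theorem Phi_iSup_le {M : ℕ → Submodule S.O V} (hM : Monotone M) :
    S.Phi f Fil (⨆ n, M n) ≤ ⨆ n, S.Phi f Fil (M n) := by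
  rw [Phi, Submodule.span_le]
  rintro _ ⟨i, x, hx, hi, rfl⟩
  obtain ⟨n, hn⟩ := (Submodule.mem_iSup_of_directed M hM.directed_le).1 hx
  exact Submodule.mem_iSup_of_mem n (mem_Phi hn hi)

theorem Phi_top (htop : ∃ i, Fil i = ⊤) : S.Phi f Fil ⊤ = ⊤ := by
  obtain ⟨i, hi⟩ := htop
  rw [eq_top_iff]
  intro x _
  have h1 : f⁻¹ (S.ϖ ^ i • x) ∈ Fil i := by rw [hi]; trivial
  have := mem_Phi (S := S) (f := f) (M := ⊤) trivial h1
  rwa [perm_apply_inv_apply, smul_smul, ← zpow_add₀ S.ϖ_ne, neg_add_cancel, zpow_zero,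
    one_smul] at this

theorem IsAdapted.apply_mem {ι : Type*} [Fintype ι] {c : ι → V} {w : ι → ℤ}
    (h : IsAdapted Fil c w) (j : ι) : c j ∈ Fil (w j) := by
  classical
  have h1 := (h (w j) (Pi.single j 1)).2 fun l hl => by
    have : l ≠ j := fun h => by subst h; omega
    simp [this]
  simpa [Pi.single_apply] using h1

/-- A basis vector of weight w contributes to all steps i ≤ w, but ϖ^(-i) is an integral multiple of
ϖ^(-w), so only i = w counts. Thus Φ maps lattices to finitely generated modules and changes the
volume by ord det f - ∑ w. -/
theorem Phi_span_basis (hf : S.IsSemi f τ) {ι : Type*} [Fintype ι] (b : Module.Basis ι K V)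
    {w : ι → ℤ} (h : IsAdapted Fil b w) :
    S.Phi f Fil (Submodule.span S.O (Set.range b)) =
      Submodule.span S.O (Set.range fun j => S.ϖ ^ (-w j) • f (b j)) := by
  apply le_antisymm
  · rw [Phi, Submodule.span_le]
    rintro _ ⟨i, x, hx, hi, rfl⟩
    have hx' := (S.mem_span_basis b).1 hx
    rw [← b.sum_repr x] at hi
    have hi' := (h i _).1 hi
    rw [← b.sum_repr x, apply_sum_smul hf, Finset.smul_sum]
    refine Submodule.sum_mem _ fun j _ => ?_
    by_cases hj : w j < i
    · rw [hi' j hj, map_zero, zero_smul, smul_zero]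
      exact Submodule.zero_mem _
    · have : S.ϖ ^ (-i) • τ (b.repr x j) • f (b j) =
          (S.ϖ ^ (w j - i) * τ (b.repr x j)) • S.ϖ ^ (-w j) • f (b j) := by
        rw [smul_smul, smul_smul, mul_right_comm, ← zpow_add₀ S.ϖ_ne]
        congr 3
        ring
      rw [this]
      refine S.smul_mem _ (S.O.mul_mem (S.zpow_mem (by omega)) (hf.mem_O.2 (hx' j))) ?_
      exact Submodule.subset_span ⟨j, rfl⟩
  · rw [Submodule.span_le]
    rintro _ ⟨j, rfl⟩
    exact mem_Phi (Submodule.subset_span ⟨j, rfl⟩) (h.apply_mem j)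

end Phi

section StronglyDivisible

/-- Weak admissibility, expressed through adapted bases of stable subspaces. -/
def WeaklyAdmissible (S : DVField K) {V : Type*} [AddCommGroup V] [Module K V]
    (f : Equiv.Perm V) (Fil : ℤ → Submodule K V) : Prop :=
  ∀ (ι : Type) [Fintype ι] [DecidableEq ι] (c : ι → V) (w : ι → ℤ) (P : Matrix ι ι K),
    IsFrame f c P → IsAdapted Fil c w → ∑ j, w j ≤ S.ord P.det

variable {V : Type u} [AddCommGroup V] [Module K V]
  {f : Equiv.Perm V} {τ : RingAut K} {Fil : ℤ → Submodule K V}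

/-- Both sides depend only on the span: the sum of the weights is the degree of the induced
filtration, and the valuation of the determinant is independent of the frame. -/
theorem sum_weight_eq_ord_det (hf : S.IsSemi f τ) {ι κ : Type*} [Fintype ι] [DecidableEq ι]
    [Fintype κ] [DecidableEq κ] {c : ι → V} {w : ι → ℤ} {P : Matrix ι ι K} (hP : IsFrame f c P)
    (hc : IsAdapted Fil c w) {d : κ → V} {v : κ → ℤ} {Q : Matrix κ κ K} (hQ : IsFrame f d Q)
    (hd : IsAdapted Fil d v)
    (hspan : Submodule.span K (Set.range c) = Submodule.span K (Set.range d))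
    (h : ∑ j, w j = S.ord P.det) : ∑ j, v j = S.ord Q.det := by
  rw [← hP.ord_det_eq hf hQ hspan, ← h, ← hc.filDegree_eq hP.indep, ← hd.filDegree_eq hQ.indep,
    hspan]

theorem smul_apply_eq_sum {ι : Type*} [Fintype ι] [DecidableEq ι] {c : ι → V} {P : Matrix ι ι K}
    (hP : IsFrame f c P) (w : ι → ℤ) (j : ι) :
    S.ϖ ^ (-w j) • f (c j) =
      ∑ i, (P * Matrix.diagonal fun j => S.ϖ ^ (-w j)) i j • c i := by
  rw [hP.map, Finset.smul_sum]
  simp only [Matrix.mul_diagonal, smul_smul, mul_comm]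

variable [FiniteDimensional K V]

/-- If the degrees of the filtration and of `f` agree, the chain of lattices which is generated by
`Phi` does not exhaust `V`. -/
theorem fg_top_of_iSup_chain_Phi (hf : S.IsSemi f τ) (hanti : Antitone Fil)
    (htop : ∃ i, Fil i = ⊤) (hbot : ∃ i, Fil i = ⊥) {ι : Type} [Fintype ι] [DecidableEq ι]
    {c : ι → V} {w : ι → ℤ} {P : Matrix ι ι K} (hP : IsFrame f c P) (hc : IsAdapted Fil c w)
    (hspan : Submodule.span K (Set.range c) = ⊤) (hdeg : ∑ j, w j = S.ord P.det)
    {M₀ : Submodule S.O V} (h₀ : S.IsLat M₀) (h : ⨆ n, chain (S.Phi f Fil) M₀ n = ⊤) :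
    (⊤ : Submodule S.O V).FG := by
  refine fg_top_of_iSup_chain_eq_top Phi_mono (Phi_top htop) (fun M hM => Phi_iSup_le hM)
    (fun M hM => ?_) (fun M hM hle => ?_) h₀ h
  · obtain ⟨b, v, hb, rfl⟩ := exists_adapted_basis_of_isLat rfl hM hanti htop hbot
    rw [Phi_span_basis hf b (isAdapted_basis b hb)]
    exact Submodule.fg_span (Set.finite_range _)
  · obtain ⟨b, v, hb, rfl⟩ := exists_adapted_basis_of_isLat rfl hM hanti htop hbot
    have hQ := isFrame_basis f b
    rw [Phi_span_basis hf b (isAdapted_basis b hb)] at hle ⊢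
    -- The matrix expressing Φ(M) through M has determinant of valuation ord det Q - ∑ v, which is 0
    -- by equality of degrees.
    refine span_le_span_of_le b.linearIndependent (smul_apply_eq_sum hQ v) ?_ hle
    rw [ord_det_mul_diagonal v (hQ.det_ne_zero hf), ← sum_weight_eq_ord_det hf hP hc hQ
      (isAdapted_basis b hb) (hspan.trans b.span_eq.symm) hdeg, sub_self]

end StronglyDivisible

end DVField

/-! ### Existence of strongly divisible lattices. -/

namespace DVField

universe u

variable {K : Type*} [Field K] {S : DVField K}

section Glue

variable {V : Type*} [AddCommGroup V] [Module K V]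
  {f : Equiv.Perm V} {τ : RingAut K} {Fil : ℤ → Submodule K V}
  {κ : Type*} [Fintype κ] [DecidableEq κ] (b : Module.Basis κ K V) (T : κ → Prop)

omit [Fintype κ] [DecidableEq κ] in
theorem repr_eq_zero_of_mem_span {x : V}
    (hx : x ∈ Submodule.span K (Set.range fun j : {j // ¬ T j} => b j)) {i : κ} (hi : T i) :
    b.repr x i = 0 := by
  induction hx using Submodule.span_induction with
  | mem x hx =>
    obtain ⟨⟨j, hj⟩, rfl⟩ := hx
    have : j ≠ i := fun h => hj (h ▸ hi)
    simp [this]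
  | zero => simp
  | add x y _ _ hx hy => simp [hx, hy]
  | smul a x _ hx => simp [hx]

omit [DecidableEq κ] in
theorem mem_span_of_repr_eq_zero {x : V} (h : ∀ i, T i → b.repr x i = 0) :
    x ∈ Submodule.span K (Set.range fun j : {j // ¬ T j} => b j) := by
  rw [← b.sum_repr x]
  refine Submodule.sum_mem _ fun j _ => ?_
  by_cases hj : T j
  · rw [h j hj, zero_smul]; exact Submodule.zero_mem _
  · exact Submodule.smul_mem _ _ (Submodule.subset_span ⟨⟨j, hj⟩, rfl⟩)

variable {b T} [DecidablePred T]

omit [DecidableEq κ] in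
theorem isAdapted_restrict {w : κ → ℤ} (h : IsAdapted Fil b w) :
    IsAdapted Fil (fun j : {j // ¬ T j} => b j) (fun j => w j) := by
  classical
  intro i a
  have h1 : ∑ j, a j • b (j : κ) =
      ∑ j, (if hj : ¬ T j then a ⟨j, hj⟩ else 0) • b j := by
    symm
    rw [← Fintype.sum_subtype_add_sum_subtype (fun j => ¬ T j)]
    have h2 : ∀ j : {j // ¬ ¬ T j},
        (if hj : ¬ T (j : κ) then a ⟨j, hj⟩ else 0) • b (j : κ) = 0 := fun j => by
      rw [dif_neg j.2, zero_smul]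
    have h3 : ∀ j : {j // ¬ T j},
        (if hj : ¬ T (j : κ) then a ⟨j, hj⟩ else 0) • b (j : κ) = a j • b j := fun j => by
      rw [dif_pos j.2]
    simp only [h2, h3, Finset.sum_const_zero, add_zero]
  rw [h1, h]
  constructor
  · intro h j hj
    have := h j hj
    rwa [dif_pos j.2] at this
  · intro h j hj
    split_ifs with hT
    · rfl
    · exact h ⟨j, hT⟩ hj

/-- Gluing of a lattice on the span of a part of a basis with the lattice spanned by the rest. -/
theorem exists_glue (hf : S.IsSemi f τ) {w : κ → ℤ}
    (hw : ∀ i x, x ∈ Fil i ↔ ∀ j, w j < i → b.repr x j = 0)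
    (hint : ∀ j, T j → ∀ i, T i → S.ϖ ^ (-w j) * b.repr (f (b j)) i ∈ S.O)
    {ι : Type} [Fintype ι] {c : ι → V} {v : ι → ℤ} (hci : LinearIndependent K c)
    (hc : Submodule.span K (Set.range c) =
      Submodule.span K (Set.range fun j : {j // ¬ T j} => b j))
    (hv : IsAdapted Fil c v)
    (hcint : ∀ j, S.ϖ ^ (-v j) • f (c j) ∈ Submodule.span S.O (Set.range c)) :
    ∃ e : ι ⊕ {j // T j} → V, LinearIndependent K e ∧ Submodule.span K (Set.range e) = ⊤ ∧
      IsAdapted Fil e (Sum.elim v fun j => w j) ∧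
      ∀ j, S.ϖ ^ (-(Sum.elim v (fun j : {j // T j} => w j) j)) • f (e j) ∈
        Submodule.span S.O (Set.range e) := by
  classical
  have hcb : ∀ j i, T i → b.repr (c j) i = 0 := fun j i hi =>
    repr_eq_zero_of_mem_span b T (hc ▸ Submodule.subset_span ⟨j, rfl⟩) hi
  -- The T-components are integral by `hint`. The only obstruction to the naive union of the two
  -- bases is the component `h` in the span of `c`, which may have denominators.
  have hsplit : ∀ j : {j // T j}, ∃ h ∈ Submodule.span K (Set.range c),
      S.ϖ ^ (-w j) • f (b j) = h +
        ∑ i : {i // T i}, (S.ϖ ^ (-w j) * b.repr (f (b j)) i) • b i := by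
    intro j
    refine ⟨∑ i : {i // ¬ T i}, (S.ϖ ^ (-w j) * b.repr (f (b j)) i) • b i, ?_, ?_⟩
    · rw [hc]
      exact Submodule.sum_mem _ fun i _ => Submodule.smul_mem _ _ (Submodule.subset_span ⟨i, rfl⟩)
    · conv_lhs => rw [← b.sum_repr (f (b j)), Finset.smul_sum]
      simp only [smul_smul]
      rw [← Fintype.sum_subtype_add_sum_subtype T, add_comm]
  choose h hh hsum using hsplit
  have habs : ∀ j, ∃ n : ℕ, S.ϖ ^ n • h j ∈ Submodule.span S.O (Set.range c) := fun j =>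
    absorbs_of_span (E := Submodule.span K (Set.range c))
      (le_antisymm (Submodule.span_le.2 (Submodule.span_subset_span S.O K _))
        (Submodule.span_mono Submodule.subset_span)) (hh j)
  choose N hN using habs
  -- A common bound for the finitely many denominators. Scaling `c` by ϖ^(-m) enlarges that lattice
  -- until it contains all `h j`; the scaling affects neither weights nor stability.
  let m : ℕ := Finset.univ.sup N
  have hm : ∀ j, S.ϖ ^ (m : ℤ) • h j ∈ Submodule.span S.O (Set.range c) := fun j =>
    zpow_smul_mem_of_le (m := N j)
      (by exact_mod_cast Finset.le_sup (f := N) (Finset.mem_univ j)) (by simpa using hN j)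
  let e : ι ⊕ {j // T j} → V := Sum.elim (fun j => S.ϖ ^ (-(m : ℤ)) • c j) fun j => b j
  have hscale : ∀ x ∈ Submodule.span S.O (Set.range c),
      S.ϖ ^ (-(m : ℤ)) • x ∈ Submodule.span S.O (Set.range e) := by
    intro x hx
    induction hx using Submodule.span_induction with
    | mem x hx =>
      obtain ⟨j, rfl⟩ := hx
      exact Submodule.subset_span ⟨Sum.inl j, rfl⟩
    | zero => rw [smul_zero]; exact Submodule.zero_mem _
    | add x y _ _ hx hy => rw [smul_add]; exact Submodule.add_mem _ hx hy
    | smul a x _ hx => rw [smul_comm]; exact Submodule.smul_mem _ a hx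
  have hreprT : ∀ (a : ι ⊕ {j // T j} → K) (i : {j // T j}),
      b.repr (∑ j, a j • e j) i = a (Sum.inr i) := by
    intro a i
    rw [Fintype.sum_sum_type]
    simp only [e, Sum.elim_inl, Sum.elim_inr, map_add, map_sum, map_smul, Finsupp.add_apply,
      Finsupp.finsetSum_apply, Finsupp.smul_apply, hcb _ _ i.2, Finset.sum_const_zero,
      zero_add, Module.Basis.repr_self, Finsupp.single_apply, Subtype.coe_inj, smul_eq_mul,
      mul_ite, mul_one, mul_zero, Finset.sum_ite_eq', Finset.mem_univ, if_true]
  have hreprS : ∀ (a : ι ⊕ {j // T j} → K) (i : κ), ¬ T i →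
      b.repr (∑ j, a j • e j) i = b.repr (∑ j, (a (Sum.inl j) * S.ϖ ^ (-(m : ℤ))) • c j) i := by
    intro a i hi
    have hne : ∀ j : {j // T j}, (j : κ) ≠ i := fun j h => hi (h ▸ j.2)
    rw [Fintype.sum_sum_type]
    simp only [e, Sum.elim_inl, Sum.elim_inr, map_add, map_sum, map_smul, Finsupp.add_apply,
      Finsupp.finsetSum_apply, Finsupp.smul_apply, smul_smul, Module.Basis.repr_self,
      Finsupp.single_apply, hne, if_false, smul_eq_mul, mul_assoc, mul_zero,
      Finset.sum_const_zero, add_zero]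
  have hind : LinearIndependent K e := by
    rw [Fintype.linearIndependent_iff]
    intro a ha
    have hT : ∀ i, a (Sum.inr i) = 0 := fun i => by
      rw [← hreprT a i, ha, map_zero]; rfl
    have h0 := ha
    rw [Fintype.sum_sum_type] at h0
    simp only [hT, zero_smul, Finset.sum_const_zero, add_zero, e, Sum.elim_inl, smul_smul] at h0
    have h1 := Fintype.linearIndependent_iff.1 hci _ h0
    rintro (j | j)
    · exact (mul_eq_zero.1 (h1 j)).resolve_right (S.zpow_ne _)
    · exact hT j
  refine ⟨e, hind, ?_, ?_, ?_⟩
  · rw [eq_top_iff, ← b.span_eq, Submodule.span_le]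
    rintro _ ⟨j, rfl⟩
    by_cases hj : T j
    · exact Submodule.subset_span ⟨Sum.inr ⟨j, hj⟩, rfl⟩
    · have h1 : b j ∈ Submodule.span K (Set.range c) := by
        rw [hc]; exact Submodule.subset_span ⟨⟨j, hj⟩, rfl⟩
      refine Submodule.span_le.2 ?_ h1
      rintro _ ⟨i, rfl⟩
      have h2 : c i = S.ϖ ^ (m : ℤ) • e (Sum.inl i) := by
        simp only [e, Sum.elim_inl, smul_smul]
        rw [← zpow_add₀ S.ϖ_ne, add_neg_cancel, zpow_zero, one_smul]
      rw [h2]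
      exact Submodule.smul_mem _ _ (Submodule.subset_span ⟨Sum.inl i, rfl⟩)
  · intro i a
    have h1 := hv i fun j => a (Sum.inl j) * S.ϖ ^ (-(m : ℤ))
    rw [hw] at h1 ⊢
    constructor
    · intro h2
      have h3 := h1.1 fun j hj => by
        by_cases hT : T j
        · simp only [map_sum, map_smul, Finsupp.finsetSum_apply, Finsupp.smul_apply, hcb _ _ hT,
            smul_zero, Finset.sum_const_zero]
        · rw [← hreprS a j hT]
          exact h2 j hj
      rintro (j | j) hj
      · exact (mul_eq_zero.1 (h3 j hj)).resolve_right (S.zpow_ne _)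
      · rw [← hreprT a j]
        exact h2 j hj
    · intro h2 j hj
      by_cases hT : T j
      · rw [hreprT a ⟨j, hT⟩]
        exact h2 (Sum.inr ⟨j, hT⟩) hj
      · rw [hreprS a j hT]
        refine h1.2 (fun l hl => ?_) j hj
        rw [h2 (Sum.inl l) hl, zero_mul]
  · rintro (j | j)
    · have h1 : S.ϖ ^ (-v j) • f (e (Sum.inl j)) =
          S.ϖ ^ (-(m : ℤ)) • S.ϖ ^ (-v j) • f (c j) := by
        simp only [e, Sum.elim_inl]
        rw [hf.apply_zpow_smul, smul_comm]
      simp only [Sum.elim_inl]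
      rw [h1]
      exact hscale _ (hcint j)
    · simp only [Sum.elim_inr]
      have h1 : f (e (Sum.inr j)) = f (b j) := rfl
      rw [h1, hsum j]
      refine Submodule.add_mem _ ?_ (Submodule.sum_mem _ fun i _ => ?_)
      · have := hscale _ (hm j)
        rwa [smul_smul, ← zpow_add₀ S.ϖ_ne, neg_add_cancel, zpow_zero, one_smul] at this
      · exact S.smul_mem _ (hint j j.2 i i.2) (Submodule.subset_span ⟨Sum.inr i, rfl⟩)

/-- A stable `O`-submodule with divisible part `span (b j, ¬ T j)` forces the degrees of `f` and
of the filtration to agree on the divisible part, if they agree on the whole space. -/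
theorem sum_weight_eq_of_block (hf : S.IsSemi f τ) (hwa : S.WeaklyAdmissible f Fil)
    {κ : Type} [Fintype κ] [DecidableEq κ] {b : Module.Basis κ K V} {T : κ → Prop} [DecidablePred T] {w : κ → ℤ}
    (hw : IsAdapted Fil b w)
    (hzero : ∀ i, T i → ∀ j, ¬ T j → b.repr (f (b j)) i = 0)
    (hint : ∀ j, T j → ∀ i, T i → S.ϖ ^ (-w j) * b.repr (f (b j)) i ∈ S.O)
    (hdeg : ∑ j, w j =
      S.ord (Matrix.of fun i j => b.repr (f (b j)) i : Matrix κ κ K).det) :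
    ∃ P : Matrix {j // ¬ T j} {j // ¬ T j} K, IsFrame f (fun j : {j // ¬ T j} => b j) P ∧
      ∑ j : {j // ¬ T j}, w j = S.ord P.det := by
  set P : Matrix κ κ K := Matrix.of fun i j => b.repr (f (b j)) i with hP
  have hPdet := (isFrame_basis f b).det_ne_zero hf
  rw [← hP] at hPdet
  -- By `hzero` the span of the vectors outside `T` is stable, so P is block triangular, with blocks
  -- A on this subspace and B on the quotient.
  have hblock := Matrix.twoBlockTriangular_det P (fun j => ¬ T j)
    (fun i hi j hj => hzero i (not_not.1 hi) j hj)
  set A := P.toSquareBlockProp fun j => ¬ T j with hA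
  set B := P.toSquareBlockProp fun j => ¬ ¬ T j with hB
  rw [hblock] at hPdet hdeg
  have hA0 := left_ne_zero_of_mul hPdet
  have hB0 := right_ne_zero_of_mul hPdet
  have hfr : IsFrame f (fun j : {j // ¬ T j} => b j) A := by
    refine ⟨b.linearIndependent.comp _ Subtype.val_injective, fun j => ?_⟩
    rw [← b.sum_repr (f (b j)), ← Fintype.sum_subtype_add_sum_subtype (fun j => ¬ T j)]
    have h1 : ∀ i : {i // ¬ ¬ T i}, b.repr (f (b j)) i • b i = 0 := fun i => by
      rw [hzero i (not_not.1 i.2) j j.2, zero_smul]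
    simp only [h1, Finset.sum_const_zero, add_zero]
    rfl
  refine ⟨A, hfr, ?_⟩
  have h1 := hwa _ _ _ A hfr (isAdapted_restrict hw)
  -- On the quotient the inequality comes from integrality, on the subspace (`h1`) from weak
  -- admissibility. As the totals agree, both are equalities.
  have h2 : ∑ j : {j // ¬ ¬ T j}, w j ≤ S.ord B.det := by
    have h3 := S.det_mem (Q := B * Matrix.diagonal fun j : {j // ¬ ¬ T j} => S.ϖ ^ (-w j))
      fun i j => by
        rw [Matrix.mul_diagonal, mul_comm]
        exact hint j (not_not.1 j.2) i (not_not.1 i.2)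
    rw [S.mem_O, ord_det_mul_diagonal (fun j : {j // ¬ ¬ T j} => w j) hB0] at h3
    omega
  rw [S.ord_mul hA0 hB0, ← Fintype.sum_subtype_add_sum_subtype (fun j => ¬ T j)] at hdeg
  omega

end Glue

/-- A weakly admissible filtration of the right degree has a strongly divisible lattice. -/
theorem exists_strongly_divisible (n : ℕ) : ∀ (V : Type u) [AddCommGroup V] [Module K V]
    [FiniteDimensional K V] (_ : Module.finrank K V = n) (f : Equiv.Perm V) (τ : RingAut K)
    (_ : S.IsSemi f τ) (Fil : ℤ → Submodule K V) (_ : Antitone Fil)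
    (_ : ∃ i, Fil i = ⊤) (_ : ∃ i, Fil i = ⊥) (_ : S.WeaklyAdmissible f Fil)
    (ι : Type) [Fintype ι] [DecidableEq ι] (c : ι → V) (w : ι → ℤ) (P : Matrix ι ι K)
    (_ : IsFrame f c P) (_ : IsAdapted Fil c w) (_ : Submodule.span K (Set.range c) = ⊤)
    (_ : ∑ j, w j = S.ord P.det),
    ∃ (κ : Type) (_ : Fintype κ) (e : κ → V) (v : κ → ℤ), LinearIndependent K e ∧
      Submodule.span K (Set.range e) = ⊤ ∧ IsAdapted Fil e v ∧
      ∀ j, S.ϖ ^ (-v j) • f (e j) ∈ Submodule.span S.O (Set.range e) := by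
  induction n using Nat.strong_induction_on with
  | _ n ih =>
  intro V _ _ _ hn f τ hf Fil hanti htop hbot hwa ι _ _ c w P hP hc hspan hdeg
  classical
  let M₀ : Submodule S.O V := Submodule.span S.O (Set.range (Module.finBasis K V))
  have hM₀ : S.IsLat M₀ := isLat_span_basis _
  -- The smallest Φ-stable O-submodule containing `M₀`. It need not be finitely generated; the
  -- indices outside `T` span its divisible part.
  let U : Submodule S.O V := ⨆ n, chain (S.Phi f Fil) M₀ n
  have hΦU : S.Phi f Fil U ≤ U := map_iSup_chain_le (fun M hM => Phi_iSup_le hM) Phi_mono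
  have hUabs : ∀ x : V, ∃ n : ℕ, S.ϖ ^ n • x ∈ U := fun x =>
    (hM₀.2 x).imp fun _ h => (le_iSup (chain (S.Phi f Fil) M₀) 0) h
  obtain ⟨b, v, T, hv, hT⟩ := S.exists_adapted_basis n V hn U hUabs Fil hanti htop hbot
  have hbv := isAdapted_basis b hv
  have hbU : ∀ j, b j ∈ U := fun j => (hT _).2 fun i _ => by
    rw [Module.Basis.repr_self, Finsupp.single_apply]
    split_ifs
    · exact S.O.one_mem
    · exact S.O.zero_mem
  have hint : ∀ j, ∀ i, T i → S.ϖ ^ (-v j) * b.repr (f (b j)) i ∈ S.O := fun j i hi => by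
    have h1 := (hT _).1 (hΦU (mem_Phi (hbU j) (hbv.apply_mem j))) i hi
    rwa [map_smul, Finsupp.smul_apply, smul_eq_mul] at h1
  by_cases hall : ∀ j, T j
  · refine ⟨Fin n, inferInstance, b, v, b.linearIndependent, b.span_eq, hbv, fun j => ?_⟩
    rw [S.mem_span_basis]
    intro i
    rw [map_smul, Finsupp.smul_apply, smul_eq_mul]
    exact hint j i (hall i)
  push Not at hall
  obtain ⟨j₀, hj₀⟩ := hall
  have hline : ∀ j, ¬ T j → ∀ a : K, a • b j ∈ U := fun j hj a => (hT _).2 fun i hi => by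
    have : j ≠ i := fun h => hj (h ▸ hi)
    rw [map_smul, Module.Basis.repr_self, Finsupp.smul_apply, Finsupp.single_apply, if_neg this,
      smul_zero]
    exact S.O.zero_mem
  -- K-lines inside `U` are sent to K-lines inside `U`, whose coordinates in `T` are integral for
  -- every scalar and therefore vanish. The scalar τ⁻¹(ϖ^(v j) a) undoes both the twist by τ and the
  -- factor ϖ^(-v j) of Φ.
  have hzero : ∀ i, T i → ∀ j, ¬ T j → b.repr (f (b j)) i = 0 := by
    intro i hi j hj
    by_contra h0
    refine not_forall_smul_mem_of_fg (S := S) (M := Submodule.span S.O {(1 : K)})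
      (Submodule.fg_span_singleton _) (x := b.repr (f (b j)) i) (l := LinearMap.id) h0
      fun a => ?_
    have h1 := mem_Phi (f := f) (Fil := Fil) (hline j hj (τ⁻¹ (S.ϖ ^ (v j) * a)))
      (Submodule.smul_mem _ _ (hbv.apply_mem j))
    have h2 := (hT _).1 (hΦU h1) i hi
    rw [hf.smul, apply_inv_apply, smul_smul, ← mul_assoc, ← zpow_add₀ S.ϖ_ne, neg_add_cancel,
      zpow_zero, one_mul, map_smul, Finsupp.smul_apply] at h2
    exact Submodule.mem_span_singleton.2 ⟨⟨_, h2⟩, by simp [Subring.smul_def]⟩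
  -- No index in `T` would mean U = V, which preservation of volume excludes.
  by_cases hnone : ∀ j, ¬ T j
  · have hUtop : U = ⊤ := top_le_iff.1 fun x _ => (hT x).2 fun j hj => absurd hj (hnone j)
    have hfg := fg_top_of_iSup_chain_Phi hf hanti htop hbot hP hc hspan hdeg hM₀ hUtop
    exact absurd (fun a => trivial) (not_forall_smul_mem_of_fg hfg (x := b j₀)
      (l := b.coord j₀) (by simp))
  push Not at hnone
  obtain ⟨j₁, hj₁⟩ := hnone
  have hdegb := sum_weight_eq_ord_det hf hP hc (isFrame_basis f b) hbv
    (hspan.trans b.span_eq.symm) hdeg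
  -- The divisible part inherits the equality of degrees and so all hypotheses of the induction.
  obtain ⟨A, hA, hAdeg⟩ := sum_weight_eq_of_block hf hwa hbv hzero
    (fun j _ i hi => hint j i hi) hdegb
  let H : Submodule K V := Submodule.span K (Set.range fun j : {j // ¬ T j} => b j)
  have hH : f '' (H : Set V) = H := hA.image_span hf
  have hrank : Module.finrank K H < n := by
    have h1 : Module.finrank K H = Fintype.card {j // ¬ T j} := finrank_span_eq_card hA.indep
    have h2 : Fintype.card {j // ¬ T j} < Fintype.card (Fin n) :=
      Fintype.card_subtype_lt (x := j₁) (not_not.2 hj₁)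
    rw [Fintype.card_fin] at h2
    omega
  let cH : {j // ¬ T j} → H := fun j => ⟨b j, Submodule.subset_span ⟨j, rfl⟩⟩
  have hcH : IsFrame (restr f H hH) cH A := IsFrame.restr hH hA
  have hcHspan : Submodule.span K (Set.range cH) = ⊤ := by
    refine Submodule.map_injective_of_injective H.injective_subtype ?_
    rw [Submodule.map_span, Submodule.map_top, Submodule.range_subtype, ← Set.range_comp]
    rfl
  obtain ⟨κ, _, e, u, hei, hes, hea, hed⟩ := ih _ hrank H rfl (restr f H hH) τ (hf.restr hH)
    (fun i => (Fil i).comap H.subtype) (fun i j hij => Submodule.comap_mono (hanti hij))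
    (exists_eq_top_comap htop) (exists_eq_bot_comap hbot)
    (fun ι _ _ c w P hP hc => hwa ι _ w P hP.of_restr (isAdapted_comap_iff.1 hc))
    _ cH (fun j => v j) A hcH (isAdapted_comap_iff.2 (isAdapted_restrict hbv)) hcHspan hAdeg
  obtain ⟨e', h1, h2, h3, h4⟩ := exists_glue (T := T) hf hv (fun j _ i hi => hint j i hi)
    (c := fun j => (e j : V)) (v := u) (hei.map' H.subtype H.ker_subtype) (span_coe_eq hes)
    (isAdapted_comap_iff.1 hea) (fun j => coe_mem_span (hed j))
  exact ⟨_, inferInstance, e', _, h1, h2, h3, h4⟩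

end DVField

/-! ### Vectors with bounded forward orbit as a complement of an expanding subspace. -/

namespace DVField

universe u

variable {K : Type*} [Field K] {S : DVField K}

section Split

variable {V : Type*} [AddCommGroup V] [Module K V]
  {f g θ : Equiv.Perm V} {τ ρ : RingAut K}

/-- Power series in `ϖ` with coefficients in a finitely generated `O`-module converge. -/
theorem exists_sum_of_fg {M : Submodule S.O V} (hM : M.FG) {k : ℕ → V} (hk : ∀ n, k n ∈ M) :
    ∃ z : V, ∀ n, ∃ t ∈ M, z = ∑ j ∈ Finset.range n, S.ϖ ^ j • k j + S.ϖ ^ n • t := by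
  obtain ⟨d, e, rfl⟩ := Submodule.fg_iff_exists_fin_generating_family.1 hM
  have h1 : ∀ n, ∃ a : Fin d → S.O, ∑ i, a i • e i = k n := fun n =>
    (Submodule.mem_span_range_iff_exists_fun S.O).1 (hk n)
  choose a ha using h1
  have h2 := fun i => S.complete (fun n => (a n i : K)) fun n => (a n i).2
  choose s hs using h2
  refine ⟨∑ i, s i • e i, fun n => ⟨∑ i, ((s i - ∑ j ∈ Finset.range n, S.ϖ ^ j * (a j i : K)) *
    (S.ϖ ^ n)⁻¹) • e i, Submodule.sum_mem _ fun i _ => S.smul_mem _ (hs i n)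
      (Submodule.subset_span ⟨i, rfl⟩), ?_⟩⟩
  have h3 : ∑ j ∈ Finset.range n, S.ϖ ^ j • k j =
      ∑ i, (∑ j ∈ Finset.range n, S.ϖ ^ j * (a j i : K)) • e i := by
    simp only [Finset.sum_smul]
    rw [Finset.sum_comm]
    refine Finset.sum_congr rfl fun j _ => ?_
    rw [← ha j, Finset.smul_sum]
    refine Finset.sum_congr rfl fun i _ => ?_
    rw [mul_smul]
    rfl
  rw [h3, Finset.smul_sum, ← Finset.sum_add_distrib]
  refine Finset.sum_congr rfl fun i _ => ?_
  rw [smul_smul, ← add_smul]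
  congr 1
  have := pow_ne_zero n S.ϖ_ne
  field_simp
  ring

theorem exists_zpow_smul_mem_of_fg {M N : Submodule S.O V} {H : Submodule K V}
    (hM : ∀ x ∈ H, ∃ n : ℕ, S.ϖ ^ n • x ∈ M) (hN : N.FG) (hNH : ∀ x ∈ N, x ∈ H) :
    ∃ n : ℕ, ∀ m : ℤ, n ≤ m → ∀ x ∈ N, S.ϖ ^ m • x ∈ M := by
  obtain ⟨s, rfl⟩ := hN
  choose! n hn using hM
  refine ⟨s.sup n, fun m hm x hx => ?_⟩
  induction hx using Submodule.span_induction with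
  | mem x hx =>
    have := Finset.le_sup (f := n) hx
    exact zpow_smul_mem_of_le (m := n x) (by omega)
      (by simpa using hn x (hNH x (Submodule.subset_span hx)))
  | zero => simp
  | add x y _ _ hx hy => rw [smul_add]; exact M.add_mem hx hy
  | smul a x _ hx => rw [smul_comm]; exact M.smul_mem a hx

theorem eq_zero_of_forall_smul_mem [FiniteDimensional K V] {M : Submodule S.O V} (hM : M.FG)
    {x : V} (h : ∀ n : ℕ, S.ϖ ^ (-(n : ℤ)) • x ∈ M) : x = 0 := by
  let b := Module.finBasis K V
  rw [← b.sum_repr x]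
  refine Finset.sum_eq_zero fun i _ => ?_
  obtain ⟨m, hm⟩ := exists_forall_zpow_mul_mem_of_fg hM (b.coord i)
  have : b.repr x i = 0 := S.eq_zero_of_forall_mem fun n => by
    have h1 := hm _ (h (n + m))
    rw [map_smul, smul_eq_mul, Module.Basis.coord_apply, ← mul_assoc, ← zpow_natCast,
      ← zpow_add₀ S.ϖ_ne] at h1
    convert h1 using 3
    push_cast
    ring
  rw [this, zero_smul]

/-- The vectors with bounded forward orbit under `θ`. -/
def boundedPart (hθ : S.IsSemi θ ρ) (Λ : Submodule S.O V) : Submodule K V where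
  carrier := {x | ∃ m : ℕ, ∀ n : ℕ, S.ϖ ^ (m : ℤ) • (θ ^ n) x ∈ Λ}
  zero_mem' := ⟨0, fun n => by rw [(hθ.pow n).map_zero, smul_zero]; exact Λ.zero_mem⟩
  add_mem' := by
    rintro x y ⟨m, hm⟩ ⟨l, hl⟩
    refine ⟨m + l, fun n => ?_⟩
    rw [(hθ.pow n).add, smul_add]
    exact Λ.add_mem (zpow_smul_mem_of_le (by push_cast; omega) (hm n))
      (zpow_smul_mem_of_le (by push_cast; omega) (hl n))
  smul_mem' := by
    rintro a x ⟨m, hm⟩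
    obtain ⟨l, hl⟩ := S.exists_zpow_mul_mem (fun _ : Unit => a)
    refine ⟨m + l, fun n => ?_⟩
    have h1 := (hθ.pow n).mem_O.2 (hl l le_rfl ())
    rw [map_mul, (hθ.pow n).map_zpow] at h1
    have h2 : S.ϖ ^ ((m + l : ℕ) : ℤ) • (θ ^ n) (a • x) =
        (S.ϖ ^ (l : ℤ) * (ρ ^ n) a) • S.ϖ ^ (m : ℤ) • (θ ^ n) x := by
      rw [(hθ.pow n).smul, smul_smul, smul_smul, Nat.cast_add, zpow_add₀ S.ϖ_ne]
      congr 1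
      ring
    rw [h2]
    exact S.smul_mem Λ h1 (hm n)

/-- Since `g` commutes with θ, it carries the orbit of x to the orbit of g x, and it enlarges the
denominators relative to Λ by a bounded power of ϖ only. -/
theorem apply_mem_boundedPart {hθ : S.IsSemi θ ρ} {Λ : Submodule S.O V} (hΛ : S.IsLat Λ)
    (hg : S.IsSemi g τ) (hc : Commute g θ) {x : V} (hx : x ∈ boundedPart hθ Λ) :
    g x ∈ boundedPart hθ Λ := by
  obtain ⟨m, hm⟩ := hx
  obtain ⟨l, hl⟩ := hΛ.exists_zpow_smul_mem (img_fg hg hΛ.1)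
  refine ⟨m + l, fun n => ?_⟩
  have h1 := hl l le_rfl _ (apply_mem_img (f := g) (hm n))
  rw [hg.apply_zpow_smul, smul_smul, ← zpow_add₀ S.ϖ_ne] at h1
  have h2 : (θ ^ n) (g x) = g ((θ ^ n) x) := by
    rw [← Equiv.Perm.mul_apply, ← Equiv.Perm.mul_apply, (hc.pow_right n).eq]
  rw [h2]
  convert h1 using 3
  push_cast
  ring

theorem image_eq_of_forall_mem {H : Submodule K V} (h1 : ∀ x ∈ H, f x ∈ H)
    (h2 : ∀ x ∈ H, f⁻¹ x ∈ H) : f '' (H : Set V) = H := by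
  ext x
  constructor
  · rintro ⟨y, hy, rfl⟩
    exact h1 y hy
  · exact fun hx => ⟨f⁻¹ x, h2 x hx, perm_apply_inv_apply f x⟩

theorem image_boundedPart {hθ : S.IsSemi θ ρ} {Λ : Submodule S.O V} (hΛ : S.IsLat Λ)
    (hf : S.IsSemi f τ) (hc : Commute f θ) :
    f '' (boundedPart hθ Λ : Set V) = boundedPart hθ Λ :=
  image_eq_of_forall_mem (fun _ => apply_mem_boundedPart hΛ hf hc)
    (fun _ => apply_mem_boundedPart hΛ hf.inv hc.inv_left)

section

variable {H : Submodule K V} {N M : Submodule S.O V}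

/-- The hypothesis `hcon` says that θ⁻¹ M ⊆ ϖ M; iterating it gives θ^(-n) M ⊆ ϖ^n M. -/
theorem inv_pow_mem_of_contract (hθ : S.IsSemi θ ρ)
    (hcon : ∀ x ∈ M, S.ϖ ^ (-1 : ℤ) • θ⁻¹ x ∈ M) (n : ℕ) {x : V} (hx : x ∈ M) :
    S.ϖ ^ (-(n : ℤ)) • (θ⁻¹ ^ n) x ∈ M := by
  induction n with
  | zero => simpa using hx
  | succ n ih =>
    have h1 := hcon _ ih
    rw [hθ.inv.apply_zpow_smul, smul_smul, ← zpow_add₀ S.ϖ_ne, ← Equiv.Perm.mul_apply,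
      ← pow_succ'] at h1
    convert h1 using 3
    push_cast
    ring

theorem inv_pow_mem_of_contract' (hθ : S.IsSemi θ ρ)
    (hcon : ∀ x ∈ M, S.ϖ ^ (-1 : ℤ) • θ⁻¹ x ∈ M) (n : ℕ) {x : V} (hx : x ∈ M) :
    (θ⁻¹ ^ n) x ∈ M := by
  have := zpow_smul_mem_of_le (n := 0) (by omega) (inv_pow_mem_of_contract hθ hcon n hx)
  simpa using this

/-- Modulo the expanding part, every vector of `N` has a representative with bounded forward
orbit. -/
theorem exists_bounded_sub (hθ : S.IsSemi θ ρ) (hM : M.FG) (hMH : ∀ x ∈ M, x ∈ H)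
    (hθH : ∀ x ∈ H, θ x ∈ H) (habs : ∀ x ∈ H, ∃ n : ℕ, S.ϖ ^ n • x ∈ M)
    (hcon : ∀ x ∈ M, S.ϖ ^ (-1 : ℤ) • θ⁻¹ x ∈ M)
    (hstep : ∀ y ∈ N, ∃ y' ∈ N, ∃ k ∈ M, θ y = y' + k) {y : V} (hy : y ∈ N) :
    ∃ z ∈ H, ∀ n : ℕ, (θ ^ n) (y - z) ∈ N ⊔ M := by
  choose! Y hY k hk hYk using hstep
  -- Following the N-component of the orbit produces an error `k (ys j)` in M at each step. The
  -- correction z is the sum of these errors pulled back by θ^(-(j+1)), which converges because θ⁻¹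
  -- contracts M.
  let ys : ℕ → V := fun n => Y^[n] y
  have hys : ∀ n, ys n ∈ N := fun n => by
    induction n with
    | zero => exact hy
    | succ n ih => simp only [ys, Function.iterate_succ_apply']; exact hY _ ih
  have hys' : ∀ n, θ (ys n) = ys (n + 1) + k (ys n) := fun n => by
    simp only [ys, Function.iterate_succ_apply']
    exact hYk _ (hys n)
  let u : ℕ → V := fun j => (θ⁻¹ ^ (j + 1)) (k (ys j))
  have hu : ∀ n j, j ≤ n → (θ ^ j) (u n) = (θ⁻¹ ^ (n - j + 1)) (k (ys n)) := by
    intro n j hj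
    simp only [u]
    rw [← Equiv.Perm.mul_apply]
    congr 1
    have : n + 1 = j + (n - j + 1) := by omega
    rw [this, pow_add, ← mul_assoc, inv_pow, mul_inv_cancel, one_mul]
  have hu1 : ∀ n, θ ^ (n + 1) * θ⁻¹ ^ (n + 1) = 1 := fun n => by
    rw [inv_pow, mul_inv_cancel]
  have hpart : ∀ n, (θ ^ n) (y - ∑ j ∈ Finset.range n, u j) = ys n := by
    intro n
    induction n with
    | zero => simp [ys]
    | succ n ih =>
      rw [Finset.sum_range_succ, ← sub_sub, (hθ.pow (n + 1)).map_sub, pow_succ',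
        Equiv.Perm.mul_apply, ih, hys']
      have : (θ * θ ^ n) (u n) = k (ys n) := by
        rw [← pow_succ']
        change (θ ^ (n + 1)) ((θ⁻¹ ^ (n + 1)) (k (ys n))) = _
        rw [← Equiv.Perm.mul_apply, hu1]
        rfl
      rw [this, add_sub_cancel_right]
  have hv : ∀ n : ℕ, S.ϖ ^ (-(n : ℤ)) • u n ∈ M := fun n => by
    refine zpow_smul_mem_of_le (m := -((n + 1 : ℕ) : ℤ)) (by push_cast; omega) ?_
    exact inv_pow_mem_of_contract hθ hcon (n + 1) (hk _ (hys n))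
  obtain ⟨z, hz⟩ := exists_sum_of_fg hM hv
  have hterm : ∀ j : ℕ, S.ϖ ^ j • S.ϖ ^ (-(j : ℤ)) • u j = u j := fun j => by
    rw [← zpow_natCast, smul_smul, ← zpow_add₀ S.ϖ_ne, add_neg_cancel, zpow_zero, one_smul]
  simp only [hterm] at hz
  refine ⟨z, ?_, fun n => ?_⟩
  · obtain ⟨t, ht, h⟩ := hz 0
    rw [h]
    simpa using hMH t ht
  have hHn : ∀ x ∈ H, (θ ^ n) x ∈ H := by
    intro x hx
    induction n with
    | zero => exact hx
    | succ n ih => rw [pow_succ', Equiv.Perm.mul_apply]; exact hθH _ ih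
  -- The exponent `a` depends on n: θ^n may introduce denominators ϖ^a. Cutting the series at n + a
  -- instead of n makes the image of its tail lie in M.
  obtain ⟨a, ha⟩ := exists_zpow_smul_mem_of_fg habs (img_fg (hθ.pow n) hM) fun x hx => by
    obtain ⟨y, hy, rfl⟩ := (mem_img (hθ.pow n)).1 hx
    exact hHn y (hMH y hy)
  obtain ⟨t, ht, hzt⟩ := hz (n + a)
  have h1 : y - z = (y - ∑ j ∈ Finset.range n, u j) -
      (∑ j ∈ Finset.range a, u (n + j) + S.ϖ ^ (n + a) • t) := by
    rw [hzt, Finset.sum_range_add]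
    abel
  rw [h1, (hθ.pow n).map_sub, hpart]
  refine Submodule.sub_mem _ (Submodule.mem_sup_left (hys n)) (Submodule.mem_sup_right ?_)
  rw [(hθ.pow n).add, (hθ.pow n).map_sum]
  refine M.add_mem (M.sum_mem fun j _ => ?_) ?_
  · rw [hu (n + j) n (by omega)]
    exact inv_pow_mem_of_contract' hθ hcon _ (hk _ (hys _))
  · have h2 := ha ((n + a : ℕ) : ℤ) (by push_cast; omega) _ (apply_mem_img (f := θ ^ n) ht)
    rwa [← (hθ.pow n).apply_zpow_smul, zpow_natCast] at h2

/-- On H the inverse of θ contracts, so θ expands: a vector of H with bounded orbit lies in every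
ϖ^n M and is zero. That H and the bounded part span follows from `exists_bounded_sub`. -/
theorem isCompl_boundedPart [FiniteDimensional K V] (hθ : S.IsSemi θ ρ) {Λ : Submodule S.O V}
    (hΛ : S.IsLat Λ) (hN : N.FG) (hM : M.FG) (hMH : ∀ x ∈ M, x ∈ H)
    (hθH : ∀ x ∈ H, θ x ∈ H) (habs : ∀ x ∈ H, ∃ n : ℕ, S.ϖ ^ n • x ∈ M)
    (hcon : ∀ x ∈ M, S.ϖ ^ (-1 : ℤ) • θ⁻¹ x ∈ M)
    (hstep : ∀ y ∈ N, ∃ y' ∈ N, ∃ k ∈ M, θ y = y' + k)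
    (hspan : ∀ x : V, ∃ n : ℕ, ∃ y ∈ N, ∃ h ∈ H, S.ϖ ^ n • x = y + h) :
    IsCompl H (boundedPart hθ Λ) := by
  constructor
  · rw [Submodule.disjoint_def]
    rintro x hx ⟨m, hm⟩
    have hfg : (Λ ⊓ H.restrictScalars S.O : Submodule S.O V).FG :=
      Submodule.FG.of_le hΛ.1 inf_le_left
    obtain ⟨a, ha⟩ := exists_zpow_smul_mem_of_fg habs hfg fun x hx => hx.2
    have hHn : ∀ n : ℕ, (θ ^ n) x ∈ H := by
      intro n
      induction n with
      | zero => exact hx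
      | succ n ih => rw [pow_succ', Equiv.Perm.mul_apply]; exact hθH _ ih
    -- Pull the bounded vector θ^n x back by θ^(-n), gaining a factor ϖ^n.
    have h1 : ∀ n : ℕ, S.ϖ ^ ((a + m : ℤ) - n) • x ∈ M := by
      intro n
      have h2 := ha a le_rfl _ ⟨hm n, H.smul_mem _ (hHn n)⟩
      have h3 := inv_pow_mem_of_contract hθ hcon n h2
      rw [(hθ.inv.pow n).apply_zpow_smul, (hθ.inv.pow n).apply_zpow_smul, smul_smul, smul_smul,
        ← zpow_add₀ S.ϖ_ne, ← zpow_add₀ S.ϖ_ne] at h3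
      rw [← Equiv.Perm.mul_apply, inv_pow, inv_mul_cancel, Equiv.Perm.one_apply] at h3
      convert h3 using 3
      ring
    refine eq_zero_of_forall_smul_mem hM fun n => ?_
    have := h1 (a + m + n)
    convert this using 3
    push_cast
    ring
  · rw [codisjoint_iff, eq_top_iff]
    intro x _
    obtain ⟨n, y, hy, h, hh, hx⟩ := hspan x
    obtain ⟨z, hz, hb⟩ := exists_bounded_sub hθ hM hMH hθH habs hcon hstep hy
    obtain ⟨m, hm⟩ := hΛ.exists_zpow_smul_mem (hN.sup hM)
    have h1 : y - z ∈ boundedPart hθ Λ := ⟨m, fun n => hm m le_rfl _ (hb n)⟩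
    have h2 : S.ϖ ^ n • x ∈ H ⊔ boundedPart hθ Λ := by
      have : S.ϖ ^ n • x = (h + z) + (y - z) := by rw [hx]; abel
      rw [this]
      exact Submodule.add_mem _ (Submodule.mem_sup_left (H.add_mem hh hz))
        (Submodule.mem_sup_right h1)
    exact (Submodule.smul_mem_iff _ (pow_ne_zero n S.ϖ_ne)).1 h2

end

end Split

end DVField

/-! ### Isoclinic subspaces and the splitting of an isocrystal. -/

namespace DVField

universe u

variable {K : Type*} [Field K] {S : DVField K}

section Isoclinic

variable {V : Type*} [AddCommGroup V] [Module K V] {f g : Equiv.Perm V} {τ ρ : RingAut K}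

/-- The stable subspace `E` is isoclinic of slope `α`. -/
def IsIsoclinicOf (S : DVField K) (f : Equiv.Perm V) (E : Submodule K V) (α : ℚ) : Prop :=
  f '' (E : Set V) = E ∧ ∃ (s : ℕ) (r : ℤ), 0 < s ∧ α = (r : ℚ) / (s : ℚ) ∧
    ∃ M : Submodule S.O V, (M.FG ∧ Submodule.span K (M : Set V) = E) ∧
      f^[s] '' (M : Set V) = (fun x => S.ϖ ^ r • x) '' (M : Set V)

variable (S) in
/-- The automorphism `ϖ ^ (-r) f ^ s`. -/
def twist (f : Equiv.Perm V) (s : ℕ) (r : ℤ) : Equiv.Perm V := S.scale V (-r) * f ^ s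

theorem IsSemi.twist (hf : S.IsSemi f τ) (s : ℕ) (r : ℤ) : S.IsSemi (S.twist f s r) (τ ^ s) := by
  have := (isSemi_scale (S := S) (V := V) (-r)).mul (hf.pow s)
  rwa [one_mul] at this

theorem twist_apply (s : ℕ) (r : ℤ) (x : V) : S.twist f s r x = S.ϖ ^ (-r) • (f ^ s) x := rfl

theorem IsSemi.commute_twist (hf : S.IsSemi f τ) (s : ℕ) (r : ℤ) : Commute f (S.twist f s r) :=
  (hf.commute_scale _).mul_right ((Commute.refl f).pow_right s)

theorem twist_pow (hf : S.IsSemi f τ) (s : ℕ) (r : ℤ) (t : ℕ) :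
    S.twist f s r ^ t = S.twist f (s * t) (r * t) := by
  have hc : Commute (S.scale V (-r)) (f ^ s) := ((hf.commute_scale (-r)).pow_left s).symm
  rw [twist, hc.mul_pow, twist, pow_mul]
  congr 1
  induction t with
  | zero =>
    ext x
    simp [scale_apply]
  | succ t ih =>
    rw [pow_succ, ih, ← scale_add]
    congr 1
    push_cast
    ring

/-- Turns the isoclinic condition into the existence of a lattice fixed by the automorphism ϖ^(-r)
f^s, which is easier to iterate. -/
theorem image_iterate_eq_iff (hf : S.IsSemi f τ) {s : ℕ} {r : ℤ} {M : Submodule S.O V} :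
    f^[s] '' (M : Set V) = (fun x => S.ϖ ^ r • x) '' (M : Set V) ↔
      S.img (S.twist f s r) M = M := by
  have hcoe : f^[s] = ⇑(f ^ s) := Equiv.Perm.iterate_eq_pow f s
  have hinv : ∀ x : V, S.ϖ ^ (-r) • S.ϖ ^ r • x = x := fun x => by
    rw [smul_smul, ← zpow_add₀ S.ϖ_ne, neg_add_cancel, zpow_zero, one_smul]
  have hinv' : ∀ x : V, S.ϖ ^ r • S.ϖ ^ (-r) • x = x := fun x => by
    rw [smul_smul, ← zpow_add₀ S.ϖ_ne, add_neg_cancel, zpow_zero, one_smul]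
  rw [hcoe]
  constructor
  · intro h
    ext x
    rw [mem_img (hf.twist s r)]
    constructor
    · rintro ⟨y, hy, rfl⟩
      obtain ⟨z, hz, hzy⟩ : (f ^ s) y ∈ (fun x => S.ϖ ^ r • x) '' (M : Set V) := h ▸ ⟨y, hy, rfl⟩
      rw [twist_apply, ← hzy, hinv]
      exact hz
    · intro hx
      obtain ⟨y, hy, hyx⟩ : S.ϖ ^ r • x ∈ (f ^ s) '' (M : Set V) := h ▸ ⟨x, hx, rfl⟩
      exact ⟨y, hy, by rw [twist_apply, hyx, hinv]⟩
  · intro h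
    ext x
    constructor
    · rintro ⟨y, hy, rfl⟩
      refine ⟨S.twist f s r y, ?_, by simp only [twist_apply, hinv']⟩
      rw [SetLike.mem_coe, ← h]
      exact apply_mem_img hy
    · rintro ⟨y, hy, rfl⟩
      rw [SetLike.mem_coe, ← h, mem_img (hf.twist s r)] at hy
      obtain ⟨z, hz, rfl⟩ := hy
      exact ⟨z, hz, by simp only [twist_apply, hinv']⟩

theorem IsIsoclinicOf.of_restr {H : Submodule K V} {hH : f '' (H : Set V) = H}
    {E : Submodule K H} {α : ℚ} (h : S.IsIsoclinicOf (restr f H hH) E α) :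
    S.IsIsoclinicOf f (E.map H.subtype) α := by
  obtain ⟨h1, s, r, hs, hα, M, ⟨hfg, hspan⟩, hM⟩ := h
  have hit : ∀ x : H, (((restr f H hH)^[s] x : H) : V) = f^[s] x :=
    Function.Semiconj.iterate_right (f := ((↑) : H → V)) (ga := restr f H hH) (gb := f)
      (fun _ => rfl) s
  refine ⟨?_, s, r, hs, hα, M.map (H.subtype.restrictScalars S.O), ⟨hfg.map _, ?_⟩, ?_⟩
  · rw [Submodule.map_coe, Set.image_image]
    nth_rewrite 2 [← h1]
    rw [Set.image_image]
    rfl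
  · rw [← hspan, Submodule.map_span]
    rfl
  · rw [Submodule.map_coe, Set.image_image, Set.image_image]
    have h2 := congrArg (fun X : Set H => H.subtype '' X) hM
    simp only [Set.image_image] at h2
    refine (Set.image_congr fun x _ => (hit x).symm).trans (h2.trans ?_)
    rfl

end Isoclinic

section Decomposition

variable {V : Type u} [AddCommGroup V] [Module K V] {f g ψ : Equiv.Perm V} {τ ρ : RingAut K}

theorem img_span_range (hf : S.IsSemi f τ) {ι : Type*} (c : ι → V) :
    S.img f (Submodule.span S.O (Set.range c)) = Submodule.span S.O (Set.range (f ∘ c)) := by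
  rw [img_span hf, Set.range_comp]

theorem eq_zero_of_forall_mul_mem {c : K} (h : ∀ a : K, a * c ∈ S.O) : c = 0 :=
  S.eq_zero_of_forall_mem fun n => h (S.ϖ ^ (-(n : ℤ)))

/-- As `g` commutes with ψ, a denominator ϖ^m that is enough for `M₀` is enough for each ψ^j M₀,
hence for every term of the chain. -/
theorem exists_smul_apply_mem_iSup_chain (hψ : S.IsSemi ψ ρ) (hg : S.IsSemi g τ)
    (hc : Commute g ψ) {M₀ : Submodule S.O V} (h₀ : S.IsLat M₀) :
    ∃ m : ℕ, ∀ u ∈ ⨆ n, chain (S.img ψ) M₀ n,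
      S.ϖ ^ (m : ℤ) • g u ∈ ⨆ n, chain (S.img ψ) M₀ n := by
  obtain ⟨m, hm⟩ := h₀.exists_zpow_smul_mem (img_fg hg h₀.1)
  refine ⟨m, fun u hu => ?_⟩
  have hmono : Monotone (chain (S.img ψ) M₀) := chain_mono fun _ _ h => img_mono h
  have key : ∀ n, ∀ u ∈ chain (S.img ψ) M₀ n, S.ϖ ^ (m : ℤ) • g u ∈ chain (S.img ψ) M₀ n := by
    intro n
    induction n with
    | zero => exact fun u hu => hm m le_rfl _ (apply_mem_img hu)
    | succ n ih =>
      intro u hu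
      obtain ⟨x, hx, y, hy, rfl⟩ := Submodule.mem_sup.1 hu
      rw [hg.add, smul_add]
      refine Submodule.add_mem_sup (hm m le_rfl _ (apply_mem_img hx)) ?_
      obtain ⟨z, hz, rfl⟩ := (mem_img hψ).1 hy
      have : g (ψ z) = ψ (g z) := by
        rw [← Equiv.Perm.mul_apply, hc.eq, Equiv.Perm.mul_apply]
      rw [this, ← hψ.apply_zpow_smul]
      exact apply_mem_img (ih z hz)
  obtain ⟨n, hn⟩ := (Submodule.mem_iSup_of_directed _ hmono.directed_le).1 hu
  exact Submodule.mem_iSup_of_mem n (key n u hn)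

section

variable {κ : Type*} [Fintype κ] [DecidableEq κ] {b : Module.Basis κ K V} {T : κ → Prop}
  [DecidablePred T] {M₀ : Submodule S.O V}

omit [DecidableEq κ] [DecidablePred T] in
/-- The divisible part of the union of the chain is stable under everything which commutes with
`ψ`. -/
theorem apply_mem_divisible_part (hψ : S.IsSemi ψ ρ) (hg : S.IsSemi g τ)
    (hc : Commute g ψ) (h₀ : S.IsLat M₀)
    (hT : ∀ x, x ∈ (⨆ n, chain (S.img ψ) M₀ n) ↔ ∀ j, T j → b.repr x j ∈ S.O) {x : V}
    (hx : x ∈ Submodule.span K (Set.range fun j : {j // ¬ T j} => b j)) :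
    g x ∈ Submodule.span K (Set.range fun j : {j // ¬ T j} => b j) := by
  obtain ⟨m, hm⟩ := exists_smul_apply_mem_iSup_chain hψ hg hc h₀
  refine mem_span_of_repr_eq_zero b T fun i hi => ?_
  refine eq_zero_of_forall_mul_mem (S := S) fun a => ?_
  -- The scalar is chosen so that ϖ^m g turns it into `a`: every multiple of the i-th coordinate of
  -- g x is then integral, so that coordinate is 0.
  have h1 : (τ⁻¹ (S.ϖ ^ (-(m : ℤ)) * a)) • x ∈ ⨆ n, chain (S.img ψ) M₀ n :=
    (hT _).2 fun j hj => by
      rw [map_smul, Finsupp.smul_apply, repr_eq_zero_of_mem_span b T hx hj, smul_zero]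
      exact S.O.zero_mem
  have h2 := (hT _).1 (hm _ h1) i hi
  rwa [hg.smul, apply_inv_apply, smul_smul, ← mul_assoc, ← zpow_add₀ S.ϖ_ne, add_neg_cancel,
    zpow_zero, one_mul, map_smul, Finsupp.smul_apply, smul_eq_mul] at h2

/-- If the chain generated by `ψ` has a proper nonzero divisible part, then the latter has a
stable complement. -/
theorem exists_compl_divisible_part [FiniteDimensional K V] (hψ : S.IsSemi ψ ρ)
    (hf : S.IsSemi f τ) (hc : Commute f ψ) (h₀ : S.IsLat M₀)
    (hT : ∀ x, x ∈ (⨆ n, chain (S.img ψ) M₀ n) ↔ ∀ j, T j → b.repr x j ∈ S.O) :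
    ∃ C : Submodule K V, f '' (C : Set V) = C ∧
      IsCompl (Submodule.span K (Set.range fun j : {j // ¬ T j} => b j)) C := by
  set H : Submodule K V := Submodule.span K (Set.range fun j : {j // ¬ T j} => b j) with hHdef
  set U : Submodule S.O V := ⨆ n, chain (S.img ψ) M₀ n with hU
  have himono : Monotone (S.img ψ) := fun _ _ h => img_mono h
  have hmono : Monotone (chain (S.img ψ) M₀) := chain_mono himono
  have hψU : S.img ψ U ≤ U := map_iSup_chain_le (fun M hM => img_iSup_le hψ hM) himono
  have hHU : ∀ x ∈ H, x ∈ U := fun x hx => (hT x).2 fun j hj => by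
    rw [repr_eq_zero_of_mem_span b T hx hj]; exact S.O.zero_mem
  have hψH : ∀ x ∈ H, ψ x ∈ H := fun x hx =>
    apply_mem_divisible_part hψ hψ (Commute.refl ψ) h₀ hT hx
  have hψH' : ∀ x ∈ H, ψ⁻¹ x ∈ H := fun x hx =>
    apply_mem_divisible_part hψ hψ.inv (Commute.refl ψ).inv_left h₀ hT hx
  -- M₀ ∩ ψ(U) is finitely generated and lies in the increasing union of the ψ(M_n), hence in one of
  -- them.
  obtain ⟨n₀, hn₀⟩ := exists_le_of_fg
    (M := M₀ ⊓ S.img ψ U) (f := fun n => S.img ψ (chain (S.img ψ) M₀ n))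
    (Submodule.FG.of_le h₀.1 inf_le_left) (himono.comp hmono)
    (inf_le_right.trans (img_iSup_le hψ hmono))
  -- From n₀ on, ψ⁻¹ moves vectors of H one step back in the chain: the part in `M₀` of such a
  -- vector lies in ψ(U), hence in ψ(M_(n₀)).
  have hback : ∀ k, n₀ ≤ k → ∀ x ∈ H, x ∈ chain (S.img ψ) M₀ (k + 1) →
      ψ⁻¹ x ∈ chain (S.img ψ) M₀ k := by
    intro k hk x hx hxk
    obtain ⟨m, hm, y, hy, rfl⟩ := Submodule.mem_sup.1 hxk
    have hxU : m + y ∈ S.img ψ U :=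
      (mem_img hψ).2 ⟨_, hHU _ (hψH' _ hx), perm_apply_inv_apply _ _⟩
    have hyU : y ∈ S.img ψ U := img_mono (le_iSup (chain (S.img ψ) M₀) k) hy
    have hmU : m ∈ S.img ψ U := by
      have := Submodule.sub_mem _ hxU hyU
      rwa [add_sub_cancel_right] at this
    have h1 : m + y ∈ S.img ψ (chain (S.img ψ) M₀ k) :=
      Submodule.add_mem _ (img_mono (hmono hk) (hn₀ ⟨hm, hmU⟩)) hy
    obtain ⟨z, hz, hzx⟩ := (mem_img hψ).1 h1
    rw [← hzx]
    rwa [Equiv.Perm.inv_def, Equiv.symm_apply_apply]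
  have hback' : ∀ c : ℕ, ∀ x ∈ H, x ∈ chain (S.img ψ) M₀ (n₀ + c) →
      (ψ⁻¹ ^ c) x ∈ chain (S.img ψ) M₀ n₀ ∧ (ψ⁻¹ ^ c) x ∈ H := by
    intro c
    induction c with
    | zero => exact fun x hx h => ⟨h, hx⟩
    | succ c ih =>
      intro x hx h
      have h1 := ih _ (hψH' x hx) (hback (n₀ + c) (by omega) x hx h)
      rwa [← Equiv.Perm.mul_apply, ← pow_succ] at h1
  have hlat := isLat_chain (Φ := S.img ψ) (fun M hM => img_fg hψ hM.1) h₀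
  let M₁ : Submodule S.O V := chain (S.img ψ) M₀ n₀ ⊓ H.restrictScalars S.O
  have hM₁ : M₁.FG := Submodule.FG.of_le (hlat n₀).1 inf_le_left
  -- The finitely generated module ϖ⁻¹ M₁ lies in H ⊆ U, hence in some M_c ⊆ M_(n₀+c). Going back c
  -- steps sends it into M₁, so ψ^(-c) maps M₁ into ϖ M₁.
  obtain ⟨c, hcc⟩ := exists_le_of_fg (img_fg (isSemi_scale (S := S) (-1)) hM₁) hmono (by
    intro x hx
    obtain ⟨y, hy, rfl⟩ := (mem_img (isSemi_scale (-1))).1 hx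
    exact hHU _ (H.smul_mem _ hy.2))
  let θ : Equiv.Perm V := ψ ^ c
  have hθ : S.IsSemi θ (ρ ^ c) := hψ.pow c
  have hcon₁ : ∀ x ∈ M₁, S.ϖ ^ (-1 : ℤ) • θ⁻¹ x ∈ M₁ := by
    intro x hx
    have h1 := hmono (by omega : c ≤ n₀ + c) (hcc (apply_mem_img (f := S.scale V (-1)) hx))
    have h2 := hback' c _ (H.smul_mem _ hx.2) h1
    rw [hψ.inv.pow c |>.apply_zpow_smul, inv_pow] at h2
    exact h2
  have hθH : ∀ x ∈ H, θ x ∈ H := fun x hx =>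
    apply_mem_divisible_part hψ hθ ((Commute.refl ψ).pow_left c) h₀ hT hx
  have hθU : ∀ x ∈ U, θ x ∈ U := by
    have : ∀ n : ℕ, ∀ x ∈ U, (ψ ^ n) x ∈ U := by
      intro n
      induction n with
      | zero => exact fun x hx => hx
      | succ n ih =>
        intro x hx
        rw [pow_succ', Equiv.Perm.mul_apply]
        exact hψU (apply_mem_img (ih x hx))
    exact this c
  let N : Submodule S.O V := Submodule.span S.O (Set.range fun j : {j // T j} => b j)
  have hsplit : ∀ x ∈ U, ∃ y ∈ N, ∃ h ∈ H, x = y + h := by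
    intro x hx
    refine ⟨∑ j : {j // T j}, b.repr x j • b j, Submodule.sum_mem _ fun j _ =>
      S.smul_mem _ ((hT x).1 hx j j.2) (Submodule.subset_span ⟨j, rfl⟩),
      ∑ j : {j // ¬ T j}, b.repr x j • b j, Submodule.sum_mem _ fun j _ =>
        Submodule.smul_mem _ _ (Submodule.subset_span ⟨j, rfl⟩), ?_⟩
    rw [Fintype.sum_subtype_add_sum_subtype T (fun j => b.repr x j • b j), b.sum_repr]
  have hbU : ∀ j, b j ∈ U := fun j => (hT _).2 fun i _ => by
    rw [Module.Basis.repr_self, Finsupp.single_apply]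
    split_ifs
    · exact S.O.one_mem
    · exact S.O.zero_mem
  -- θ maps N into itself up to errors `h j` in H. Their denominators are absorbed by replacing M₁
  -- with M₂ = ϖ^(-m) M₁, on which θ⁻¹ still contracts.
  choose y hy h hh hyh using fun j : {j // T j} => hsplit _ (hθU _ (hbU j))
  have habs₁ : ∀ x ∈ H, ∃ n : ℕ, S.ϖ ^ n • x ∈ M₁ := fun x hx =>
    ((hlat n₀).2 x).imp fun n hn => ⟨hn, H.smul_mem _ hx⟩
  choose e he using fun j => habs₁ _ (hh j)
  let m : ℕ := Finset.univ.sup e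
  let M₂ : Submodule S.O V := S.img (S.scale V (-(m : ℤ))) M₁
  have hmem₂ : ∀ x, S.ϖ ^ (m : ℤ) • x ∈ M₁ → x ∈ M₂ := fun x hx => by
    have := apply_mem_img (f := S.scale V (-(m : ℤ))) hx
    rwa [scale_apply, smul_smul, ← zpow_add₀ S.ϖ_ne, neg_add_cancel, zpow_zero, one_smul] at this
  have hM₂ : ∀ x ∈ M₂, ∃ x' ∈ M₁, x = S.ϖ ^ (-(m : ℤ)) • x' := fun x hx => by
    obtain ⟨y, hy, rfl⟩ := (mem_img (isSemi_scale _)).1 hx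
    exact ⟨y, hy, rfl⟩
  have hhM : ∀ j, h j ∈ M₂ := fun j => hmem₂ _ (zpow_smul_mem_of_le (m := e j)
    (by exact_mod_cast Finset.le_sup (f := e) (Finset.mem_univ j)) (by simpa using he j))
  refine ⟨boundedPart hθ M₀, image_boundedPart h₀ hf (hc.pow_right c),
    isCompl_boundedPart (N := N) (M := M₂) hθ h₀ (Submodule.fg_span (Set.finite_range _))
      (img_fg (isSemi_scale _) hM₁) ?_ hθH ?_ ?_ ?_ ?_⟩
  · intro x hx
    obtain ⟨x', hx', rfl⟩ := hM₂ x hx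
    exact H.smul_mem _ hx'.2
  · intro x hx
    obtain ⟨n, hn⟩ := habs₁ x hx
    refine ⟨n, hmem₂ _ ?_⟩
    exact S.smul_mem _ (S.zpow_mem (by omega)) hn
  · intro x hx
    obtain ⟨x', hx', rfl⟩ := hM₂ x hx
    rw [hθ.inv.apply_zpow_smul, smul_comm]
    exact apply_mem_img (f := S.scale V (-(m : ℤ))) (hcon₁ x' hx')
  · intro x hx
    induction hx using Submodule.span_induction with
    | mem x hx =>
      obtain ⟨j, rfl⟩ := hx
      exact ⟨y j, hy j, h j, hhM j, hyh j⟩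
    | zero => exact ⟨0, N.zero_mem, 0, M₂.zero_mem, by rw [hθ.map_zero, add_zero]⟩
    | add x x' _ _ hx hx' =>
      obtain ⟨y, hy, k, hk, h⟩ := hx
      obtain ⟨y', hy', k', hk', h'⟩ := hx'
      exact ⟨y + y', N.add_mem hy hy', k + k', M₂.add_mem hk hk', by rw [hθ.add, h, h']; abel⟩
    | smul a x _ hx =>
      obtain ⟨y, hy, k, hk, h⟩ := hx
      have ha := hθ.mem_O.2 a.2
      refine ⟨(ρ ^ c) (a : K) • y, S.smul_mem _ ha hy, (ρ ^ c) (a : K) • k,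
        S.smul_mem _ ha hk, ?_⟩
      rw [← smul_add, ← h]
      exact hθ.smul _ _
  · intro x
    obtain ⟨n, hn⟩ := h₀.2 x
    exact ⟨n, hsplit _ ((le_iSup (chain (S.img ψ) M₀) 0) hn)⟩

end

/-- Either the whole space is isoclinic or it splits. -/
theorem isIsoclinicOf_top_or_exists_isCompl [FiniteDimensional K V] [Nontrivial V]
    (hf : S.IsSemi f τ) :
    (∃ α, S.IsIsoclinicOf f ⊤ α) ∨ ∃ H C : Submodule K V, IsCompl H C ∧ f '' (H : Set V) = H ∧
      f '' (C : Set V) = C ∧ H ≠ ⊥ ∧ H ≠ ⊤ := by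
  classical
  let n := Module.finrank K V
  have hn : 0 < n := Module.finrank_pos
  let b₀ := Module.finBasis K V
  have hP := isFrame_basis f b₀
  set r : ℤ := S.ord (Matrix.of fun i j => b₀.repr (f (b₀ j)) i).det with hr
  -- If V is isoclinic its slope must be r/n. This normalisation makes the determinant of ψ a unit:
  -- its valuation is -r n + n r.
  let ψ : Equiv.Perm V := S.twist f n r
  have hψ : S.IsSemi ψ (τ ^ n) := hf.twist n r
  have hdet : ∀ b : Module.Basis (Fin n) K V,
      S.ord (Matrix.of fun i j => b.repr (ψ (b j)) i).det = 0 := by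
    intro b
    obtain ⟨Q, hQ, hQdet⟩ := hP.exists_pow hf n
    have hQ' : IsFrame ψ b₀ (S.ϖ ^ (-r) • Q) := hQ.scale_mul (-r)
    rw [← hQ'.ord_det_eq hψ (isFrame_basis ψ b) (b₀.span_eq.trans b.span_eq.symm),
      ord_det_smul _ (hQ.det_ne_zero (hf.pow n)), hQdet, ← hr, Fintype.card_fin]
    change -r * (n : ℤ) + n * r = 0
    ring
  let M₀ : Submodule S.O V := Submodule.span S.O (Set.range b₀)
  have h₀ : S.IsLat M₀ := isLat_span_basis _
  have himono : Monotone (S.img ψ) := fun _ _ h => img_mono h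
  let U : Submodule S.O V := ⨆ n, chain (S.img ψ) M₀ n
  have hψU : S.img ψ U ≤ U := map_iSup_chain_le (fun M hM => img_iSup_le hψ hM) himono
  have hUabs : ∀ x : V, ∃ n : ℕ, S.ϖ ^ n • x ∈ U := fun x =>
    (h₀.2 x).imp fun _ h => (le_iSup (chain (S.img ψ) M₀) 0) h
  obtain ⟨b, -, T, -, hT⟩ := S.exists_adapted_basis n V rfl U hUabs (trivFil V) trivFil_antitone
    ⟨0, by simp [trivFil]⟩ ⟨1, by simp [trivFil]⟩
  -- If U is a lattice, then ψ U ⊆ U is an equality by volume and V is isoclinic. Otherwise the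
  -- divisible part of U is one of the two summands.
  by_cases hall : ∀ j, T j
  · left
    have hUb : U = Submodule.span S.O (Set.range b) := by
      ext x
      rw [hT, S.mem_span_basis]
      exact ⟨fun h j => h j (hall j), fun h j _ => h j⟩
    have hUlat : S.IsLat U := hUb ▸ isLat_span_basis b
    refine ⟨(r : ℚ) / n, ?_, n, r, hn, rfl, U, ⟨hUlat.1, hUlat.span_eq_top⟩,
      (image_iterate_eq_iff hf).2 (le_antisymm hψU ?_)⟩
    · rw [Submodule.top_coe, Set.image_univ]
      exact f.surjective.range_eq
    · have hF := isFrame_basis ψ b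
      rw [hUb, img_span_range hψ] at hψU ⊢
      exact S.span_le_span_of_det hF.map
        (fun i j => (S.mem_span_basis b).1 (hψU (Submodule.subset_span ⟨j, rfl⟩)) i)
        (hF.det_ne_zero hψ) (hdet b).le
  · push Not at hall
    obtain ⟨j₀, hj₀⟩ := hall
    right
    obtain ⟨C, hC, hcompl⟩ := exists_compl_divisible_part (T := T) (b := b) hψ hf
      (hf.commute_twist n r) h₀ hT
    refine ⟨_, C, hcompl, image_eq_of_forall_mem
      (fun x hx => apply_mem_divisible_part hψ hf (hf.commute_twist n r) h₀ hT hx)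
      (fun x hx => apply_mem_divisible_part hψ hf.inv (hf.commute_twist n r).inv_left h₀ hT hx),
      hC, fun hbot => ?_, fun htop => ?_⟩
    · have h1 : b j₀ ∈ Submodule.span K (Set.range fun j : {j // ¬ T j} => b j) :=
        Submodule.subset_span ⟨⟨j₀, hj₀⟩, rfl⟩
      rw [hbot, Submodule.mem_bot] at h1
      exact b.ne_zero j₀ h1
    -- The divisible part is proper: ψ preserves volumes, so its chain cannot exhaust V.
    · have hUtop : U = ⊤ := top_le_iff.1 fun x _ => (hT x).2 fun j hj => by
        rw [repr_eq_zero_of_mem_span b T (htop ▸ Submodule.mem_top) hj]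
        exact S.O.zero_mem
      have hfg : (⊤ : Submodule S.O V).FG := by
        refine fg_top_of_iSup_chain_eq_top himono (img_top hψ)
          (fun M hM => img_iSup_le hψ hM) (fun M hM => img_fg hψ hM.1) (fun M hM hle => ?_) h₀ hUtop
        obtain ⟨b', rfl⟩ := exists_basis_of_isLat (n := n) rfl hM
        rw [img_span_range hψ] at hle ⊢
        exact span_le_span_of_le b'.linearIndependent (isFrame_basis ψ b').map (hdet b').ge hle
      exact absurd (fun a => trivial) (not_forall_smul_mem_of_fg hfg (x := b j₀)
        (l := b.coord j₀) (by simp))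

/-- Every isocrystal is spanned by its isoclinic parts. -/
theorem sSup_isIsoclinicOf (n : ℕ) : ∀ (V : Type u) [AddCommGroup V] [Module K V]
    [FiniteDimensional K V] (_ : Module.finrank K V = n) (f : Equiv.Perm V) (τ : RingAut K)
    (_ : S.IsSemi f τ), sSup {E : Submodule K V | ∃ α, S.IsIsoclinicOf f E α} = ⊤ := by
  induction n using Nat.strong_induction_on with
  | _ n ih =>
  intro V _ _ _ hn f τ hf
  rcases subsingleton_or_nontrivial V with hV | hV
  · exact Subsingleton.elim _ _
  rcases isIsoclinicOf_top_or_exists_isCompl hf with h | ⟨H, C, hcompl, hH, hC, hbot, htop⟩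
  · exact top_le_iff.1 (le_sSup h)
  · have key : ∀ X : Submodule K V, X ≠ ⊤ → f '' (X : Set V) = X →
        X ≤ sSup {E : Submodule K V | ∃ α, S.IsIsoclinicOf f E α} := by
      intro X hX hfX
      have h1 := ih _ (hn ▸ Submodule.finrank_lt hX) X rfl (restr f X hfX) τ (hf.restr hfX)
      have h2 := congrArg (Submodule.map X.subtype) h1
      rw [Submodule.map_top, Submodule.range_subtype] at h2
      rw [← h2, Submodule.map_le_iff_le_comap]
      refine sSup_le ?_
      rintro E ⟨α, hE⟩
      rw [← Submodule.map_le_iff_le_comap]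
      exact le_sSup ⟨α, hE.of_restr⟩
    rw [eq_top_iff, ← hcompl.sup_eq_top]
    refine sup_le (key H htop hH) (key C (fun h => hbot ?_) hC)
    have := hcompl.inf_eq_bot
    rwa [h, inf_top_eq] at this

end Decomposition

end DVField

/-! ### Slope parts, their independence and the sum of the slopes. -/

namespace DVField

universe u

variable {K : Type*} [Field K] {S : DVField K}

section SlopeParts

variable {V : Type u} [AddCommGroup V] [Module K V] {f g : Equiv.Perm V} {τ ρ : RingAut K}

theorem img_pow_eq (hg : S.IsSemi g τ) {M : Submodule S.O V} (h : S.img g M = M) (t : ℕ) :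
    S.img (g ^ t) M = M := by
  induction t with
  | zero =>
    ext x
    rw [mem_img (hg.pow 0)]
    simp
  | succ t ih => rw [pow_succ, img_mul (hg.pow t) hg, h, ih]

theorem img_inv_eq (hg : S.IsSemi g τ) {M : Submodule S.O V} (h : S.img g M = M) :
    S.img g⁻¹ M = M := by
  nth_rewrite 1 [← h]
  rw [← img_mul hg.inv hg, inv_mul_cancel]
  ext x
  rw [mem_img IsSemi.one]
  simp

theorem img_sup (hg : S.IsSemi g τ) (M N : Submodule S.O V) :
    S.img g (M ⊔ N) = S.img g M ⊔ S.img g N := by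
  refine le_antisymm (fun x hx => ?_) (sup_le (img_mono le_sup_left) (img_mono le_sup_right))
  obtain ⟨y, hy, rfl⟩ := (mem_img hg).1 hx
  obtain ⟨a, ha, b, hb, rfl⟩ := Submodule.mem_sup.1 hy
  rw [hg.add]
  exact Submodule.add_mem_sup (apply_mem_img ha) (apply_mem_img hb)

theorem img_twist_mul (hf : S.IsSemi f τ) {s : ℕ} {r : ℤ} {M : Submodule S.O V}
    (h : S.img (S.twist f s r) M = M) (t : ℕ) :
    S.img (S.twist f (s * t) (r * t)) M = M := by
  rw [← twist_pow hf]
  exact img_pow_eq (hf.twist s r) h t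

theorem isIsoclinicOf_bot (hf : S.IsSemi f τ) (α : ℚ) : S.IsIsoclinicOf f ⊥ α := by
  refine ⟨by simp [hf.map_zero], α.den, α.num, α.pos, (Rat.num_div_den α).symm, ⊥,
    ⟨Submodule.fg_bot, by simp⟩, (image_iterate_eq_iff hf).2 ?_⟩
  simp [img, (hf.twist _ _).map_zero]

/-- Passing to the common exponent s s' makes both lattices fixed by the same automorphism, which
then fixes their sum. -/
theorem IsIsoclinicOf.sup (hf : S.IsSemi f τ) {E E' : Submodule K V} {α : ℚ}
    (h : S.IsIsoclinicOf f E α) (h' : S.IsIsoclinicOf f E' α) :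
    S.IsIsoclinicOf f (E ⊔ E') α := by
  obtain ⟨h1, s, r, hs, hα, M, ⟨hfg, hspan⟩, hM⟩ := h
  obtain ⟨h1', s', r', hs', hα', M', ⟨hfg', hspan'⟩, hM'⟩ := h'
  rw [image_iterate_eq_iff hf] at hM hM'
  have hrs : r * s' = r' * s := by
    have h2 : (r : ℚ) / s = r' / s' := hα.symm.trans hα'
    rw [div_eq_div_iff (by positivity) (by positivity)] at h2
    exact_mod_cast h2
  refine ⟨?_, s * s', r * s', Nat.mul_pos hs hs', ?_, M ⊔ M', ⟨hfg.sup hfg', ?_⟩,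
    (image_iterate_eq_iff hf).2 ?_⟩
  · ext x
    constructor
    · rintro ⟨y, hy, rfl⟩
      obtain ⟨a, ha, b, hb, rfl⟩ := Submodule.mem_sup.1 hy
      rw [hf.add]
      exact Submodule.add_mem_sup ((mem_iff_of_image_eq h1 a).2 ha)
        ((mem_iff_of_image_eq h1' b).2 hb)
    · intro hx
      obtain ⟨a, ha, b, hb, rfl⟩ := Submodule.mem_sup.1 hx
      rw [← SetLike.mem_coe, ← h1] at ha
      rw [← SetLike.mem_coe, ← h1'] at hb
      obtain ⟨a, ha, rfl⟩ := ha
      obtain ⟨b, hb, rfl⟩ := hb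
      exact ⟨a + b, Submodule.add_mem_sup ha hb, hf.add a b⟩
  · rw [hα]
    push_cast
    rw [mul_div_mul_right _ _ (by positivity)]
  · apply le_antisymm
    · rw [Submodule.span_le]
      intro x hx
      obtain ⟨a, ha, b, hb, rfl⟩ := Submodule.mem_sup.1 hx
      exact Submodule.add_mem_sup (hspan ▸ Submodule.subset_span ha)
        (hspan' ▸ Submodule.subset_span hb)
    · rw [← hspan, ← hspan']
      exact sup_le (Submodule.span_mono fun x hx => Submodule.mem_sup_left hx)
        (Submodule.span_mono fun x hx => Submodule.mem_sup_right hx)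
  · rw [img_sup (hf.twist _ _), img_twist_mul hf hM, hrs, mul_comm s, img_twist_mul hf hM']

/-- The largest isoclinic subspace of slope `α` of `D'`. -/
def slopePartOf (S : DVField K) (f : Equiv.Perm V) (D' : Submodule K V) (α : ℚ) :
    Submodule K V :=
  sSup {E | E ≤ D' ∧ S.IsIsoclinicOf f E α}

theorem slopePartOf_le (D' : Submodule K V) (α : ℚ) : S.slopePartOf f D' α ≤ D' :=
  sSup_le fun _ h => h.1

variable [FiniteDimensional K V]

/-- Isoclinic subspaces of one slope are closed under sums, so in finite dimension the supremum is
attained. -/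
theorem isIsoclinicOf_slopePartOf (hf : S.IsSemi f τ) (D' : Submodule K V) (α : ℚ) :
    S.IsIsoclinicOf f (S.slopePartOf f D' α) α := by
  obtain ⟨E, ⟨hED, hE⟩, hmax⟩ := set_has_maximal_iff_noetherian.2
    (inferInstance : IsNoetherian K V) {E | E ≤ D' ∧ S.IsIsoclinicOf f E α}
    ⟨⊥, bot_le, isIsoclinicOf_bot hf α⟩
  have : S.slopePartOf f D' α = E := by
    refine le_antisymm (sSup_le fun E' hE' => ?_) (le_sSup ⟨hED, hE⟩)
    have h1 := hmax (E ⊔ E') ⟨sup_le hED hE'.1, hE.sup hf hE'.2⟩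
    by_contra hlt
    exact h1 (left_lt_sup.2 hlt)
  rw [this]
  exact hE

theorem le_iSup_slopePartOf (hf : S.IsSemi f τ) {D' : Submodule K V}
    (hD' : f '' (D' : Set V) = D') : D' ≤ ⨆ α, S.slopePartOf f D' α := by
  have h1 := sSup_isIsoclinicOf _ D' rfl (restr f D' hD') τ (hf.restr hD')
  have h2 := congrArg (Submodule.map D'.subtype) h1
  rw [Submodule.map_top, Submodule.range_subtype] at h2
  nth_rewrite 1 [← h2]
  rw [Submodule.map_le_iff_le_comap]
  refine sSup_le ?_
  rintro E ⟨α, hE⟩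
  rw [← Submodule.map_le_iff_le_comap]
  have h3 : E.map D'.subtype ≤ S.slopePartOf f D' α :=
    le_sSup ⟨Submodule.map_subtype_le _ _, hE.of_restr⟩
  exact h3.trans (le_iSup (fun α => S.slopePartOf f D' α) α)

/-- Isoclinic subspaces of different slopes are independent. -/
theorem iSupIndep_of_isIsoclinicOf (hf : S.IsSemi f τ) {E : ℚ → Submodule K V}
    (hE : ∀ α, S.IsIsoclinicOf f (E α) α) : iSupIndep E := by
  classical
  rw [iSupIndep_iff_finsetSum_eq_zero_imp_eq_zero]
  intro s v hv hsum
  choose hEf s₀ r₀ hs₀ hα M₀ hM₀ hM₀' using hE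
  simp only [image_iterate_eq_iff hf] at hM₀'
  -- A common exponent: each lattice is fixed by ϖ^(-r α) f^t for the same t.
  let t : ℕ := ∏ α ∈ s, s₀ α
  have ht : ∀ α ∈ s, ∃ r : ℤ, (r : ℚ) = α * t ∧ S.img (S.twist f t r) (M₀ α) = M₀ α := by
    intro α hαs
    have h1 : t = s₀ α * ∏ β ∈ s.erase α, s₀ β := (Finset.mul_prod_erase s s₀ hαs).symm
    refine ⟨r₀ α * (∏ β ∈ s.erase α, s₀ β : ℕ), ?_, ?_⟩
    · have h2 : (s₀ α : ℚ) ≠ 0 := by exact_mod_cast (hs₀ α).ne'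
      have h3 : α * s₀ α = r₀ α := (eq_div_iff h2).1 (hα α)
      rw [h1]
      push_cast
      rw [← mul_assoc, h3]
    · rw [h1]
      exact img_twist_mul hf (hM₀' α) _
  have htpos : 0 < t := Finset.prod_pos fun α _ => hs₀ α
  choose! r hr hrM using ht
  by_contra! hne
  obtain ⟨α', hα's, hα'⟩ := hne
  let s' := s.filter fun α => v α ≠ 0
  have hs'ne : s'.Nonempty := ⟨α', Finset.mem_filter.2 ⟨hα's, hα'⟩⟩
  -- The smallest slope in the relation. With θ normalised to fix the lattice of slope α, each step
  -- of θ gains at least one factor ϖ on every other component.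
  obtain ⟨α, hαs', hmin⟩ := s'.exists_minimal hs'ne
  obtain ⟨hαs, hα0⟩ := Finset.mem_filter.1 hαs'
  apply hα0
  have hlt : ∀ β ∈ s'.erase α, r α + 1 ≤ r β := by
    intro β hβ
    obtain ⟨hβα, hβs'⟩ := Finset.mem_erase.1 hβ
    have h1 : α < β := lt_of_le_of_ne (by
      by_contra! h
      exact absurd (hmin hβs' h.le) (not_le.2 h)) (Ne.symm hβα)
    have h2 : (r α : ℚ) < r β := by
      rw [hr α hαs, hr β (Finset.mem_filter.1 hβs').1]
      exact mul_lt_mul_of_pos_right h1 (by exact_mod_cast htpos)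
    have h3 : r α < r β := by exact_mod_cast h2
    omega
  let W : Submodule S.O V := ⨆ β ∈ s'.erase α, M₀ β
  have hW : W.FG := Submodule.fg_biSup _ _ fun β _ => (hM₀ β).1
  have hvM : ∀ β, ∃ n : ℕ, β ∈ s → S.ϖ ^ n • v β ∈ M₀ β := fun β => by
    by_cases hβ : β ∈ s
    · obtain ⟨n, hn⟩ := absorbs_of_span (hM₀ β).2 (hv β hβ)
      exact ⟨n, fun _ => hn⟩
    · exact ⟨0, fun h => absurd h hβ⟩
  choose e he using hvM
  let m : ℕ := s.sup e
  have hm : ∀ β ∈ s, S.ϖ ^ (m : ℤ) • v β ∈ M₀ β := fun β hβ =>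
    zpow_smul_mem_of_le (m := e β) (by exact_mod_cast Finset.le_sup (f := e) hβ)
      (by simpa using he β hβ)
  let θ := S.twist f t (r α)
  have hθ : S.IsSemi θ (τ ^ t) := hf.twist _ _
  have hθn : ∀ n : ℕ, ∀ β ∈ s'.erase α, S.ϖ ^ (m - n : ℤ) • (θ ^ n) (v β) ∈ M₀ β := by
    intro n β hβ
    have hβs : β ∈ s := (Finset.mem_filter.1 (Finset.mem_erase.1 hβ).2).1
    have h1 := apply_mem_img (f := S.twist f t (r β) ^ n) (hm β hβs)
    rw [img_pow_eq (hf.twist _ _) (hrM β hβs), twist_pow hf, twist_apply,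
      (hf.pow _).apply_zpow_smul, smul_smul, ← zpow_add₀ S.ϖ_ne] at h1
    change S.ϖ ^ (m - n : ℤ) • (S.twist f t (r α) ^ n) (v β) ∈ M₀ β
    rw [twist_pow hf, twist_apply, smul_smul, ← zpow_add₀ S.ϖ_ne]
    refine zpow_smul_mem_of_le ?_ h1
    have := hlt β hβ
    nlinarith
  have hsum' : v α = - ∑ β ∈ s'.erase α, v β := by
    rw [eq_neg_iff_add_eq_zero, Finset.add_sum_erase s' v hαs', ← hsum]
    exact Finset.sum_filter_ne_zero s
  -- The relation transfers the decay of the other components to θ^n (v α). But θ^(-n) fixes `M₀ α`,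
  -- so `v α` itself is divisible by all powers of ϖ up to a bounded factor, hence zero.
  have hθα : ∀ n : ℕ, S.ϖ ^ (m - n : ℤ) • (θ ^ n) (v α) ∈ W ⊓ (E α).restrictScalars S.O := by
    intro n
    constructor
    · rw [hsum', (hθ.pow n).map_neg, (hθ.pow n).map_sum, smul_neg, Finset.smul_sum]
      refine W.neg_mem (W.sum_mem fun β hβ => ?_)
      exact Submodule.mem_iSup_of_mem β (Submodule.mem_iSup_of_mem hβ (hθn n β hβ))
    · have h1 := apply_mem_img (f := θ ^ n) (hm α hαs)
      rw [img_pow_eq hθ (hrM α hαs), (hθ.pow n).apply_zpow_smul] at h1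
      have h2 : S.ϖ ^ (m : ℤ) • (θ ^ n) (v α) ∈ E α := by
        rw [← (hM₀ α).2]
        exact Submodule.subset_span h1
      exact (E α).smul_mem _ (((E α).smul_mem_iff (S.zpow_ne _)).1 h2)
  obtain ⟨a, ha⟩ := exists_zpow_smul_mem_of_fg (M := M₀ α) (H := E α)
    (fun x hx => absorbs_of_span (hM₀ α).2 hx)
    (Submodule.FG.of_le hW (inf_le_left (b := (E α).restrictScalars S.O))) fun x hx => hx.2
  refine eq_zero_of_forall_smul_mem (hM₀ α).1 fun n => ?_
  have h1 := ha a le_rfl _ (hθα (n + a + m))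
  have h2 := apply_mem_img (f := (θ ^ (n + a + m))⁻¹) h1
  rw [img_inv_eq (hθ.pow _) (img_pow_eq hθ (hrM α hαs) _), smul_smul, ← zpow_add₀ S.ϖ_ne,
    (hθ.pow _).inv.apply_zpow_smul, Equiv.Perm.inv_def, Equiv.symm_apply_apply] at h2
  convert h2 using 3
  push_cast
  ring

/-- An isoclinic subspace of slope `α` and dimension `n` has degree `n * α`. -/
theorem IsIsoclinicOf.exists_isFrame (hf : S.IsSemi f τ) {E : Submodule K V} {α : ℚ}
    (h : S.IsIsoclinicOf f E α) :
    ∃ (c : Fin (Module.finrank K E) → V)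
      (P : Matrix (Fin (Module.finrank K E)) (Fin (Module.finrank K E)) K),
      IsFrame f c P ∧ Submodule.span K (Set.range c) = E ∧
        (S.ord P.det : ℚ) = Module.finrank K E * α := by
  obtain ⟨h1, s, r, hs, hα, M, ⟨hfg, hspan⟩, hM⟩ := h
  rw [image_iterate_eq_iff hf] at hM
  have hME : ∀ x ∈ M, x ∈ E := fun x hx => hspan ▸ Submodule.subset_span hx
  have hlat : S.IsLat (S.traceO M E) := by
    refine ⟨?_, fun x => absorbs_of_span hspan x.2⟩
    refine Submodule.fg_of_fg_map_injective (E.subtype.restrictScalars S.O)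
      Subtype.val_injective ?_
    have : (S.traceO M E).map (E.subtype.restrictScalars S.O) = M := by
      ext x
      constructor
      · rintro ⟨y, hy, rfl⟩
        exact hy
      · exact fun hx => ⟨⟨x, hME x hx⟩, hx, rfl⟩
    rw [this]
    exact hfg
  obtain ⟨b, hb⟩ := exists_basis_of_isLat rfl hlat
  let c : Fin (Module.finrank K E) → V := fun j => b j
  have hcM : M = Submodule.span S.O (Set.range c) := by
    apply le_antisymm
    · intro x hx
      have : (⟨x, hME x hx⟩ : E) ∈ Submodule.span S.O (Set.range b) := hb ▸ hx
      exact coe_mem_span this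
    · rw [Submodule.span_le]
      rintro _ ⟨j, rfl⟩
      have : b j ∈ S.traceO M E := hb ▸ Submodule.subset_span ⟨j, rfl⟩
      exact this
  have hci : LinearIndependent K c := b.linearIndependent.map' E.subtype E.ker_subtype
  have hcs : Submodule.span K (Set.range c) = E := span_coe_eq b.span_eq
  obtain ⟨P, hP⟩ := DVField.exists_isFrame (f := f) hci fun x hx => by
    rw [hcs] at hx ⊢
    exact (mem_iff_of_image_eq h1 x).2 hx
  refine ⟨c, P, hP, hcs, ?_⟩
  obtain ⟨Q, hQ, hQdet⟩ := hP.exists_pow hf s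
  have hQ' : IsFrame (S.twist f s r) c (S.ϖ ^ (-r) • Q) := hQ.scale_mul (-r)
  rw [hcM, img_span_range (hf.twist s r)] at hM
  have h2 : ∀ j, ∃ a : _ → S.O, ∑ i, a i • c i = S.twist f s r (c j) := fun j =>
    (Submodule.mem_span_range_iff_exists_fun S.O).1
      (hM ▸ Submodule.subset_span ⟨j, rfl⟩)
  have h3 : ∀ j, ∃ a : _ → S.O, ∑ i, a i • S.twist f s r (c i) = c j := fun j =>
    (Submodule.mem_span_range_iff_exists_fun S.O (v := S.twist f s r ∘ c)).1
      (by rw [hM]; exact Submodule.subset_span ⟨j, rfl⟩)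
  choose a ha using h2
  choose a' ha' using h3
  -- The matrix of ϖ^(-r) f^s and its inverse are both integral, so the determinant has valuation 0.
  -- This says s · ord det P = r · dim E.
  have h4 : S.ϖ ^ (-r) • Q = Matrix.of fun i j => (a j i : K) :=
    matrix_eq_of_sum_smul hci hQ'.map fun j => (ha j).symm
  have h5 : (S.ϖ ^ (-r) • Q) * Matrix.of (fun i j => (a' j i : K)) = 1 :=
    matrix_eq_of_sum_smul hci (sum_matrix_smul hQ'.map fun j => (ha' j).symm)
      (fun j => by simp [Matrix.one_apply])
  have h6 := congrArg Matrix.det h5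
  rw [Matrix.det_mul, Matrix.det_one] at h6
  have h7 := S.ord_mul (left_ne_zero_of_mul_eq_one h6) (right_ne_zero_of_mul_eq_one h6)
  rw [h6, S.ord_one] at h7
  have h8 : 0 ≤ S.ord (S.ϖ ^ (-r) • Q).det := by
    rw [h4, ← S.mem_O]
    exact S.det_mem fun i j => (a j i).2
  have h9 : 0 ≤ S.ord (Matrix.of (fun i j => (a' j i : K))).det :=
    S.mem_O.1 (S.det_mem fun i j => (a' j i).2)
  have h10 := ord_det_smul (S := S) (-r) (hQ.det_ne_zero (hf.pow s))
  rw [hQdet, Fintype.card_fin] at h10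
  have h11 : (s : ℤ) * S.ord P.det = r * Module.finrank K E := by
    have : S.ord (S.ϖ ^ (-r) • Q).det = 0 := by omega
    rw [this] at h10
    linarith
  have h12 : (s : ℚ) * S.ord P.det = r * Module.finrank K E := by exact_mod_cast h11
  have hs0 : (s : ℚ) ≠ 0 := by exact_mod_cast hs.ne'
  rw [hα]
  field_simp
  linarith

omit [FiniteDimensional K V] in
theorem IsFrame.sum {ι κ : Type*} [Fintype ι] [Fintype κ] {c : ι → V} {d : κ → V}
    {P : Matrix ι ι K} {Q : Matrix κ κ K} (hP : IsFrame f c P) (hQ : IsFrame f d Q)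
    (h : Disjoint (Submodule.span K (Set.range c)) (Submodule.span K (Set.range d))) :
    IsFrame f (Sum.elim c d) (Matrix.fromBlocks P 0 0 Q) := by
  refine ⟨hP.indep.sum_type hQ.indep h, ?_⟩
  rintro (j | j)
  · simp [hP.map, Fintype.sum_sum_type]
  · simp [hQ.map, Fintype.sum_sum_type]

/-- The sum of the slopes of a stable subspace is the valuation of the determinant. -/
theorem finsum_slopes_eq (hf : S.IsSemi f τ) {ι : Type*} [Fintype ι] [DecidableEq ι] {c : ι → V}
    {P : Matrix ι ι K} (hP : IsFrame f c P) :
    ∑ᶠ α : ℚ, (Module.finrank K (S.slopePartOf f (Submodule.span K (Set.range c)) α) : ℚ) * α =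
      S.ord P.det := by
  classical
  set D' := Submodule.span K (Set.range c) with hD'
  let E : ℚ → Submodule K V := S.slopePartOf f D'
  have hE : ∀ α, S.IsIsoclinicOf f (E α) α := isIsoclinicOf_slopePartOf hf D'
  have hind : iSupIndep E := iSupIndep_of_isIsoclinicOf hf hE
  have hfin : {α | E α ≠ ⊥}.Finite := WellFoundedGT.finite_ne_bot_of_iSupIndep hind
  -- Independence lets frames of the slope parts be joined into a block diagonal frame, along which
  -- valuations of determinants add.
  have key : ∀ s : Finset ℚ, ∃ (κ : Type) (_ : Fintype κ) (_ : DecidableEq κ) (d : κ → V)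
      (Q : Matrix κ κ K), IsFrame f d Q ∧ Submodule.span K (Set.range d) = s.sup E ∧
        (S.ord Q.det : ℚ) = ∑ α ∈ s, (Module.finrank K (E α) : ℚ) * α := by
    intro s
    induction s using Finset.induction_on with
    | empty =>
      refine ⟨Empty, inferInstance, inferInstance, Empty.elim, 1,
        ⟨linearIndependent_empty_type, fun j => j.elim⟩, by simp, by simp [S.ord_one]⟩
    | insert α s hα ih =>
      obtain ⟨κ, _, _, d, Q, hQ, hspan, hdeg⟩ := ih
      obtain ⟨e, R, hR, hspan', hdeg'⟩ := (hE α).exists_isFrame hf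
      have hdis : Disjoint (Submodule.span K (Set.range e)) (Submodule.span K (Set.range d)) := by
        rw [hspan, hspan']
        exact (hind α).mono_right (Finset.sup_le fun β hβ =>
          le_iSup₂_of_le β (show β ≠ α from fun h => hα (h ▸ hβ)) le_rfl)
      refine ⟨_, _, inferInstance, _, _, hR.sum hQ hdis, ?_, ?_⟩
      · rw [Set.Sum.elim_range, Submodule.span_union, hspan, hspan', Finset.sup_insert]
      · rw [Matrix.det_fromBlocks_zero₂₁, S.ord_mul (hR.det_ne_zero hf) (hQ.det_ne_zero hf),
          Finset.sum_insert hα, ← hdeg, ← hdeg']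
        push_cast
        rfl
  obtain ⟨κ, _, _, d, Q, hQ, hspan, hdeg⟩ := key hfin.toFinset
  have hD : Submodule.span K (Set.range c) = Submodule.span K (Set.range d) := by
    rw [hspan]
    apply le_antisymm
    · refine (le_iSup_slopePartOf hf (hP.image_span hf)).trans (iSup_le fun α => ?_)
      by_cases h : E α = ⊥
      · exact h.le.trans bot_le
      · exact Finset.le_sup (f := E) (hfin.mem_toFinset.2 h)
    · exact Finset.sup_le fun α _ => slopePartOf_le D' α
  rw [hP.ord_det_eq hf hQ hD, hdeg]
  refine finsum_eq_sum_of_support_subset _ fun α hα => ?_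
  rw [Set.Finite.coe_toFinset]
  intro h
  apply hα
  change (Module.finrank K (E α) : ℚ) * α = 0
  rw [h, finrank_bot]
  simp

end SlopeParts

end DVField

/-! ### From a complete ring with a uniformizer to a valued field. -/

namespace DVField

section OfRing

variable {T L : Type*} [CommRing T]

/-- A ring `T` which is separated and complete for the powers of `π` and whose elements are units
modulo `π` as soon as they are not divisible by `π`. -/
structure IsCompleteDV (π : T) : Prop where
  sep : ∀ t : T, (∀ n : ℕ, π ^ n ∣ t) → t = 0
  complete : ∀ a : ℕ → T, ∃ s : T, ∀ n, π ^ n ∣ s - ∑ j ∈ Finset.range n, π ^ j * a j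
  dvd_or : ∀ t : T, π ∣ t ∨ ∃ u, IsUnit u ∧ π ∣ t - u

namespace IsCompleteDV

variable {π : T}

/-- The inverse is the geometric series, which `complete` sums; `sep` turns the congruences modulo
all π^n into an equality. -/
theorem isUnit_one_sub (h : IsCompleteDV π) (t : T) : IsUnit (1 - π * t) := by
  obtain ⟨s, hs⟩ := h.complete fun j => t ^ j
  refine IsUnit.of_mul_eq_one s (sub_eq_zero.1 (h.sep _ fun n => ?_))
  have h1 : (1 - π * t) * ∑ j ∈ Finset.range n, π ^ j * t ^ j = 1 - (π * t) ^ n := by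
    simp only [← mul_pow]
    rw [mul_comm]
    exact geom_sum_mul_neg (π * t) n
  have h2 : (1 - π * t) * s - 1 =
      (1 - π * t) * (s - ∑ j ∈ Finset.range n, π ^ j * t ^ j) - (π * t) ^ n := by
    rw [mul_sub, h1]
    ring
  rw [h2]
  exact dvd_sub (Dvd.dvd.mul_left (hs n) _) (by rw [mul_pow]; exact dvd_mul_right _ _)

theorem dvd_or_isUnit (h : IsCompleteDV π) (t : T) : π ∣ t ∨ IsUnit t := by
  rcases h.dvd_or t with h1 | ⟨u, ⟨u, rfl⟩, s, hs⟩
  · exact Or.inl h1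
  · right
    have h2 : t = u * (1 - π * (-(↑u⁻¹ * s))) := by
      have : t = u + π * s := by rw [← hs]; ring
      have h3 : (u : T) * (π * (↑u⁻¹ * s)) = π * s := by
        rw [mul_left_comm, ← mul_assoc (u : T), Units.mul_inv, one_mul]
      rw [this, mul_sub, mul_one, mul_neg, mul_neg, h3]
      ring
    rw [h2]
    exact u.isUnit.mul (h.isUnit_one_sub _)

theorem exists_eq_pow_mul (h : IsCompleteDV π) {t : T} (ht : t ≠ 0) :
    ∃ (n : ℕ) (u : T), IsUnit u ∧ t = π ^ n * u := by
  classical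
  have h1 : ∃ n, ¬ π ^ n ∣ t := by
    by_contra! h2
    exact ht (h.sep t h2)
  obtain ⟨n, hn⟩ : ∃ n, Nat.find h1 = n + 1 := Nat.exists_eq_succ_of_ne_zero fun h0 => by
    have := Nat.find_spec h1
    rw [h0, pow_zero] at this
    exact this (one_dvd t)
  obtain ⟨s, hs⟩ := not_not.1 (Nat.find_min h1 (by omega : n < Nat.find h1))
  refine ⟨n, s, (h.dvd_or_isUnit s).resolve_left ?_, hs⟩
  rintro ⟨r, rfl⟩
  have := Nat.find_spec h1
  rw [hn] at this
  exact this ⟨r, by rw [hs]; ring⟩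

theorem not_isUnit [Nontrivial T] (h : IsCompleteDV π) : ¬ IsUnit π := fun hu =>
  one_ne_zero (h.sep 1 fun n => (hu.pow n).dvd)

/-- A nonzero element of T is a unit times a power of π, so it becomes a unit once π does, and every
element of L comes from T up to a power of π. -/
theorem isField [CommRing L] [Nontrivial L] (h : IsCompleteDV π) (g : T →+* L)
    (hπ : IsUnit (g π)) (hfrac : ∀ x : L, ∃ (n : ℕ) (t : T), g π ^ n * x = g t) : IsField L := by
  refine ⟨exists_pair_ne L, mul_comm, fun {x} hx => ?_⟩
  obtain ⟨n, t, hnt⟩ := hfrac x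
  have ht : t ≠ 0 := by
    rintro rfl
    rw [map_zero] at hnt
    exact hx ((hπ.pow n).mul_right_eq_zero.1 hnt)
  obtain ⟨m, u, hu, rfl⟩ := h.exists_eq_pow_mul ht
  have h1 : IsUnit (g π ^ n * x) := by
    rw [hnt, map_mul, map_pow]
    exact (hπ.pow m).mul (hu.map g)
  obtain ⟨y, hy⟩ := (isUnit_of_mul_isUnit_right h1).exists_right_inv
  exact ⟨y, hy⟩

variable [Field L] {g : T →+* L}

theorem map_ne_zero (h : IsCompleteDV π) (hπ : g π ≠ 0) {t : T} (ht : t ≠ 0) : g t ≠ 0 := by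
  obtain ⟨n, u, hu, rfl⟩ := h.exists_eq_pow_mul ht
  rw [map_mul, map_pow]
  exact mul_ne_zero (pow_ne_zero n hπ) (hu.map g).ne_zero

theorem exists_eq_zpow_mul (h : IsCompleteDV π) (hπ : g π ≠ 0)
    (hfrac : ∀ x : L, ∃ (n : ℕ) (t : T), g π ^ n * x = g t) {x : L} (hx : x ≠ 0) :
    ∃ (n : ℤ) (u : T), IsUnit u ∧ x = g π ^ n * g u := by
  obtain ⟨n, t, hnt⟩ := hfrac x
  have ht : t ≠ 0 := by
    rintro rfl
    rw [map_zero] at hnt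
    exact mul_ne_zero (pow_ne_zero n hπ) hx hnt
  obtain ⟨m, u, hu, rfl⟩ := h.exists_eq_pow_mul ht
  refine ⟨m - n, u, hu, ?_⟩
  rw [zpow_sub₀ hπ, zpow_natCast, zpow_natCast]
  rw [map_mul, map_pow] at hnt
  field_simp
  linear_combination hnt

theorem zpow_mul_mem_range_iff (h : IsCompleteDV π) (hπ : g π ≠ 0) {n : ℤ} {u : T}
    (hu : IsUnit u) : g π ^ n * g u ∈ g.range ↔ 0 ≤ n := by
  constructor
  · rintro ⟨t, ht⟩
    by_contra! hn
    have hnt : Nontrivial T := g.domain_nontrivial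
    have h1 : g u = g (π ^ (-n).toNat * t) := by
      rw [map_mul, map_pow, ht, ← zpow_natCast, ← mul_assoc, ← zpow_add₀ hπ]
      have : ((-n).toNat : ℤ) + n = 0 := by omega
      rw [this, zpow_zero, one_mul]
    have h2 : u = π ^ (-n).toNat * t := by
      by_contra hne
      exact h.map_ne_zero hπ (sub_ne_zero.2 hne) (by rw [map_sub, h1, sub_self])
    rw [h2] at hu
    have h3 := isUnit_of_mul_isUnit_left hu
    exact h.not_isUnit ((isUnit_pow_iff (by omega)).1 h3)
  · intro hn
    refine ⟨π ^ n.toNat * u, ?_⟩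
    rw [map_mul, map_pow, ← zpow_natCast, Int.toNat_of_nonneg hn]

theorem eq_of_zpow_mul_eq (h : IsCompleteDV π) (hπ : g π ≠ 0) {m n : ℤ} {u v : T}
    (hu : IsUnit u) (hv : IsUnit v) (heq : g π ^ m * g u = g π ^ n * g v) : m = n := by
  obtain ⟨u, rfl⟩ := hu
  obtain ⟨v, rfl⟩ := hv
  have hgu : g u ≠ 0 := (u.isUnit.map g).ne_zero
  have hgv : g v ≠ 0 := (v.isUnit.map g).ne_zero
  have key : ∀ (a b : ℤ) (x y : Tˣ), g π ^ a * g x = g π ^ b * g y → a ≤ b := by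
    intro a b x y hxy
    have h1 : g π ^ (b - a) * g (y : T) ∈ g.range := by
      refine ⟨x, ?_⟩
      rw [zpow_sub₀ hπ]
      have := zpow_ne_zero a hπ
      field_simp
      linear_combination hxy
    have := (h.zpow_mul_mem_range_iff hπ y.isUnit).1 h1
    omega
  exact le_antisymm (key _ _ _ _ heq) (key _ _ _ _ heq.symm)

open Classical in
/-- The valued field attached to a complete ring `T` with `L = T[1/π]`. -/
noncomputable def toDVField (h : IsCompleteDV π) (hπ : g π ≠ 0)
    (hfrac : ∀ x : L, ∃ (n : ℕ) (t : T), g π ^ n * x = g t) : DVField L :=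
  let ord : L → ℤ := fun x =>
    if hx : x ≠ 0 then (h.exists_eq_zpow_mul hπ hfrac hx).choose else 0
  -- The exponent is unique by `eq_of_zpow_mul_eq`, so the chosen representation does not matter.
  have hord : ∀ {n : ℤ} {u : T}, IsUnit u → ord (g π ^ n * g u) = n := by
    intro n u hu
    have h0 : g π ^ n * g u ≠ 0 := mul_ne_zero (zpow_ne_zero n hπ) (hu.map g).ne_zero
    obtain ⟨v, hv, hvx⟩ := (h.exists_eq_zpow_mul hπ hfrac h0).choose_spec
    simp only [ord, dif_pos h0]
    exact (h.eq_of_zpow_mul_eq hπ hu hv hvx).symm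
  { O := g.range
    ϖ := g π
    ord := ord
    ord_zero := by simp [ord]
    ord_mul := by
      intro a b ha hb
      obtain ⟨m, u, hu, rfl⟩ := h.exists_eq_zpow_mul hπ hfrac ha
      obtain ⟨n, v, hv, rfl⟩ := h.exists_eq_zpow_mul hπ hfrac hb
      have : g π ^ m * g u * (g π ^ n * g v) = g π ^ (m + n) * g (u * v) := by
        rw [zpow_add₀ hπ, map_mul]
        ring
      rw [this, hord hu, hord hv, hord (hu.mul hv)]
    mem_O := by
      intro a
      by_cases ha : a = 0
      · simp [ha, ord, zero_mem]
      · obtain ⟨m, u, hu, rfl⟩ := h.exists_eq_zpow_mul hπ hfrac ha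
        rw [hord hu]
        exact h.zpow_mul_mem_range_iff hπ hu
    ϖ_ne := hπ
    ord_ϖ := by
      have := hord (n := 1) isUnit_one
      rwa [zpow_one, map_one, mul_one] at this
    complete := by
      intro a ha
      choose b hb using ha
      obtain ⟨s, hs⟩ := h.complete b
      refine ⟨g s, fun n => ?_⟩
      obtain ⟨t, ht⟩ := hs n
      refine ⟨t, ?_⟩
      have h1 : g s - ∑ j ∈ Finset.range n, g π ^ j * a j = g π ^ n * g t := by
        rw [← map_pow, ← map_mul, ← ht, map_sub, map_sum]
        simp only [map_mul, map_pow, hb]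
      rw [h1]
      have := pow_ne_zero n hπ
      field_simp }

end IsCompleteDV

end OfRing

section Integral

variable {K : Type*} [Field K] (S : DVField K)

/-- A valuation ring is integrally closed. -/
theorem mem_O_of_isIntegral {x : K} (hx : IsIntegral S.O x) : x ∈ S.O := by
  let A : ValuationSubring K :=
    { S.O with
      mem_or_inv_mem' := fun y => by
        change y ∈ S.O ∨ y⁻¹ ∈ S.O
        rw [S.mem_O, S.mem_O, S.ord_inv]
        omega }
  have h1 : IsIntegral A x := hx
  obtain ⟨y, hy⟩ := IsIntegrallyClosed.isIntegral_iff.1 h1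
  rw [← hy]
  exact y.2

/-- Stability of O gives ord a ≤ ord (τ a); the same for a⁻¹ is the reverse inequality, so no
hypothesis on τ⁻¹ is needed. -/
theorem ord_map_eq {τ : RingAut K} (hϖ : τ S.ϖ = S.ϖ) (hO : ∀ a ∈ S.O, τ a ∈ S.O) (a : K) :
    S.ord (τ a) = S.ord a := by
  by_cases ha : a = 0
  · rw [ha, map_zero]
  have key : ∀ b : K, b ≠ 0 → S.ord b ≤ S.ord (τ b) := by
    intro b hb
    have h1 : S.ϖ ^ (-S.ord b) * b ∈ S.O := by
      rw [S.zpow_mul_mem hb]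
      omega
    have h2 := hO _ h1
    rw [map_mul, map_zpow₀, hϖ, S.zpow_mul_mem ((map_ne_zero τ).2 hb)] at h2
    omega
  have h1 := key a ha
  have h2 := key a⁻¹ (inv_ne_zero ha)
  rw [map_inv₀, S.ord_inv, S.ord_inv] at h2
  omega

end Integral

end DVField

/-! ### The ring O_F over W(k_F), and p-adic series over W(k). -/

namespace FilteredIsocrystal

section BaseField

variable (p : ℕ) [Fact p.Prime] (F : Type*) [Field F] [Algebra ℚ_[p] F]
  [Algebra ℤ_[p] F] [IsScalarTower ℤ_[p] ℚ_[p] F] [FiniteDimensional ℚ_[p] F]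

/-- The embedding `W(k_F) → O_F` makes `O_F` a `W(k_F)`-algebra. -/
noncomputable instance algebraWittOF : Algebra (WittVector p (KF p F)) (OF p F) :=
  (wittToOF p F).toAlgebra

instance isScalarTower_witt_OF : IsScalarTower (WittVector p (KF p F)) (OF p F) F :=
  IsScalarTower.of_algebraMap_eq fun _ => rfl

theorem natCast_OF_ne_zero : (p : OF p F) ≠ 0 := by
  have : CharZero F := charZero_of_injective_algebraMap (algebraMap ℚ_[p] F).injective
  intro h
  have h1 : ((p : OF p F) : F) = 0 := by rw [h]; rfl
  have h2 : (p : F) = 0 := by exact_mod_cast h1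
  exact (Fact.out : p.Prime).ne_zero (by exact_mod_cast h2)

instance isDiscreteValuationRing_OF : IsDiscreteValuationRing (OF p F) := by
  have h1 : IsDedekindDomain (OF p F) := IsIntegralClosure.isDedekindDomain ℤ_[p] ℚ_[p] F _
  have h2 : ¬ IsField (OF p F) := fun h => by
    let := h.toField
    exact not_isUnit_p p F (IsUnit.mk0 _ (natCast_OF_ne_zero p F))
  exact ((IsDiscreteValuationRing.TFAE (OF p F) h2).out 0 2).2 h1

/-- Ring homomorphisms agree on integers, which are dense modulo p^n, and O_F is p-adically
separated. So the map through W(k_F) induces the given ℤ_p-structure. -/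
theorem padicInt_ringHom_ext (f : ℤ_[p] →+* OF p F) : f = algebraMap ℤ_[p] (OF p F) := by
  ext1 x
  refine sub_eq_zero.1 (IsHausdorff.haus (I := Ideal.span {((p : ℕ) : OF p F)}) inferInstance _
    fun n => ?_)
  rw [SModEq.zero, smul_eq_mul, Ideal.mul_top, Ideal.span_singleton_pow, Ideal.mem_span_singleton]
  obtain ⟨y, hy⟩ := Ideal.mem_span_singleton.1 (PadicInt.appr_spec n x)
  have hx : x = x.appr n + p ^ n * y := by rw [← hy]; ring
  refine ⟨f y - algebraMap ℤ_[p] (OF p F) y, ?_⟩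
  conv_lhs => rw [hx]
  simp only [map_add, map_mul, map_pow, map_natCast]
  ring

theorem finite_witt_OF : Module.Finite (WittVector p (KF p F)) (OF p F) := by
  let i : ℤ_[p] →+* WittVector p (KF p F) :=
    (WittVector.map (ZMod.castHom (dvd_refl p) (KF p F))).comp
      (WittVector.equiv p).symm.toRingHom
  let : Algebra ℤ_[p] (WittVector p (KF p F)) := i.toAlgebra
  have : IsScalarTower ℤ_[p] (WittVector p (KF p F)) (OF p F) :=
    IsScalarTower.of_algebraMap_eq fun x =>
      (RingHom.congr_fun (padicInt_ringHom_ext p F ((wittToOF p F).comp i)) x).symm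
  have := finite_OF p F
  exact Module.Finite.of_restrictScalars_finite ℤ_[p] _ _

variable {p F}

theorem dvd_of_residue_eq_zero {π : OF p F} (hπ : Irreducible π) {x : OF p F}
    (hx : IsLocalRing.residue (OF p F) x = 0) : π ∣ x := by
  rwa [IsLocalRing.residue_eq_zero_iff, hπ.maximalIdeal_eq, Ideal.mem_span_singleton] at hx

/-- O_F and W(k_F) have the same residue field: a Teichmüller lift approximates x modulo π. -/
theorem exists_eq_wittToOF_add {π : OF p F} (hπ : Irreducible π) (x : OF p F) :
    ∃ v y, x = wittToOF p F v + π * y := by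
  obtain ⟨y, hy⟩ := dvd_of_residue_eq_zero hπ
    (x := x - wittToOF p F (WittVector.teichmuller p (IsLocalRing.residue (OF p F) x))) (by
      rw [map_sub, residue_wittToOF, WittVector.teichmuller_coeff_zero, sub_self])
  exact ⟨_, y, by rw [← hy]; ring⟩

theorem exists_associated_natCast_pow {π : OF p F} (hπ : Irreducible π) :
    ∃ e : ℕ, 1 ≤ e ∧ Associated (p : OF p F) (π ^ e) := by
  obtain ⟨e, he⟩ := IsDiscreteValuationRing.associated_pow_irreducible
    (natCast_OF_ne_zero p F) hπ
  refine ⟨e, ?_, he⟩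
  by_contra! h
  obtain rfl : e = 0 := by omega
  rw [pow_zero] at he
  exact not_isUnit_p p F (associated_one_iff_isUnit.1 he)

theorem exists_pow_mul_mem_OF {π : OF p F} (hπ : Irreducible π) (x : F) :
    ∃ n : ℕ, ∃ y : OF p F, (π : F) ^ n * x = y := by
  have : IsFractionRing (OF p F) F := IsIntegralClosure.isFractionRing_of_finite_extension
    ℤ_[p] ℚ_[p] F (OF p F)
  obtain ⟨a, b, hb, rfl⟩ := IsFractionRing.div_surjective (A := OF p F) x
  obtain ⟨n, u, hu⟩ := IsDiscreteValuationRing.associated_pow_irreducible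
    (nonZeroDivisors.ne_zero hb) hπ
  refine ⟨n, u * a, ?_⟩
  have hb0 : (b : F) ≠ 0 := fun h => nonZeroDivisors.ne_zero hb (Subtype.ext h)
  have h1 : (π : F) ^ n = b * ((u : OF p F) : F) := by exact_mod_cast congrArg Subtype.val hu.symm
  rw [h1]
  change (b : F) * ((u : OF p F) : F) * ((a : F) / (b : F)) = ((u : OF p F) : F) * (a : F)
  field_simp

end BaseField

section WittVectors

variable {p : ℕ} [Fact p.Prime] {k : Type*} [Field k] [CharP k p] [PerfectRing k p]

theorem exists_witt_sum_natCast_pow (a : ℕ → WittVector p k) :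
    ∃ s, ∀ n, (p : WittVector p k) ^ n ∣ s - ∑ j ∈ Finset.range n, (p : WittVector p k) ^ j * a j := by
  obtain ⟨s, hs⟩ := IsPrecomplete.prec (I := Ideal.span {(p : WittVector p k)}) inferInstance
    (f := fun n => ∑ j ∈ Finset.range n, (p : WittVector p k) ^ j * a j) (by
      intro m n hmn
      rw [smul_eq_mul, Ideal.mul_top, Ideal.span_singleton_pow, SModEq.sub_mem,
        Ideal.mem_span_singleton, ← dvd_neg, neg_sub, ← Finset.sum_Ico_eq_sub _ hmn]
      exact Finset.dvd_sum fun j hj =>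
        Dvd.dvd.mul_right (pow_dvd_pow _ (Finset.mem_Ico.1 hj).1) _)
  refine ⟨s, fun n => ?_⟩
  have := hs n
  rwa [smul_eq_mul, Ideal.mul_top, Ideal.span_singleton_pow, SModEq.sub_mem,
    Ideal.mem_span_singleton, ← dvd_neg, neg_sub] at this

variable {M : Type*} [AddCommGroup M] [Module (WittVector p k) M] [Module.Finite (WittVector p k) M]

theorem exists_module_sum_natCast_pow (a : ℕ → M) :
    ∃ s : M, ∀ n, ∃ y, s - ∑ j ∈ Finset.range n, (p : WittVector p k) ^ j • a j =
      (p : WittVector p k) ^ n • y := by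
  obtain ⟨m, f, hf⟩ := Module.Finite.exists_fin' (WittVector p k) M
  choose b hb using fun j => hf (a j)
  choose s hs using fun i => exists_witt_sum_natCast_pow fun j => b j i
  choose c hc using hs
  refine ⟨f s, fun n => ⟨f fun i => c i n, ?_⟩⟩
  have : s - ∑ j ∈ Finset.range n, (p : WittVector p k) ^ j • b j =
      (p : WittVector p k) ^ n • fun i => c i n := by
    ext1 i
    simpa using hc i n
  rw [← map_smul, ← this, map_sub, map_sum]
  simp only [map_smul, hb]

theorem eq_zero_of_forall_natCast_pow (x : M)
    (hx : ∀ n : ℕ, ∃ y, x = (p : WittVector p k) ^ n • y) : x = 0 := by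
  refine IsHausdorff.haus (I := IsLocalRing.maximalIdeal (WittVector p k)) inferInstance x
    fun n => ?_
  obtain ⟨y, hy⟩ := hx n
  rw [SModEq.zero, hy]
  refine Submodule.smul_mem_smul (Ideal.pow_mem_pow ?_ n) trivial
  exact (IsLocalRing.mem_maximalIdeal _).2 (WittVector.irreducible p).not_isUnit

end WittVectors

end FilteredIsocrystal

/-! ### The ring W(k) ⊗ O_F, the field L and its ring of integers. -/

namespace FilteredIsocrystal

section FieldL

variable (p : ℕ) [Fact p.Prime] (F : Type*) [Field F] [Algebra ℚ_[p] F]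
  [Algebra ℤ_[p] F] [IsScalarTower ℤ_[p] ℚ_[p] F] [FiniteDimensional ℚ_[p] F]
  (k : Type*) [Field k] [Algebra (KF p F) k]

/-- The ring `W(k) ⊗_{W(k_F)} O_F`. -/
abbrev WittOF : Type _ := WittVector p k ⊗[WittVector p (KF p F)] OF p F

/-- The natural map `W(k) ⊗_{W(k_F)} O_F → L`. -/
noncomputable def wittOFToL : WittOF p F k →+* L p F k :=
  ((Algebra.TensorProduct.map (IsScalarTower.toAlgHom (WittVector p (KF p F)) (OF p F) F)
    (AlgHom.id _ (WittVector p k))).comp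
    (Algebra.TensorProduct.comm (WittVector p (KF p F)) (WittVector p k) (OF p F)).toAlgHom).toRingHom

theorem wittOFToL_tmul (w : WittVector p k) (x : OF p F) :
    wittOFToL p F k (w ⊗ₜ x) = (x : F) ⊗ₜ w := rfl

theorem isUnit_wittOFToL {π : OF p F} (hπ : π ≠ 0) :
    IsUnit (wittOFToL p F k (1 ⊗ₜ π)) := by
  have h : (π : F) ≠ 0 := fun h => hπ (Subtype.ext h)
  exact (IsUnit.mk0 _ h).map (algebraMap F (L p F k))

theorem exists_pow_mul_eq_wittOFToL {π : OF p F} (hπ : Irreducible π) (x : L p F k) :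
    ∃ (n : ℕ) (t : WittOF p F k), wittOFToL p F k (1 ⊗ₜ π) ^ n * x = wittOFToL p F k t := by
  induction x using TensorProduct.induction_on with
  | zero => exact ⟨0, 0, by simp⟩
  | tmul f w =>
    obtain ⟨n, y, hy⟩ := exists_pow_mul_mem_OF hπ f
    refine ⟨n, w ⊗ₜ y, ?_⟩
    rw [wittOFToL_tmul, wittOFToL_tmul, Algebra.TensorProduct.tmul_pow,
      Algebra.TensorProduct.tmul_mul_tmul, hy, one_pow, one_mul]
  | add x y hx hy =>
    obtain ⟨m, s, hs⟩ := hx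
    obtain ⟨n, t, ht⟩ := hy
    refine ⟨m + n, (1 ⊗ₜ π) ^ n * s + (1 ⊗ₜ π) ^ m * t, ?_⟩
    simp only [map_add, map_mul, map_pow, ← hs, ← ht]
    ring

/-- W(k_F) embeds into F, and W(k), being torsion-free, is flat over W(k_F). -/
theorem nontrivial_L [CharP k p] [PerfectRing k p] : Nontrivial (L p F k) := by
  have h1 : Function.Injective (algebraMap (WittVector p (KF p F)) (WittVector p k)) :=
    WittVector.map_injective _ (algebraMap (KF p F) k).injective
  have h2 : Function.Injective (algebraMap (WittVector p (KF p F)) F) := by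
    have hF : CharZero F := charZero_of_injective_algebraMap (algebraMap ℚ_[p] F).injective
    refine (injective_iff_map_eq_zero _).2 fun x hx => ?_
    by_contra hx0
    obtain ⟨m, u, rfl⟩ := WittVector.exists_eq_pow_p_mul' x hx0
    rw [map_mul, map_pow, map_natCast] at hx
    exact mul_ne_zero (pow_ne_zero m (Nat.cast_ne_zero.2 (Fact.out : p.Prime).ne_zero))
      ((u.isUnit.map _).ne_zero) hx
  have : FaithfulSMul (WittVector p (KF p F)) (WittVector p k) :=
    (faithfulSMul_iff_algebraMap_injective _ _).2 h1
  have : Module.IsTorsionFree (WittVector p (KF p F)) (WittVector p k) := inferInstance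
  exact Algebra.TensorProduct.nontrivial_of_algebraMap_injective_of_flat_right _ _ _ h2

theorem finite_wittOF : Module.Finite (WittVector p k) (WittOF p F k) := by
  have := finite_witt_OF p F
  infer_instance

theorem natCast_smul_wittOF (n : ℕ) (t : WittOF p F k) :
    (p : WittVector p k) ^ n • t = (p : WittOF p F k) ^ n * t := by
  rw [Algebra.smul_def, map_pow, map_natCast]

theorem exists_associated_natCast_wittOF {π : OF p F} (hπ : Irreducible π) :
    ∃ e : ℕ, 1 ≤ e ∧ Associated (p : WittOF p F k) ((1 ⊗ₜ π) ^ e) := by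
  obtain ⟨e, he, h⟩ := exists_associated_natCast_pow hπ
  refine ⟨e, he, ?_⟩
  have := h.map (Algebra.TensorProduct.includeRight :
    OF p F →ₐ[WittVector p (KF p F)] WittOF p F k)
  rwa [map_natCast, map_pow] at this

/-- The ring is finite over W(k), hence p-adically complete and separated, and p is a unit times
ϖ^e, so the same holds for ϖ. Modulo ϖ each element comes from W(k), where an element is a unit or
divisible by p. -/
theorem isCompleteDV_wittOF [CharP k p] [PerfectRing k p] {π : OF p F} (hπ : Irreducible π) :
    DVField.IsCompleteDV (1 ⊗ₜ π : WittOF p F k) := by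
  have hfin := finite_wittOF p F k
  obtain ⟨e, he, u, hu⟩ := exists_associated_natCast_wittOF p F k hπ
  set ϖ : WittOF p F k := 1 ⊗ₜ π with hϖ
  refine ⟨fun t ht => ?_, fun a => ?_, fun t => ?_⟩
  · refine eq_zero_of_forall_natCast_pow (k := k) t fun n => ?_
    have h1 : (p : WittOF p F k) ^ n ∣ t := by
      have h2 : (p : WittOF p F k) ^ n ∣ ϖ ^ (e * n) := by
        rw [pow_mul, ← hu, mul_pow]
        exact dvd_mul_right _ _
      exact h2.trans (ht _)
    obtain ⟨y, hy⟩ := h1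
    exact ⟨y, by rw [hy, natCast_smul_wittOF]⟩
  -- The series in ϖ is grouped into blocks of e terms, which turns it into a series in p; the
  -- factor u^j compensates for ϖ^e = p u.
  · obtain ⟨s, hs⟩ := exists_module_sum_natCast_pow (k := k) fun j =>
      (u : WittOF p F k) ^ j * ∑ i ∈ Finset.range e, ϖ ^ i * a (e * j + i)
    have hsum : ∀ n, ∑ j ∈ Finset.range n, (p : WittVector p k) ^ j •
        ((u : WittOF p F k) ^ j * ∑ i ∈ Finset.range e, ϖ ^ i * a (e * j + i)) =
        ∑ j ∈ Finset.range (e * n), ϖ ^ j * a j := by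
      intro n
      induction n with
      | zero => simp
      | succ n ih =>
        rw [Finset.sum_range_succ, ih, mul_add_one, Finset.sum_range_add, natCast_smul_wittOF,
          ← mul_assoc, ← mul_pow, hu, ← pow_mul, Finset.mul_sum]
        simp only [← mul_assoc, ← pow_add]
    refine ⟨s, fun n => ?_⟩
    obtain ⟨y, hy⟩ := hs n
    rw [hsum, natCast_smul_wittOF] at hy
    have h1 : n ≤ e * n := Nat.le_mul_of_pos_left n he
    have h2 : s - ∑ j ∈ Finset.range n, ϖ ^ j * a j =
        (p : WittOF p F k) ^ n * y + ∑ j ∈ Finset.Ico n (e * n), ϖ ^ j * a j := by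
      rw [Finset.sum_Ico_eq_sub _ h1, ← hy]
      ring
    rw [h2]
    refine dvd_add (Dvd.dvd.mul_right ?_ _) (Finset.dvd_sum fun j hj =>
      Dvd.dvd.mul_right (pow_dvd_pow _ (Finset.mem_Ico.1 hj).1) _)
    refine pow_dvd_pow_of_dvd ?_ n
    have h3 : (p : WittOF p F k) = ϖ ^ e * ↑u⁻¹ := by rw [← hu, Units.mul_inv_cancel_right]
    rw [h3]
    exact Dvd.dvd.mul_right (dvd_pow_self _ (by omega)) _
  · have h1 : ∃ w : WittVector p k, ϖ ∣ t - w ⊗ₜ 1 := by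
      induction t with
      | zero => exact ⟨0, by simp⟩
      | tmul w x =>
        obtain ⟨v, y, rfl⟩ := exists_eq_wittToOF_add hπ x
        refine ⟨v • w, w ⊗ₜ y, ?_⟩
        have h2 : wittToOF p F v = v • (1 : OF p F) := by
          rw [Algebra.smul_def, mul_one]
          rfl
        rw [h2, TensorProduct.tmul_add, ← TensorProduct.smul_tmul, add_sub_cancel_left, hϖ,
          Algebra.TensorProduct.tmul_mul_tmul, one_mul]
      | add x y hx hy =>
        obtain ⟨v, hv⟩ := hx
        obtain ⟨w, hw⟩ := hy
        refine ⟨v + w, ?_⟩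
        rw [TensorProduct.add_tmul, add_sub_add_comm]
        exact dvd_add hv hw
    obtain ⟨w, hw⟩ := h1
    by_cases h0 : w.coeff 0 = 0
    · left
      obtain ⟨v, rfl⟩ := Ideal.mem_span_singleton.1
        ((WittVector.mem_span_p_iff_coeff_zero_eq_zero w).2 h0)
      have h2 : ϖ ∣ ((p : WittVector p k) * v) ⊗ₜ[WittVector p (KF p F)] (1 : OF p F) := by
        have h3 : ((p : WittVector p k) * v) ⊗ₜ[WittVector p (KF p F)] (1 : OF p F) =
            (p : WittOF p F k) * v ⊗ₜ 1 := by
          have h4 := natCast_smul_wittOF p F k 1 (v ⊗ₜ 1)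
          rwa [pow_one, pow_one, TensorProduct.smul_tmul', smul_eq_mul] at h4
        have h5 : (p : WittOF p F k) = ϖ ^ e * ↑u⁻¹ := by rw [← hu, Units.mul_inv_cancel_right]
        rw [h3, h5, mul_assoc]
        exact Dvd.dvd.mul_right (dvd_pow_self _ (by omega)) _
      simpa using dvd_add hw h2
    · exact Or.inr ⟨_, (WittVector.isUnit_of_coeff_zero_ne_zero w h0).map
        (Algebra.TensorProduct.includeLeft :
          WittVector p k →ₐ[WittVector p (KF p F)] WittOF p F k), hw⟩

theorem isField_L [CharP k p] [PerfectRing k p] {π : OF p F} (hπ : Irreducible π) :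
    IsField (L p F k) := by
  have := nontrivial_L p F k
  exact (isCompleteDV_wittOF p F k hπ).isField (wittOFToL p F k)
    (isUnit_wittOFToL p F k hπ.ne_zero) (exists_pow_mul_eq_wittOFToL p F k hπ)

/-- `σ` preserves the image of `W(k) ⊗ O_F`. -/
theorem sigma_mem_range {x : L p F k} (hx : x ∈ (wittOFToL p F k).range) :
    sigma p F k x ∈ (wittOFToL p F k).range := by
  obtain ⟨t, rfl⟩ := hx
  induction t using TensorProduct.induction_on with
  | zero => simp
  | tmul w y => exact ⟨sigma0 p F k w ⊗ₜ y, rfl⟩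
  | add s t hs ht =>
    rw [map_add, map_add]
    exact add_mem hs ht

theorem sigma_wittOFToL (π : OF p F) :
    sigma p F k (wittOFToL p F k (1 ⊗ₜ π)) = wittOFToL p F k (1 ⊗ₜ π) := by
  rw [wittOFToL_tmul]
  change (π : F) ⊗ₜ sigma0 p F k 1 = _
  rw [map_one]

theorem frobQ_surjective [PerfectField k] : Function.Surjective (frobQ p F k) := by
  have hk : CharP k p := charP_of_injective_algebraMap (algebraMap (KF p F) k).injective p
  have : PerfectRing k p := PerfectField.toPerfectRing p
  have := Fintype.ofFinite (KF p F)
  obtain ⟨n, -, hn⟩ := FiniteField.card (KF p F) p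
  intro y
  obtain ⟨x, hx⟩ := (iterateFrobeniusEquiv k p n).surjective y
  refine ⟨x, ?_⟩
  rw [frobQ_apply, Nat.card_eq_fintype_card, hn, ← hx, iterateFrobeniusEquiv_def]

theorem sigma_surjective [PerfectField k] : Function.Surjective (sigma p F k) :=
  TensorProduct.map_surjective Function.surjective_id
    (WittVector.map_surjective _ (frobQ_surjective p F k))

/-- The image of W(k) ⊗ O_F is integral because it is finite over W(k), and it is integrally closed
because it is a valuation ring of L. -/
theorem OL_eq_range [CharP k p] [PerfectRing k p] {π : OF p F} (hπ : Irreducible π) :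
    OL p F k = (wittOFToL p F k).range := by
  ext x
  constructor
  · intro hx
    let := (isField_L p F k hπ).toField
    have h0 := (isUnit_wittOFToL p F k hπ.ne_zero).ne_zero
    let S : DVField (L p F k) := (isCompleteDV_wittOF p F k hπ).toDVField h0
      (exists_pow_mul_eq_wittOFToL p F k hπ)
    refine DVField.mem_O_of_isIntegral S ?_
    have hle : (Algebra.TensorProduct.includeRight :
        WittVector p k →ₐ[WittVector p (KF p F)] L p F k).range.toSubring ≤ S.O := by
      rintro _ ⟨w, rfl⟩
      exact ⟨w ⊗ₜ 1, rfl⟩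
    exact IsIntegral.map_of_comp_eq (Subring.inclusion hle) (RingHom.id _) (by ext; rfl)
      ((mem_integralClosure_iff _ _).1 hx)
  · rintro ⟨t, rfl⟩
    have := finite_wittOF p F k
    refine (mem_integralClosure_iff _ _).2 (IsIntegral.map_of_comp_eq
      (Algebra.TensorProduct.includeRight :
        WittVector p k →ₐ[WittVector p (KF p F)] L p F k).rangeRestrict.toRingHom
      (wittOFToL p F k) (by ext; rfl) (Algebra.IsIntegral.isIntegral (R := WittVector p k) t))

end FieldL

end FilteredIsocrystal

/-! ### The two implications over an abstract valued field. -/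

namespace DVField

universe u

variable {K : Type*} [Field K] {S : DVField K} {V : Type u} [AddCommGroup V] [Module K V]
  [FiniteDimensional K V] {f : Equiv.Perm V} {τ : RingAut K}

theorem exists_eq_top_of_iSup {Fil : ℤ → Submodule K V} (hanti : Antitone Fil)
    (h : ⨆ i, Fil i = ⊤) : ∃ i, Fil i = ⊤ := by
  obtain ⟨n, hn⟩ := monotone_stabilizes_iff_noetherian.2 (inferInstance : IsNoetherian K V)
    ⟨fun n : ℕ => Fil (-n), fun m n hmn => hanti (by simpa using hmn)⟩
  refine ⟨-n, top_le_iff.1 (h ▸ iSup_le fun i => ?_)⟩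
  have h1 : Fil (-(n : ℤ)) = Fil (-((n + (-i).toNat : ℕ) : ℤ)) := hn _ (Nat.le_add_right _ _)
  rw [h1]
  exact hanti (by push_cast; omega)

theorem exists_eq_bot_of_iInf {Fil : ℤ → Submodule K V} (hanti : Antitone Fil)
    (h : ⨅ i, Fil i = ⊥) : ∃ i, Fil i = ⊥ := by
  obtain ⟨n, hn⟩ := IsArtinian.monotone_stabilizes (R := K) (M := V)
    ⟨fun n : ℕ => OrderDual.toDual (Fil n), fun m n hmn => hanti (by simpa using hmn)⟩
  refine ⟨n, le_bot_iff.1 (h ▸ le_iInf fun i => ?_)⟩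
  have h1 : Fil (n : ℤ) = Fil ((n + i.toNat : ℕ) : ℤ) := hn _ (Nat.le_add_right _ _)
  rw [h1]
  exact hanti (by push_cast; omega)

omit [FiniteDimensional K V] in
theorem isLat_traceO {M : Submodule S.O V} (hM : S.IsLat M) (H : Submodule K V) :
    S.IsLat (S.traceO M H) := by
  refine ⟨?_, fun x => hM.2 x⟩
  have := isNoetherian_of_fg_of_noetherian M hM.1
  refine Submodule.fg_of_fg_map_injective (H.subtype.restrictScalars S.O) Subtype.val_injective ?_
  refine isNoetherian_submodule.1 this _ ?_
  rintro _ ⟨x, hx, rfl⟩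
  exact hx

omit [FiniteDimensional K V] in
theorem coeff_mem_of_mem_span {ι κ : Type*} [Fintype ι] {b : ι → V}
    (hb : LinearIndependent K b) {c : κ → V} {Q : Matrix ι κ K} (hQ : ∀ j, c j = ∑ i, Q i j • b i)
    (h : ∀ j, c j ∈ Submodule.span S.O (Set.range b)) (i : ι) (j : κ) : Q i j ∈ S.O := by
  obtain ⟨r, hr⟩ := (Submodule.mem_span_range_iff_exists_fun S.O).1 (h j)
  have := hb.eq_coords_of_eq (f := fun i => Q i j) (g := fun i => (r i : K))
    ((hQ j).symm.trans hr.symm) i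
  exact this ▸ (r i).2

omit [FiniteDimensional K V] in
theorem linearIndependent_of_span_eq {d : ℕ} (hd : Module.finrank K V = d) {e : Fin d → V}
    {M : Submodule S.O V} (h : Submodule.span S.O (Set.range e) = M)
    (hM : Submodule.span K (M : Set V) = ⊤) : LinearIndependent K e := by
  refine linearIndependent_of_top_le_span_of_card_eq_finrank ?_ (by rw [Fintype.card_fin, hd])
  rw [← hM, Submodule.span_le, ← h]
  exact Submodule.span_subset_span S.O K _

/-- The conditions for a filtration to be admissible of type `μ`. -/
structure IsAdmissibleOf (S : DVField K) (f : Equiv.Perm V) {d : ℕ} (μ : Fin d → ℤ)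
    (Fil : ℤ → Submodule K V) : Prop where
  antitone : Antitone Fil
  iSup_eq : ⨆ i, Fil i = ⊤
  iInf_eq : ⨅ i, Fil i = ⊥
  gradedDim_eq : ∀ i, gradedDim Fil i = (Finset.univ.filter fun j => μ j = i).card
  degree_eq : (filDegree Fil : ℚ) =
    ∑ᶠ α : ℚ, (Module.finrank K (S.slopePartOf f ⊤ α) : ℚ) * α
  degree_le : ∀ D' : Submodule K V, f '' (D' : Set V) = D' →
    (filDegree (fun i => Fil i ⊓ D') : ℚ) ≤
      ∑ᶠ α : ℚ, (Module.finrank K (S.slopePartOf f D' α) : ℚ) * α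

/-- The family `e` is a basis of `M` such that the `ϖ ^ μ j • e j` form a basis of `f(M)`. -/
structure IsTypeBasis (S : DVField K) (f : Equiv.Perm V) {d : ℕ} (μ : Fin d → ℤ)
    (M : Submodule S.O V) (e : Fin d → V) : Prop where
  indep : LinearIndependent S.O e
  span_eq : (Submodule.span S.O (Set.range e) : Set V) = M
  indep_smul : LinearIndependent S.O fun j => S.ϖ ^ μ j • e j
  span_smul_eq : (Submodule.span S.O (Set.range fun j => S.ϖ ^ μ j • e j) : Set V) = f '' M

/-- For a strongly divisible lattice with adapted basis e, equality of degrees makes the vectors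
ϖ^(-v j) f(e j) a basis of the same lattice. Multiplied by ϖ^(v j) they become the basis f(e j) of
its image. -/
theorem exists_typeBasis (hf : S.IsSemi f τ) {d : ℕ} {μ : Fin d → ℤ}
    {Fil : ℤ → Submodule K V} (h : S.IsAdmissibleOf f μ Fil) :
    ∃ (M : Submodule S.O V) (e : Fin d → V), M.FG ∧ Submodule.span K (M : Set V) = ⊤ ∧
      S.IsTypeBasis f μ M e := by
  classical
  have htop := exists_eq_top_of_iSup h.antitone h.iSup_eq
  have hbot := exists_eq_bot_of_iInf h.antitone h.iInf_eq
  have hwa : S.WeaklyAdmissible f Fil := by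
    intro ι _ _ c w P hP hc
    have := h.degree_le _ (hP.image_span hf)
    rw [hc.filDegree_eq hP.indep, finsum_slopes_eq hf hP] at this
    exact_mod_cast this
  obtain ⟨b, w, hw, -⟩ := exists_adapted_basis_of_isLat (S := S) rfl
    (isLat_span_basis (Module.finBasis K V)) h.antitone htop hbot
  have hbw := isAdapted_basis b hw
  have hP := isFrame_basis f b
  have hdeg := h.degree_eq
  have h1 := hbw.filDegree_eq b.linearIndependent
  have h2 := finsum_slopes_eq hf hP
  rw [b.span_eq] at h1 h2
  simp only [inf_top_eq] at h1
  rw [h1, h2] at hdeg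
  obtain ⟨κ, _, e, v, he, hspan, hev, hmem⟩ := exists_strongly_divisible _ V rfl f τ hf Fil
    h.antitone htop hbot hwa _ b w _ hP hbw b.span_eq (by exact_mod_cast hdeg)
  obtain ⟨R, hR⟩ := exists_isFrame (f := f) he fun x _ => by rw [hspan]; trivial
  have hsum : ∑ j, v j = S.ord R.det := sum_weight_eq_ord_det hf hP hbw hR hev
    (by rw [b.span_eq, hspan]) (by exact_mod_cast hdeg)
  let E : κ → V := fun j => S.ϖ ^ (-v j) • f (e j)
  have hE : ∀ j, E j = ∑ i, (R * Matrix.diagonal fun j => S.ϖ ^ (-v j)) i j • e i :=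
    smul_apply_eq_sum hR v
  have hR0 := hR.det_ne_zero hf
  have hord := S.ord_det_mul_diagonal v hR0
  rw [hsum, sub_self] at hord
  have hdet0 : (R * Matrix.diagonal fun j => S.ϖ ^ (-v j)).det ≠ 0 := by
    rw [Matrix.det_mul, Matrix.det_diagonal]
    exact mul_ne_zero hR0 (Finset.prod_ne_zero_iff.2 fun j _ => S.zpow_ne _)
  have hEspan : Submodule.span S.O (Set.range E) = Submodule.span S.O (Set.range e) := by
    apply le_antisymm
    · rw [Submodule.span_le]
      rintro _ ⟨j, rfl⟩
      exact hmem j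
    · exact S.span_le_span_of_det hE (coeff_mem_of_mem_span he hE hmem) hdet0 hord.le
  -- Both μ and v count the dimensions of the graded pieces, so they agree up to a permutation of
  -- indices.
  have hfib : ∀ i, Nonempty ({j // μ j = i} ≃ {j // v j = i}) := fun i => by
    refine Fintype.card_eq.1 ?_
    have h3 := hev.gradedDim_eq he i
    rw [hspan] at h3
    simp only [inf_top_eq] at h3
    rw [Fintype.card_subtype, Fintype.card_subtype, ← h3, ← h.gradedDim_eq]
  let g : Fin d ≃ κ := Equiv.ofFiberEquiv fun i => (hfib i).some
  have hg : ∀ j, v (g j) = μ j := Equiv.ofFiberEquiv_map _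
  have hd : Module.finrank K V = d := by
    rw [Module.finrank_eq_card_basis (Module.Basis.mk he hspan.ge), ← Fintype.card_congr g,
      Fintype.card_fin]
  have hM : S.IsLat (Submodule.span S.O (Set.range e)) := by
    have := S.isLat_span_basis (Module.Basis.mk he hspan.ge)
    rwa [Module.Basis.coe_mk] at this
  have hspan1 : Submodule.span S.O (Set.range (E ∘ g)) = Submodule.span S.O (Set.range e) := by
    rw [g.surjective.range_comp, hEspan]
  have hEg : (fun j => S.ϖ ^ μ j • (E ∘ g) j) = (f ∘ e) ∘ g := by
    funext j
    simp only [E, Function.comp_apply, hg, smul_smul]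
    rw [← zpow_add₀ S.ϖ_ne, add_neg_cancel, zpow_zero, one_smul]
  have hspan2 : Submodule.span S.O (Set.range fun j => S.ϖ ^ μ j • (E ∘ g) j) =
      S.img f (Submodule.span S.O (Set.range e)) := by
    rw [hEg, g.surjective.range_comp, Set.range_comp, img_span hf]
  refine ⟨Submodule.span S.O (Set.range e), E ∘ g, hM.1, hM.span_eq_top, ?_, ?_, ?_, ?_⟩
  · exact (linearIndependent_of_span_eq hd hspan1 hM.span_eq_top).restrict_scalars'  _
  · rw [hspan1]
  · exact (linearIndependent_of_span_eq hd hspan2 (hM.img hf).span_eq_top).restrict_scalars' _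
  · rw [hspan2]
    ext x
    exact mem_img hf

/-- The filtration with the given jumps on the vectors of a basis. -/
def basisFil {ι : Type*} (b : Module.Basis ι K V) (w : ι → ℤ) (i : ℤ) : Submodule K V where
  carrier := {x | ∀ j, w j < i → b.repr x j = 0}
  add_mem' := fun hx hy j hj => by simp [hx j hj, hy j hj]
  zero_mem' := fun j _ => by simp
  smul_mem' := fun a x hx j hj => by simp [hx j hj]

omit [FiniteDimensional K V] in
theorem mem_basisFil {ι : Type*} (b : Module.Basis ι K V) (w : ι → ℤ) (i : ℤ) (x : V) :
    x ∈ basisFil b w i ↔ ∀ j, w j < i → b.repr x j = 0 := Iff.rfl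

omit [FiniteDimensional K V] in
theorem basisFil_antitone {ι : Type*} (b : Module.Basis ι K V) (w : ι → ℤ) :
    Antitone (basisFil b w) := fun _ _ hij _ hx j hj => hx j (hj.trans_le hij)

omit [FiniteDimensional K V] in
theorem exists_basisFil_eq_top {ι : Type*} [Finite ι] (b : Module.Basis ι K V) (w : ι → ℤ) :
    ∃ i, basisFil b w i = ⊤ := by
  obtain ⟨i, hi⟩ := (Set.finite_range w).bddBelow
  refine ⟨i, top_le_iff.1 fun x _ j hj => ?_⟩
  exact absurd (hi ⟨j, rfl⟩) hj.not_ge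

omit [FiniteDimensional K V] in
theorem exists_basisFil_eq_bot {ι : Type*} [Finite ι] (b : Module.Basis ι K V) (w : ι → ℤ) :
    ∃ i, basisFil b w i = ⊥ := by
  obtain ⟨i, hi⟩ := (Set.finite_range w).bddAbove
  refine ⟨i + 1, le_bot_iff.1 fun x hx => ?_⟩
  refine b.ext_elem fun j => ?_
  rw [hx j (Int.lt_add_one_iff.2 (hi ⟨j, rfl⟩)), map_zero, Finsupp.zero_apply]

/-- The filtration has jumps μ on the basis f⁻¹(ϖ^(μ j) e j) of M, chosen so that Φ carries it to e.
-/
theorem exists_admissible (hf : S.IsSemi f τ) {d : ℕ} (hd : Module.finrank K V = d)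
    {μ : Fin d → ℤ} {M : Submodule S.O V} {e : Fin d → V} (hfg : M.FG)
    (hspan : Submodule.span K (M : Set V) = ⊤) (he : S.IsTypeBasis f μ M e) :
    ∃ Fil : ℤ → Submodule K V, S.IsAdmissibleOf f μ Fil := by
  classical
  have hM := isLat_of_span hfg hspan
  have heM : Submodule.span S.O (Set.range e) = M := SetLike.coe_injective he.span_eq
  let g : Fin d → V := fun j => f⁻¹ (S.ϖ ^ μ j • e j)
  have hg : ∀ j, S.ϖ ^ (-μ j) • f (g j) = e j := fun j => by
    rw [perm_apply_inv_apply, smul_smul, ← zpow_add₀ S.ϖ_ne, neg_add_cancel, zpow_zero, one_smul]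
  have hinv : ∀ x, f⁻¹ (f x) = x := f.symm_apply_apply
  have hgM : Submodule.span S.O (Set.range g) = M := by
    have h1 : Set.range g = (f⁻¹ : Equiv.Perm V) '' Set.range fun j => S.ϖ ^ μ j • e j := by
      rw [← Set.range_comp]; rfl
    rw [h1, ← img_span hf.inv]
    ext x
    rw [mem_img hf.inv]
    have h2 : ∀ y, y ∈ Submodule.span S.O (Set.range fun j => S.ϖ ^ μ j • e j) ↔ y ∈ f '' M :=
      fun y => by rw [← he.span_smul_eq]; rfl
    simp only [h2]
    constructor
    · rintro ⟨_, ⟨y, hy, rfl⟩, rfl⟩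
      rwa [hinv]
    · exact fun hx => ⟨f x, ⟨x, hx, rfl⟩, by rw [hinv]⟩
  have hgi := linearIndependent_of_span_eq hd hgM hspan
  have hei := linearIndependent_of_span_eq hd heM hspan
  have hgspan : ⊤ ≤ Submodule.span K (Set.range g) := by
    rw [← hspan, ← hgM, Submodule.span_le]
    exact Submodule.span_subset_span S.O K _
  let b : Module.Basis (Fin d) K V := Module.Basis.mk hgi hgspan
  have hbg : ⇑b = g := Module.Basis.coe_mk _ _
  have hbw : IsAdapted (basisFil b μ) b μ := isAdapted_basis b (mem_basisFil b μ)
  have htop := exists_basisFil_eq_top b μ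
  have hbot := exists_basisFil_eq_bot b μ
  -- Φ(M) ⊆ M. Intersecting with a stable D' yields an integral matrix on M ∩ D', whence the
  -- inequality of degrees.
  have hmem : ∀ i x, x ∈ M → x ∈ basisFil b μ i → S.ϖ ^ (-i) • f x ∈ M := by
    intro i x hx hi
    rw [← hgM, ← hbg] at hx
    have hx' := (S.mem_span_basis b).1 hx
    rw [← b.sum_repr x, apply_sum_smul hf, Finset.smul_sum]
    refine M.sum_mem fun j _ => ?_
    by_cases hj : μ j < i
    · rw [hi j hj, map_zero, zero_smul, smul_zero]
      exact M.zero_mem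
    · have h1 : S.ϖ ^ (-i) • τ (b.repr x j) • f (b j) =
          (τ (b.repr x j) * S.ϖ ^ (μ j - i)) • e j := by
        rw [← hg j, hbg, smul_smul, smul_smul, mul_assoc, ← zpow_add₀ S.ϖ_ne, mul_comm]
        congr 3
        ring
      rw [h1]
      refine S.smul_mem M (S.O.mul_mem (hf.mem_O.2 (hx' j)) (S.zpow_mem (by omega))) ?_
      rw [← heM]
      exact Submodule.subset_span ⟨j, rfl⟩
  have hle : ∀ D' : Submodule K V, f '' (D' : Set V) = D' →
      (filDegree (fun i => basisFil b μ i ⊓ D') : ℚ) ≤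
        ∑ᶠ α : ℚ, (Module.finrank K (S.slopePartOf f D' α) : ℚ) * α := by
    intro D' hD'
    obtain ⟨c, w, hw, hc⟩ := exists_adapted_basis_of_isLat (S := S) rfl (isLat_traceO hM D')
      (Fil := fun i => (basisFil b μ i).comap D'.subtype)
      (fun i j hij => Submodule.comap_mono (basisFil_antitone b μ hij))
      (exists_eq_top_comap htop) (exists_eq_bot_comap hbot)
    have hcw := isAdapted_basis c hw
    have hcw' := isAdapted_comap_iff.1 hcw
    have hR := isFrame_basis (restr f D' hD') c
    have hR' := hR.of_restr
    have h1 := hcw'.filDegree_eq hR'.indep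
    have h2 := finsum_slopes_eq hf hR'
    rw [span_coe_eq c.span_eq] at h1 h2
    rw [h1, h2]
    have h3 := S.ord_det_mul_diagonal w (hR.det_ne_zero (hf.restr hD'))
    have h4 := S.det_mem (coeff_mem_of_mem_span hR.indep (smul_apply_eq_sum hR w) fun j => by
      rw [← hc, mem_traceO]
      refine hmem (w j) _ ?_ (hcw.apply_mem j)
      rw [← S.mem_traceO, hc]
      exact Submodule.subset_span ⟨j, rfl⟩)
    rw [S.mem_O, h3] at h4
    exact_mod_cast sub_nonneg.1 h4
  have hgr : ∀ i, gradedDim (basisFil b μ) i = (Finset.univ.filter fun j => μ j = i).card := by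
    intro i
    have := hbw.gradedDim_eq b.linearIndependent i
    rw [b.span_eq] at this
    simpa only [inf_top_eq] using this
  refine ⟨basisFil b μ, basisFil_antitone b μ, ?_, ?_, hgr, ?_, hle⟩
  · obtain ⟨i, hi⟩ := htop
    exact top_le_iff.1 (hi ▸ le_iSup (basisFil b μ) i)
  · obtain ⟨i, hi⟩ := hbot
    exact le_bot_iff.1 (hi ▸ iInf_le (basisFil b μ) i)
  · have hP := isFrame_basis f b
    have h2 := finsum_slopes_eq hf hP
    rw [b.span_eq] at h2
    rw [h2, filDegree_eq_sum hgr]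
    have h3 := smul_apply_eq_sum hP (S := S) μ
    have h5 : ∀ j, e j = ∑ i, (Matrix.of (fun i j => b.repr (f (b j)) i) *
        Matrix.diagonal fun j => S.ϖ ^ (-μ j)) i j • b i := fun j => by
      rw [← h3, hbg, hg]
    -- Both b and e are bases of M, so the inverse matrix is integral too. This bounds ord det f
    -- above by ∑ μ; the opposite bound is `hle` for the whole space.
    obtain ⟨R, hR⟩ : ∃ R : Matrix (Fin d) (Fin d) K, ∀ j, b j = ∑ i, R i j • e i := by
      have : ∀ j, ∃ r : Fin d → S.O, ∑ i, r i • e i = b j := fun j =>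
        (Submodule.mem_span_range_iff_exists_fun S.O).1 (by
          rw [heM, ← hgM, ← hbg]
          exact Submodule.subset_span ⟨j, rfl⟩)
      choose r hr using this
      exact ⟨Matrix.of fun i j => (r j i : K), fun j => (hr j).symm⟩
    have hRO := coeff_mem_of_mem_span (S := S) hei hR fun j => by
      rw [heM, ← hgM, ← hbg]
      exact Submodule.subset_span ⟨j, rfl⟩
    have h6 := matrix_eq_of_sum_smul b.linearIndependent (sum_matrix_smul h5 hR)
      (Q := 1) fun j => by simp [Matrix.one_apply]
    have h7 := congrArg Matrix.det h6
    rw [Matrix.det_mul, Matrix.det_one] at h7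
    have h8 := S.ord_mul (left_ne_zero_of_mul_eq_one h7) (right_ne_zero_of_mul_eq_one h7)
    rw [h7, S.ord_one, S.ord_det_mul_diagonal μ (hP.det_ne_zero hf)] at h8
    have h9 := S.mem_O.1 (S.det_mem hRO)
    have h10 := hle ⊤ (by rw [Submodule.top_coe, Set.image_univ, f.surjective.range_eq])
    simp only [inf_top_eq] at h10
    rw [h2, filDegree_eq_sum hgr] at h10
    have h11 : ∑ j, μ j ≤ S.ord (Matrix.of fun i j => b.repr (f (b j)) i).det := by
      exact_mod_cast h10
    exact_mod_cast le_antisymm h11 (by omega)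

end DVField

/-! ### Application to isocrystals over L. -/

namespace FilteredIsocrystal

variable {p : ℕ} [Fact p.Prime] {F : Type*} [Field F] [Algebra ℚ_[p] F]
  [Algebra ℤ_[p] F] [IsScalarTower ℤ_[p] ℚ_[p] F] [FiniteDimensional ℚ_[p] F]
  {k : Type*} [Field k] [PerfectField k] [Algebra (KF p F) k]

/-- The field `L` with its valuation ring `O_L`. -/
noncomputable def dvFieldL [CharP k p] [PerfectRing k p] {π : OF p F} (hπ : Irreducible π) :
    letI := (isField_L p F k hπ).toField
    DVField (L p F k) :=
  letI := (isField_L p F k hπ).toField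
  let S := (isCompleteDV_wittOF p F k hπ).toDVField (g := wittOFToL p F k)
    (isUnit_wittOFToL p F k hπ.ne_zero).ne_zero (exists_pow_mul_eq_wittOFToL p F k hπ)
  { S with
    -- The image of W(k) ⊗ O_F is replaced by the equal subring `OL`, so that O_L-submodules are
    -- literally submodules over the valuation ring.
    O := OL p F k
    mem_O := by
      rw [OL_eq_range p F k hπ]
      exact S.mem_O
    complete := by
      rw [OL_eq_range p F k hπ]
      exact S.complete }

end FilteredIsocrystal

open FilteredIsocrystal in
theorem proposition1p3 (p : ℕ) [Fact p.Prime]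
    (F : Type*) [Field F] [Algebra ℚ_[p] F] [FiniteDimensional ℚ_[p] F]
    [Algebra ℤ_[p] F] [IsScalarTower ℤ_[p] ℚ_[p] F]
    (k : Type*) [Field k] [PerfectField k] [Algebra (KF p F) k]
    (π : OF p F) (hπ : Irreducible π)
    (D : Type*) [AddCommGroup D] [Module (L p F k) D] [Module.Finite (L p F k) D]
    (φ : D →ₛₗ[sigma p F k] D) (hφ : Function.Bijective φ)
    (d : ℕ) (hd : Module.finrank (L p F k) D = d)
    (μ : Fin d → ℤ) (hμ : Antitone μ) :
    (∃ Fil : ℤ → Submodule (L p F k) D,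
        IsFiltration Fil ∧ HasType Fil μ ∧ IsAdmissible φ π Fil) ↔
      ∃ M : Submodule (OL p F k) D, IsLatticeOf M ⊤ ∧ LatticeHasType φ π M μ := by
  have : CharP k p := charP_of_injective_algebraMap (algebraMap (KF p F) k).injective p
  have : PerfectRing k p := PerfectField.toPerfectRing p
  let := (isField_L p F k hπ).toField
  let S : DVField (L p F k) := dvFieldL hπ
  let τ : RingAut (L p F k) := RingEquiv.ofBijective (sigma p F k)
    ⟨(sigma p F k).injective, sigma_surjective p F k⟩
  let f : Equiv.Perm D := Equiv.ofBijective φ hφ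
  have hτϖ : τ S.ϖ = S.ϖ := sigma_wittOFToL p F k π
  have hf : S.IsSemi f τ := by
    refine ⟨S.ord_map_eq hτϖ fun a ha => ?_, hτϖ, map_add φ, fun a x => φ.map_smulₛₗ a x⟩
    have ha' : a ∈ OL p F k := ha
    change sigma p F k a ∈ OL p F k
    rw [OL_eq_range p F k hπ] at ha' ⊢
    exact sigma_mem_range p F k ha'
  have hpi : ∀ n : ℤ, piPow k π n = S.ϖ ^ n := fun n =>
    map_zpow₀ (algebraMap F (L p F k)) (π : F) n
  -- Once `piPow` is rewritten as a power of ϖ, the concrete and the abstract definitions agree by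
  -- unfolding.
  have hiso : ∀ E α, IsIsoclinic φ π E α ↔ S.IsIsoclinicOf f E α := by
    intro E α
    unfold IsIsoclinic
    simp only [hpi]
    rfl
  have hslope : ∀ D' α, slopePart φ π D' α = S.slopePartOf f D' α := by
    intro D' α
    unfold slopePart
    simp only [hiso]
    rfl
  have hnewton : ∀ D', newtonDegree φ π D' =
      ∑ᶠ α : ℚ, (Module.finrank (L p F k) (S.slopePartOf f D' α) : ℚ) * α := by
    intro D'
    exact finsum_congr fun α => by rw [← hslope]
  have : FiniteDimensional (L p F k) D := ‹Module.Finite (L p F k) D›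
  constructor
  · rintro ⟨Fil, h1, h2, h3⟩
    have h : S.IsAdmissibleOf f μ Fil :=
      ⟨h1.antitone, h1.exhaustive, h1.separated, h2, (hnewton ⊤).symm ▸ h3.eq_degree,
        fun D' hD' => (hnewton D').symm ▸ h3.le_degree D' hD'⟩
    obtain ⟨M, e, hfg, hspan, he⟩ := DVField.exists_typeBasis hf h
    refine ⟨M, ⟨hfg, hspan⟩, e, ⟨he.indep, he.span_eq⟩, ?_⟩
    simp only [hpi]
    exact ⟨he.indep_smul, he.span_smul_eq⟩
  · rintro ⟨M, ⟨hfg, hspan⟩, e, h1, h2⟩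
    simp only [hpi] at h2
    obtain ⟨Fil, h⟩ := DVField.exists_admissible (μ := μ) (e := e) hf hd hfg hspan
      ⟨h1.1, h1.2, h2.1, h2.2⟩
    exact ⟨Fil, ⟨h.antitone, h.iSup_eq, h.iInf_eq⟩, h.gradedDim_eq,
      ⟨(hnewton ⊤).symm ▸ h.degree_eq, fun D' hD' => (hnewton D').symm ▸ h.degree_le D' hD'⟩⟩
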